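/- Let $(M,\omega)$ be a compact connected symplectic manifold of dimension $2n$ and let $\mu=\omega^n/n!$ be its Liouville measure (so $0<\mu(M)<\infty$). Let $\pi:P\to M$ be a prequantum bundle, that is, a smooth principal $U(1)$-bundle with a connection form $\alpha\in\Omega^1(P,\mathbb R)$ such that $\alpha(\partial_\theta)=1$ and $d\alpha+\pi^*\omega=0$, where $\partial_\theta$ is the infinitesimal generator of the $U(1)$-action. Let $\mathrm{Preq}$ be the group of diffeomorphisms of $P$ which commute with the $U(1)$-action and preserve $\alpha$, and let $\mathcal P(\mathrm{Preq})$ be the group, under pointwise product, of smooth paths $\gamma=(\gamma_t)_{t\in[0,1]}$ in $\mathrm{Preq}$ with $\gamma_0=\mathrm{id}$. Let $\widetilde{\mathrm{Preq}}^0$ be the quotient of $\mathcal P(\mathrm{Preq})$ by smooth homotopy with fixed endpoints (the universal cover of the identity component of $\mathrm{Preq}$), and let $R:\mathbb R\to\widetilde{\mathrm{Preq}}^0$ be the morphism sending $\tau$ to the class of the path of rotations $t\mapsto e^{it\tau}$. Every $\gamma\in\mathcal P(\mathrm{Preq})$ has a generating Hamiltonian, that is, a (unique) smooth function $f:[0,1]\times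 M\to\mathbb R$, $f_t = f(t,\cdot)$, such that the vector fields $Y_t$ on $P$ with $\frac{d}{dt}\gamma_t=Y_t\circ\gamma_t$ are given by $Y_t=X_t^{\mathrm{hor}}-(\pi^*f_t)\,\partial_\theta$, where $X_t$ is the vector field on $M$ with $\omega(X_t,\cdot)+df_t=0$ and $X_t^{\mathrm{hor}}$ is its lift with $\alpha(X_t^{\mathrm{hor}})=0$. Put $$\mathrm{Cal}(\gamma)=\int_0^1\Bigl(\int_M f_t\,\mu\Bigr)dt .$$ Then: 1. $\mathrm{Cal}:\mathcal P(\mathrm{Preq})\to\mathbb R$ is a group morphism, and it descends to a group morphism $\mathrm{Cal}:\widetilde{\mathrm{Preq}}^0\to\mathbb R$. 2. For every $\tau\in\mathbb R$, $\mathrm{Cal}(R(\tau))=-\tau\,\mu(M)$. (In particular it is $-\tau$ if $\mu(M)=1$.) 3. For $g\in\widetilde{\mathrm{Preq}}^0$, $\mathrm{Cal}(g)=0$ if and only if $g$ is the class of a path whose generating Hamiltonian is normalised, that is, $\int_M f_t\,\mu=0$ for every $t\in[0,1]$. -/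

import Mathlib

open scoped Manifold ContDiff Topology
open MeasureTheory

noncomputable section

/-! ### Differential forms on manifolds -/

/-- Differential `k`-forms (without regularity condition) on a manifold modelled on `ℝ^m`. -/
abbrev DForm (m : ℕ) (N : Type*) [TopologicalSpace N]
    [ChartedSpace (EuclideanSpace ℝ (Fin m)) N] (k : ℕ) : Type _ :=
  ∀ x : N, TangentSpace (𝓡 m) x [⋀^Fin k]→L[ℝ] ℝ

namespace DForm

variable {m m' m'' k : ℕ}
  {N : Type*} [TopologicalSpace N] [ChartedSpace (EuclideanSpace ℝ (Fin m)) N]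
  {N' : Type*} [TopologicalSpace N'] [ChartedSpace (EuclideanSpace ℝ (Fin m')) N']
  {N'' : Type*} [TopologicalSpace N''] [ChartedSpace (EuclideanSpace ℝ (Fin m'')) N'']

/-- The expression of a form in the preferred chart at `x₀`, that is, its pull-back by the inverse
of that chart. It is meaningful on the target of the chart. -/
def inChart (η : DForm m N k) (x₀ : N) (y : EuclideanSpace ℝ (Fin m)) :
    EuclideanSpace ℝ (Fin m) [⋀^Fin k]→L[ℝ] ℝ :=
  (η ((extChartAt (𝓡 m) x₀).symm y)).compContinuousLinearMap
    (mfderiv 𝓘(ℝ, EuclideanSpace ℝ (Fin m)) (𝓡 m) (extChartAt (𝓡 m) x₀).symm y)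

/-- A form is smooth if its expressions in all the charts are smooth. -/
def IsSmooth (η : DForm m N k) : Prop :=
  ∀ x₀ : N, ContDiffOn ℝ ∞ (η.inChart x₀) (extChartAt (𝓡 m) x₀).target

/-- The exterior derivative of a form, computed at each point in the chart at that point. -/
def d (η : DForm m N k) : DForm m N (k + 1) := fun x =>
  (extDeriv (η.inChart x) (extChartAt (𝓡 m) x x)).compContinuousLinearMap
    (mfderiv (𝓡 m) 𝓘(ℝ, EuclideanSpace ℝ (Fin m)) (extChartAt (𝓡 m) x) x)

/-- The pull-back of a form by a map. -/
def pullback (F : N → N') (η : DForm m' N' k) : DForm m N k := fun x =>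
  (η (F x)).compContinuousLinearMap (mfderiv (𝓡 m) (𝓡 m') F x)

theorem pullback_id (η : DForm m N k) : pullback (fun x : N => x) η = η := by
  funext x
  ext v
  have h : mfderiv (𝓡 m) (𝓡 m) (fun x : N => x) x = ContinuousLinearMap.id ℝ _ := mfderiv_id
  simp only [pullback, h]
  rfl

theorem pullback_comp {F : N → N'} {G : N' → N''} (hF : ContMDiff (𝓡 m) (𝓡 m') ∞ F)
    (hG : ContMDiff (𝓡 m') (𝓡 m'') ∞ G) (η : DForm m'' N'' k) :
    pullback (m := m) (fun x => G (F x)) η = pullback (m := m) F (pullback (m := m') G η) := by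
  funext x
  ext v
  have h : mfderiv (𝓡 m) (𝓡 m'') (fun x => G (F x)) x =
      (mfderiv (𝓡 m') (𝓡 m'') G (F x)).comp (mfderiv (𝓡 m) (𝓡 m') F x) :=
    mfderiv_comp x (hG.mdifferentiable (by simp) _) (hF.mdifferentiable (by simp) _)
  simp only [pullback, h]
  rfl

end DForm

/-! ### Symplectic forms and the Liouville measure -/

/-- A symplectic form on a `2n`-dimensional manifold. -/
structure SymplecticForm (n : ℕ) (M : Type*) [TopologicalSpace M]
    [ChartedSpace (EuclideanSpace ℝ (Fin (2 * n))) M] where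
  form : DForm (2 * n) M 2
  smooth : form.IsSmooth
  closed : form.d = 0
  nondegenerate : ∀ (x : M) (v : TangentSpace (𝓡 (2 * n)) x), (∀ w, form x ![v, w] = 0) → v = 0

/-- The value on `2n` vectors of `ηⁿ / n!`, where `η` is an alternating `2`-form and `ηⁿ` is
its `n`-th exterior power `η ∧ ⋯ ∧ η`, i.e.
`(η ∧ ⋯ ∧ η) (v₁, …, v₂ₙ) = 2⁻ⁿ ∑_σ sign σ ∏_i η (v_{σ(2i-1)}, v_{σ(2i)})`. -/
def wedgePowDivFactorial {V : Type*} [AddCommGroup V] [Module ℝ V] [TopologicalSpace V] (n : ℕ)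
    (η : V [⋀^Fin 2]→L[ℝ] ℝ) (v : Fin (2 * n) → V) : ℝ :=
  ((n.factorial : ℝ))⁻¹ * ((2 : ℝ) ^ n)⁻¹ *
    ∑ σ : Equiv.Perm (Fin (2 * n)), ((Equiv.Perm.sign σ : ℤ) : ℝ) *
      ∏ i : Fin n, η ![v (σ ⟨2 * i, by omega⟩), v (σ ⟨2 * i + 1, by omega⟩)]

namespace SymplecticForm

variable {n : ℕ} {M : Type*} [TopologicalSpace M]
  [ChartedSpace (EuclideanSpace ℝ (Fin (2 * n))) M]

/-- The density `|Ωⁿ / n! (∂₁, …, ∂₂ₙ)|` of the Liouville volume in the chart at `x₀`. (For the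
orientation of `M` defined by `Ωⁿ`, integrating the volume form `Ωⁿ / n!` is
integrating with respect to this density.) -/
def liouvilleDensity (Ω : SymplecticForm n M) (x₀ : M) (y : EuclideanSpace ℝ (Fin (2 * n))) : ℝ :=
  |wedgePowDivFactorial n (Ω.form.inChart x₀ y) (fun i => EuclideanSpace.single i (1 : ℝ))|

variable [MeasurableSpace M]

/-- The measure defined by `Ωⁿ / n!` on the domain of the chart at `x₀` (extended by zero). -/
def liouvilleInChart (Ω : SymplecticForm n M) (x₀ : M) : Measure M :=
  ((volume.restrict (extChartAt (𝓡 (2 * n)) x₀).target).withDensity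
    (fun y => ENNReal.ofReal (Ω.liouvilleDensity x₀ y))).map (extChartAt (𝓡 (2 * n)) x₀).symm

/-- The Liouville measure `μ = Ωⁿ / n!`. The measures `Ω.liouvilleInChart x₀` agree on the overlaps
of chart domains, by the change of variables formula; they are the restrictions of `μ` to the
chart domains, and `μ` is their supremum. -/
def liouville (Ω : SymplecticForm n M) : Measure M :=
  ⨆ x₀ : M, Ω.liouvilleInChart x₀

end SymplecticForm

/-! ### Prequantum bundles -/

/-- The infinitesimal generator `∂_θ` of an action of `U(1)`, at the point `p`. -/
def fundamentalVector {m : ℕ} {P : Type*} [TopologicalSpace P]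
    [ChartedSpace (EuclideanSpace ℝ (Fin m)) P] [MulAction Circle P] (p : P) :
    TangentSpace (𝓡 m) p :=
  mfderiv 𝓘(ℝ, ℝ) (𝓡 m) (fun s : ℝ => Circle.exp s • p) 0 (1 : ℝ)

/-- A prequantum bundle `P → M` over the symplectic manifold `(M, Ω)`: a smooth `U(1)`-principal
bundle with a connection form `α` such that `dα + π^* Ω = 0`. -/
structure PrequantumBundle {n : ℕ} {M : Type*} [TopologicalSpace M]
    [ChartedSpace (EuclideanSpace ℝ (Fin (2 * n))) M] (Ω : SymplecticForm n M)
    (P : Type*) [TopologicalSpace P] [ChartedSpace (EuclideanSpace ℝ (Fin (2 * n + 1))) P]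
    [MulAction Circle P] where
  proj : P → M
  smooth_proj : ContMDiff (𝓡 (2 * n + 1)) (𝓡 (2 * n)) ∞ proj
  smooth_smul : ContMDiff ((𝓡 1).prod (𝓡 (2 * n + 1))) (𝓡 (2 * n + 1)) ∞
    (fun q : Circle × P => q.1 • q.2)
  proj_smul : ∀ (z : Circle) (p : P), proj (z • p) = proj p
  /-- Existence of smooth equivariant local trivializations. -/
  exists_trivialization : ∀ x : M, ∃ e : Bundle.Trivialization Circle proj, x ∈ e.baseSet ∧
    ContMDiffOn (𝓡 (2 * n + 1)) ((𝓡 (2 * n)).prod (𝓡 1)) ∞ e e.source ∧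
    ContMDiffOn ((𝓡 (2 * n)).prod (𝓡 1)) (𝓡 (2 * n + 1)) ∞ e.toOpenPartialHomeomorph.symm
      e.target ∧
    ∀ p ∈ e.source, ∀ z : Circle, (e (z • p)).2 = z * (e p).2
  /-- The connection form. -/
  conn : DForm (2 * n + 1) P 1
  smooth_conn : conn.IsSmooth
  conn_fundamentalVector : ∀ p : P, conn p ![fundamentalVector p] = 1
  conn_invariant : ∀ z : Circle, DForm.pullback (fun p : P => z • p) conn = conn
  curvature : ∀ p : P, conn.d p + DForm.pullback proj Ω.form p = 0

section Prequantum

variable {n : ℕ} {M : Type*} [TopologicalSpace M]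
    [ChartedSpace (EuclideanSpace ℝ (Fin (2 * n))) M] {Ω : SymplecticForm n M}
    {P : Type*} [TopologicalSpace P] [ChartedSpace (EuclideanSpace ℝ (Fin (2 * n + 1))) P]
    [MulAction Circle P]

theorem PrequantumBundle.proj_surjective (B : PrequantumBundle Ω P) :
    Function.Surjective B.proj := by
  intro x
  obtain ⟨e, hx, -⟩ := B.exists_trivialization x
  exact ⟨e.toOpenPartialHomeomorph.symm (x, 1), e.proj_symm_apply' hx⟩

/-- The prequantum bundle automorphisms: diffeomorphisms of `P` commuting with the
`U(1)`-action and preserving the connection form. -/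
@[ext]
structure Preq (B : PrequantumBundle Ω P) where
  toDiffeo : P ≃ₘ^∞⟮𝓡 (2 * n + 1), 𝓡 (2 * n + 1)⟯ P
  map_smul : ∀ (z : Circle) (p : P), toDiffeo (z • p) = z • toDiffeo p
  pullback_conn : DForm.pullback toDiffeo B.conn = B.conn

namespace Preq

variable {B : PrequantumBundle Ω P}

instance : CoeFun (Preq B) (fun _ => P → P) := ⟨fun φ => φ.toDiffeo⟩

theorem ext_apply {φ ψ : Preq B} (h : ∀ p, φ p = ψ p) : φ = ψ :=
  Preq.ext (Diffeomorph.ext h)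

instance : One (Preq B) where
  one :=
    { toDiffeo := Diffeomorph.refl _ _ _
      map_smul := fun _ _ => rfl
      pullback_conn := DForm.pullback_id _ }

/-- The product of two automorphisms is their composition. -/
instance : Mul (Preq B) where
  mul φ ψ :=
    { toDiffeo := ψ.toDiffeo.trans φ.toDiffeo
      map_smul := fun z p => by simp [ψ.map_smul, φ.map_smul]
      pullback_conn := by
        have h := DForm.pullback_comp ψ.toDiffeo.contMDiff φ.toDiffeo.contMDiff B.conn
        rw [φ.pullback_conn, ψ.pullback_conn] at h
        exact h }

instance : Inv (Preq B) where
  inv φ :=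
    { toDiffeo := φ.toDiffeo.symm
      map_smul := fun z p => by
        apply φ.toDiffeo.injective
        simp [φ.map_smul]
      pullback_conn := by
        have h := DForm.pullback_comp φ.toDiffeo.symm.contMDiff φ.toDiffeo.contMDiff B.conn
        rw [φ.pullback_conn] at h
        rw [← h]
        simp only [Diffeomorph.apply_symm_apply]
        exact DForm.pullback_id _ }

@[simp] theorem one_apply (p : P) : (1 : Preq B) p = p := rfl
@[simp] theorem mul_apply (φ ψ : Preq B) (p : P) : (φ * ψ) p = φ (ψ p) := rfl
@[simp] theorem inv_apply_self (φ : Preq B) (p : P) : φ⁻¹ (φ p) = p :=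
  φ.toDiffeo.symm_apply_apply p

instance : Group (Preq B) :=
  Group.ofLeftAxioms (fun _ _ _ => ext_apply fun _ => rfl) (fun _ => ext_apply fun _ => rfl)
    (fun φ => ext_apply fun p => inv_apply_self φ p)

/-- The action of `z ∈ U(1)`, as a prequantum bundle automorphism. -/
def rotation (B : PrequantumBundle Ω P) (z : Circle) : Preq B where
  toDiffeo :=
    { toEquiv := MulAction.toPerm z
      contMDiff_toFun := B.smooth_smul.comp (contMDiff_const.prodMk contMDiff_id)
      contMDiff_invFun := B.smooth_smul.comp (contMDiff_const.prodMk contMDiff_id) }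
  map_smul w p := smul_comm z w p
  pullback_conn := B.conn_invariant z

@[simp] theorem rotation_apply (z : Circle) (p : P) : rotation B z p = z • p := rfl
@[simp] theorem rotation_inv_apply (z : Circle) (p : P) : (rotation B z)⁻¹ p = z⁻¹ • p := rfl

end Preq

/-- The group `𝓟(Preq)` of smooth paths of prequantum bundle automorphisms parametrised by `[0,1]`
and based at the identity. Smoothness is joint smoothness on `[0,1] × P` of the path and
of the path of inverses. -/
@[ext]
structure PreqPath (B : PrequantumBundle Ω P) where
  toFun : unitInterval → Preq B
  smooth : ContMDiff ((𝓡∂ 1).prod (𝓡 (2 * n + 1))) (𝓡 (2 * n + 1)) ∞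
    (fun q : unitInterval × P => toFun q.1 q.2)
  smooth_inv : ContMDiff ((𝓡∂ 1).prod (𝓡 (2 * n + 1))) (𝓡 (2 * n + 1)) ∞
    (fun q : unitInterval × P => (toFun q.1)⁻¹ q.2)
  map_zero : toFun 0 = 1

namespace PreqPath

variable {B : PrequantumBundle Ω P}

instance : CoeFun (PreqPath B) (fun _ => unitInterval → Preq B) := ⟨fun γ => γ.toFun⟩

instance : One (PreqPath B) where
  one :=
    { toFun := fun _ => 1
      smooth := contMDiff_snd
      smooth_inv := by simpa using contMDiff_snd
      map_zero := rfl }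

/-- The product of paths is the pointwise product. -/
instance : Mul (PreqPath B) where
  mul γ γ' :=
    { toFun := fun t => γ t * γ' t
      smooth := γ.smooth.comp (contMDiff_fst.prodMk γ'.smooth)
      smooth_inv := by
        simp only [mul_inv_rev]
        exact γ'.smooth_inv.comp (contMDiff_fst.prodMk γ.smooth_inv)
      map_zero := by simp [γ.map_zero, γ'.map_zero] }

instance : Inv (PreqPath B) where
  inv γ :=
    { toFun := fun t => (γ t)⁻¹
      smooth := γ.smooth_inv
      smooth_inv := by simpa using γ.smooth
      map_zero := by simp [γ.map_zero] }

@[simp] theorem one_apply (t : unitInterval) : (1 : PreqPath B) t = 1 := rfl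
@[simp] theorem mul_apply (γ γ' : PreqPath B) (t : unitInterval) : (γ * γ') t = γ t * γ' t := rfl
@[simp] theorem inv_apply (γ : PreqPath B) (t : unitInterval) : γ⁻¹ t = (γ t)⁻¹ := rfl

instance : Group (PreqPath B) :=
  Group.ofLeftAxioms (fun _ _ _ => PreqPath.ext (funext fun _ => mul_assoc _ _ _))
    (fun _ => PreqPath.ext (funext fun _ => one_mul _))
    (fun _ => PreqPath.ext (funext fun _ => inv_mul_cancel _))

/-- Two paths are smoothly homotopic with fixed endpoints. -/
def Homotopic (γ γ' : PreqPath B) : Prop :=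
  ∃ h : unitInterval → PreqPath B,
    ContMDiff ((𝓡∂ 1).prod ((𝓡∂ 1).prod (𝓡 (2 * n + 1)))) (𝓡 (2 * n + 1)) ∞
      (fun q : unitInterval × unitInterval × P => h q.1 q.2.1 q.2.2) ∧
    h 0 = γ ∧ h 1 = γ' ∧ ∀ s, h s 1 = γ 1

theorem contMDiff_symm_unitInterval :
    ContMDiff (𝓡∂ 1) (𝓡∂ 1) ∞ (unitInterval.symm : unitInterval → unitInterval) := by
  rw [contMDiff_iff_comp_subtypeVal_Icc]
  refine ⟨unitInterval.continuous_symm, ?_⟩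
  have h : ContMDiff 𝓘(ℝ, ℝ) 𝓘(ℝ, ℝ) ∞ (fun x : ℝ => 1 - x) :=
    (contDiff_const.sub contDiff_id).contMDiff
  exact h.comp contMDiff_subtypeVal_Icc

theorem Homotopic.refl (γ : PreqPath B) : Homotopic γ γ :=
  ⟨fun _ => γ, γ.smooth.comp contMDiff_snd, rfl, rfl, fun _ => rfl⟩

theorem Homotopic.symm {γ γ' : PreqPath B} : Homotopic γ γ' → Homotopic γ' γ := by
  rintro ⟨h, hs, h0, h1, he⟩
  refine ⟨fun s => h (unitInterval.symm s), ?_, by simpa, by simpa, fun s => ?_⟩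
  · exact hs.comp ((contMDiff_symm_unitInterval.comp contMDiff_fst).prodMk contMDiff_snd)
  · rw [he, ← h1, he]

theorem Homotopic.mul {γ₁ γ₁' γ₂ γ₂' : PreqPath B} :
    Homotopic γ₁ γ₁' → Homotopic γ₂ γ₂' → Homotopic (γ₁ * γ₂) (γ₁' * γ₂') := by
  rintro ⟨h, hs, h0, h1, he⟩ ⟨k, ks, k0, k1, ke⟩
  refine ⟨fun s => h s * k s, ?_, by simp [h0, k0], by simp [h1, k1], fun s => by simp [he, ke]⟩
  exact hs.comp (contMDiff_fst.prodMk ((contMDiff_fst.comp contMDiff_snd).prodMk ks))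

theorem Homotopic.trans {γ γ' γ'' : PreqPath B} (h : Homotopic γ γ') (h' : Homotopic γ' γ'') :
    Homotopic γ γ'' := by
  have := (h.mul (Homotopic.refl γ'⁻¹)).mul h'
  simpa using this

/-- The congruence relation on `𝓟(Preq)` given by smooth homotopies with fixed endpoints. -/
def homotopyCon (B : PrequantumBundle Ω P) : Con (PreqPath B) where
  r := Homotopic
  iseqv := ⟨Homotopic.refl, Homotopic.symm, Homotopic.trans⟩
  mul' := Homotopic.mul

/-- The path `t ↦ e^{i t τ}` of rotations. -/
def rotationPath (B : PrequantumBundle Ω P) (τ : ℝ) : PreqPath B where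
  toFun t := Preq.rotation B (Circle.exp (t * τ))
  smooth := by
    have h : ContMDiff (𝓡∂ 1) (𝓡 1) ∞ (fun t : unitInterval => Circle.exp (t * τ)) := by
      have h1 : ContMDiff 𝓘(ℝ, ℝ) 𝓘(ℝ, ℝ) ∞ (fun x : ℝ => x * τ) :=
        (contDiff_id.mul contDiff_const).contMDiff
      exact contMDiff_circleExp.comp
        (h1.comp (contMDiff_subtypeVal_Icc (x := (0 : ℝ)) (y := 1)))
    exact B.smooth_smul.comp ((h.comp contMDiff_fst).prodMk contMDiff_snd)
  smooth_inv := by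
    have h : ContMDiff (𝓡∂ 1) (𝓡 1) ∞ (fun t : unitInterval => (Circle.exp (t * τ))⁻¹) := by
      have h1 : ContMDiff 𝓘(ℝ, ℝ) 𝓘(ℝ, ℝ) ∞ (fun x : ℝ => -(x * τ)) :=
        (contDiff_id.mul contDiff_const).neg.contMDiff
      have := contMDiff_circleExp (m := ∞) |>.comp
        (h1.comp (contMDiff_subtypeVal_Icc (x := (0 : ℝ)) (y := 1)))
      simpa only [Function.comp_def, Circle.exp_neg] using this
    exact B.smooth_smul.comp ((h.comp contMDiff_fst).prodMk contMDiff_snd)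
  map_zero := Preq.ext_apply fun p => by simp

/-- The velocity `d/dt γ_t(p)`, that is, the value at `γ_t(p)` of the generating
vector field `Y_t` of the path. -/
def velocity (γ : PreqPath B) (t : unitInterval) (p : P) : TangentSpace (𝓡 (2 * n + 1)) (γ t p) :=
  mfderiv (𝓡∂ 1) (𝓡 (2 * n + 1)) (fun s : unitInterval => γ s p) t (oneTangentSpaceIcc t)

/-- The time-dependent function `f` is smooth on `[0,1] × M` and corresponds to
the generating vector field `Y_t` of `γ` through the Kostant-Souriau isomorphism:
`Y_t = X_t^hor - (π^* f_t) ∂_θ` with `X_t` the Hamiltonian vector field of `f_t`,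
`Ω(X_t, ·) + d f_t = 0`. In other words, `Y_t + (π^* f_t) ∂_θ` is horizontal and projects to `X_t`
(every point of `P` is of the form `γ_t(p)`). -/
def IsGeneratingHamiltonian (γ : PreqPath B) (f : unitInterval → M → ℝ) : Prop :=
  ContMDiff ((𝓡∂ 1).prod (𝓡 (2 * n))) 𝓘(ℝ, ℝ) ∞ (fun q : unitInterval × M => f q.1 q.2) ∧
  ∀ (t : unitInterval) (p : P),
    let H : TangentSpace (𝓡 (2 * n + 1)) (γ t p) :=
      γ.velocity t p + f t (B.proj (γ t p)) • fundamentalVector (γ t p)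
    B.conn (γ t p) ![H] = 0 ∧
    ∀ w : TangentSpace (𝓡 (2 * n)) (B.proj (γ t p)),
      Ω.form (B.proj (γ t p)) ![mfderiv (𝓡 (2 * n + 1)) (𝓡 (2 * n)) B.proj (γ t p) H, w] +
        NormedSpace.fromTangentSpace _
          (mfderiv (𝓡 (2 * n)) 𝓘(ℝ, ℝ) (f t) (B.proj (γ t p)) w) = 0

/-- The generating Hamiltonian `(f_t)` of a path. As `α(X^hor) = 0` and `α(∂_θ) = 1`, it is given
by `f_t(x) = - α(Y_t)(q)` for any point `q = γ_t(p)` in the fibre of `x`. -/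
def hamiltonian (γ : PreqPath B) (t : unitInterval) (x : M) : ℝ :=
  -(fun p : P => B.conn (γ t p) ![γ.velocity t p]) ((γ t)⁻¹ (B.proj_surjective x).choose)

variable [MeasurableSpace M]

/-- `Cal(γ) = ∫₀¹ (∫_M f_t μ) dt`. -/
def cal (γ : PreqPath B) : ℝ :=
  ∫ t : unitInterval, ∫ x, γ.hamiltonian t x ∂Ω.liouville

/-- The generating Hamiltonian of the path is normalised at every time. -/
def IsNormalised (γ : PreqPath B) : Prop :=
  ∀ t : unitInterval, ∫ x, γ.hamiltonian t x ∂Ω.liouville = 0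

end PreqPath

/-- The universal cover of the identity component `Preq⁰`: the quotient of `𝓟(Preq)` by smooth
homotopies with fixed endpoints. -/
abbrev PreqCover (B : PrequantumBundle Ω P) : Type _ := (PreqPath.homotopyCon B).Quotient

namespace PreqCover

/-- The class of a path. -/
def mk (B : PrequantumBundle Ω P) : PreqPath B →* PreqCover B := (PreqPath.homotopyCon B).mk'

/-- The morphism `R`, which sends `τ` to the class of the path `t ↦ e^{i t τ}`. -/
def R (B : PrequantumBundle Ω P) : Multiplicative ℝ →* PreqCover B where
  toFun τ := mk B (PreqPath.rotationPath B τ.toAdd)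
  map_one' := by
    rw [← map_one (mk B)]
    congr 1
    refine PreqPath.ext (funext fun t => Preq.ext_apply fun p => ?_)
    simp [PreqPath.rotationPath]
  map_mul' σ τ := by
    rw [← map_mul (mk B)]
    congr 1
    refine PreqPath.ext (funext fun t => Preq.ext_apply fun p => ?_)
    simp [PreqPath.rotationPath, mul_add, Circle.exp_add, mul_smul]

end PreqCover

end Prequantum

end

/-! Everything rests on one formula: for a map `H` on a product, `dα(∂_s H, ∂_t H) = ∂_s α(∂_t H) -
∂_t α(∂_s H)` (`DForm.d_apply_partial`). The generating Hamiltonian satisfies `f_t(π(γ_t p)) =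
-α(d/dt γ_t(p))`, and `α(d/dt γ_t(p))` depends only on `π p` because rotations preserve `α`.

Existence of the Hamiltonian. Apply the formula to `(t, z) ↦ γ_t(z)`. Since `γ_t` preserves `α`, the
term `∂_t α(∂_z)` vanishes; what remains, combined with `dα = -π^*ω`, says that the velocity
projects to the Hamiltonian vector field of `f_t`. Uniqueness is read off from `α(∂_θ) = 1`.

Morphism. By the Leibniz rule and the invariance of `α`, the Hamiltonian of `γγ'` is `f_t + f'_t ∘
g_t⁻¹`, where `g_t` is the map induced on `M`. This map preserves `ω`, hence `μ`, so the integrals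
over `M` add up at every time. The preservation of `μ` comes from the change of variables in charts;
finiteness and positivity of `μ(M)` come from compactness and from `ωⁿ ≠ 0`, which is seen on a
symplectic basis.

Homotopy invariance. For a homotopy `h`, the morphism property applied to `h(s₀)⁻¹ h(s)` reduces the
computation of the derivative of `Cal(h(s))` at `s₀` to the case where `h(s₀)` is the constant path.
There `∂_t h = 0`, so the formula gives `∂_s α(∂_t h) = ∂_t α(∂_s h)`. Integrating over `t` leaves
boundary terms, which vanish since the endpoints are fixed.

Normalisation. The path `t ↦ e^{iC(t)}` has Hamiltonian `-C'(t)`. If `Cal(γ) = 0`, take `C' = (∫ f_t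
μ)/μ(M)` with `C(0) = 0`: then `C(1) = 0`, the rotation loop is contracted through `(1-s)C`, and
multiplying `γ` by it makes the Hamiltonian normalised. -/

namespace DForm

/-! ### Pull-back of forms to normed spaces, and exterior derivative -/

variable {m k : ℕ}
  {N : Type*} [TopologicalSpace N] [ChartedSpace (EuclideanSpace ℝ (Fin m)) N]
  {V : Type*} [NormedAddCommGroup V] [NormedSpace ℝ V]

/-- The tangent spaces at `p` and `q` are distinct as dependent types although both unfold to the
model space. Ascribing the model space on both sides lets the base point change without a cast. -/
theorem apply_congr (η : DForm m N k) {p q : N} (h : p = q)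
    (v w : Fin k → EuclideanSpace ℝ (Fin m)) (hv : v = w) :
    (show EuclideanSpace ℝ (Fin m) [⋀^Fin k]→L[ℝ] ℝ from η p) v =
      (show EuclideanSpace ℝ (Fin m) [⋀^Fin k]→L[ℝ] ℝ from η q) w := by
  subst h; subst hv; rfl

/-- The pull-back of a form by a map defined on a subset of a vector space. -/
noncomputable def pullbackOn (H : V → N) (S : Set V) (η : DForm m N k) (y : V) :
    V [⋀^Fin k]→L[ℝ] ℝ :=
  (show EuclideanSpace ℝ (Fin m) [⋀^Fin k]→L[ℝ] ℝ from η (H y)).compContinuousLinearMap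
    (mfderivWithin 𝓘(ℝ, V) (𝓡 m) H S y)

theorem IsSmooth.contDiffAt {η : DForm m N k} (hη : η.IsSmooth) {x₀ p : N}
    (hp : p ∈ (extChartAt (𝓡 m) x₀).source) :
    ContDiffAt ℝ ∞ (η.inChart x₀) (extChartAt (𝓡 m) x₀ p) :=
  (hη x₀).contDiffAt ((isOpen_extChartAt_target x₀).mem_nhds ((extChartAt (𝓡 m) x₀).map_source hp))

variable [IsManifold (𝓡 m) ∞ N]

theorem mfderivWithin_extChartAt_comp {H : V → N} {S : Set V} {y : V}
    (hS : UniqueDiffWithinAt ℝ S y) (hH : MDifferentiableWithinAt 𝓘(ℝ, V) (𝓡 m) H S y) {x₀ : N}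
    (hx : H y ∈ (extChartAt (𝓡 m) x₀).source) :
    fderivWithin ℝ (fun z => extChartAt (𝓡 m) x₀ (H z)) S y =
      (mfderiv (𝓡 m) 𝓘(ℝ, EuclideanSpace ℝ (Fin m)) (extChartAt (𝓡 m) x₀) (H y)).comp
        (mfderivWithin 𝓘(ℝ, V) (𝓡 m) H S y) := by
  rw [← mfderivWithin_eq_fderivWithin]
  exact mfderiv_comp_mfderivWithin y (mdifferentiableAt_extChartAt
    (by simpa using hx)) hH hS.uniqueMDiffWithinAt

/-- The derivatives of a chart and of its inverse compose to the identity, so a form is recovered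
from its coordinate expression in any chart around the point. -/
theorem inChart_apply_mfderiv (η : DForm m N k) {x₀ p : N}
    (hp : p ∈ (extChartAt (𝓡 m) x₀).source) :
    (η.inChart x₀ (extChartAt (𝓡 m) x₀ p)).compContinuousLinearMap
      (mfderiv (𝓡 m) 𝓘(ℝ, EuclideanSpace ℝ (Fin m)) (extChartAt (𝓡 m) x₀) p) = η p := by
  ext v
  refine apply_congr η ((extChartAt (𝓡 m) x₀).left_inv hp) _ _ ?_
  funext i
  have := mfderivWithin_extChartAt_symm_comp_mfderiv_extChartAt' (I := 𝓡 m) hp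
  rw [modelWithCornersSelf_coe, Set.range_id, mfderivWithin_univ] at this
  exact congrArg (fun L => L (v i)) this

/-- Through a chart of the target, the pull-back becomes one between vector spaces, to which
ordinary differential calculus applies. -/
theorem pullbackOn_eq_inChart (η : DForm m N k) {H : V → N} {S : Set V} {y : V}
    (hS : UniqueDiffWithinAt ℝ S y) (hH : MDifferentiableWithinAt 𝓘(ℝ, V) (𝓡 m) H S y) {x₀ : N}
    (hx : H y ∈ (extChartAt (𝓡 m) x₀).source) :
    pullbackOn H S η y = (η.inChart x₀ (extChartAt (𝓡 m) x₀ (H y))).compContinuousLinearMap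
      (fderivWithin ℝ (fun z => extChartAt (𝓡 m) x₀ (H z)) S y) := by
  rw [mfderivWithin_extChartAt_comp hS hH hx]
  unfold pullbackOn
  rw [← inChart_apply_mfderiv η hx]
  rfl

theorem eventually_pullbackOn_eq (η : DForm m N k) {H : V → N} {S : Set V}
    (hS : UniqueDiffOn ℝ S) (hH : ContMDiffOn 𝓘(ℝ, V) (𝓡 m) ∞ H S) {x₀ : N} {y₀ : V} (hy₀ : y₀ ∈ S)
    (hx : H y₀ ∈ (extChartAt (𝓡 m) x₀).source) :
    pullbackOn H S η =ᶠ[𝓝[S] y₀]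
      fun y => (η.inChart x₀ (extChartAt (𝓡 m) x₀ (H y))).compContinuousLinearMap
      (fderivWithin ℝ (fun z => extChartAt (𝓡 m) x₀ (H z)) S y) := by
  have h := (hH y₀ hy₀).continuousWithinAt.preimage_mem_nhdsWithin
    ((isOpen_extChartAt_source x₀).mem_nhds hx)
  filter_upwards [h, self_mem_nhdsWithin] with y h1 h2
  exact pullbackOn_eq_inChart η (hS y h2) ((hH y h2).mdifferentiableWithinAt (by simp)) h1

theorem contDiffWithinAt_extChartAt_comp {H : V → N} {S : Set V} {y₀ : V}
    (hH : ContMDiffWithinAt 𝓘(ℝ, V) (𝓡 m) ∞ H S y₀) {x₀ : N}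
    (hx : H y₀ ∈ (extChartAt (𝓡 m) x₀).source) :
    ContDiffWithinAt ℝ ∞ (fun z => extChartAt (𝓡 m) x₀ (H z)) S y₀ := by
  rw [← contMDiffWithinAt_iff_contDiffWithinAt]
  exact (contMDiffAt_extChartAt' (by simpa using hx)).comp_contMDiffWithinAt y₀ hH

theorem differentiableWithinAt_pullbackOn {η : DForm m N k} (hη : η.IsSmooth) {H : V → N}
    {S : Set V} (hS : UniqueDiffOn ℝ S) (hH : ContMDiffOn 𝓘(ℝ, V) (𝓡 m) ∞ H S) {y : V}
    (hy : y ∈ S) : DifferentiableWithinAt ℝ (pullbackOn H S η) S y := by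
  have hx := mem_extChartAt_source (I := 𝓡 m) (H y)
  have h := eventually_pullbackOn_eq η hS hH hy hx
  refine DifferentiableWithinAt.congr_of_eventuallyEq_of_mem ?_ h hy
  have h1 := contDiffWithinAt_extChartAt_comp (hH y hy) hx
  refine DifferentiableWithinAt.continuousAlternatingMapCompContinuousLinearMap ?_ ?_
  · exact ((hη.contDiffAt hx).differentiableAt (by simp)).comp_differentiableWithinAt y
      (h1.differentiableWithinAt (by simp))
  · exact (h1.fderivWithin_right (m := 1) hS (by norm_cast) hy).differentiableWithinAt (by simp)

/-- The exterior derivative commutes with pull-back. -/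
theorem extDerivWithin_pullbackOn {η : DForm m N k} (hη : η.IsSmooth) {H : V → N}
    {S : Set V} (hS : UniqueDiffOn ℝ S) (hH : ContMDiffOn 𝓘(ℝ, V) (𝓡 m) ∞ H S) {y : V}
    (hy : y ∈ S) (hy' : y ∈ closure (interior S)) :
    extDerivWithin (pullbackOn H S η) S y = pullbackOn H S η.d y := by
  have hx := mem_extChartAt_source (I := 𝓡 m) (H y)
  have h := eventually_pullbackOn_eq η hS hH hy hx
  have h1 := contDiffWithinAt_extChartAt_comp (hH y hy) hx
  have hd : DifferentiableWithinAt ℝ (η.inChart (H y)) Set.univ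
      ((fun z => extChartAt (𝓡 m) (H y) (H z)) y) :=
    ((hη.contDiffAt hx).differentiableAt (by simp)).differentiableWithinAt
  -- On vector spaces `d` commutes with pull-back by the symmetry of second derivatives; within `S`
  -- this symmetry is where `y ∈ closure (interior S)` is needed.
  have h2 := extDerivWithin_pullback (t := Set.univ) (r := ∞)
    (f := fun z => extChartAt (𝓡 m) (H y) (H z)) hd h1
    (by rw [minSmoothness_of_isRCLikeNormedField]; exact WithTop.coe_le_coe.2 le_top) hS hy' hy
    (Set.mapsTo_univ _ _)
  rw [h.extDerivWithin_eq_of_mem hy, h2, extDerivWithin_univ,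
    mfderivWithin_extChartAt_comp (hS y hy) ((hH y hy).mdifferentiableWithinAt (by simp)) hx]
  rfl

/-- The evaluation of the pull-back of a `1`-form on a constant vector is smooth. -/
theorem contDiffOn_pullbackOn_apply {η : DForm m N 1} (hη : η.IsSmooth) {H : V → N}
    {S : Set V} (hS : UniqueDiffOn ℝ S) (hH : ContMDiffOn 𝓘(ℝ, V) (𝓡 m) ∞ H S) (v : V) :
    ContDiffOn ℝ ∞ (fun y => pullbackOn H S η y ![v]) S := by
  intro y hy
  have hx := mem_extChartAt_source (I := 𝓡 m) (H y)
  have h := eventually_pullbackOn_eq η hS hH hy hx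
  have h1 := contDiffWithinAt_extChartAt_comp (hH y hy) hx
  -- A `1`-form is identified with a linear form, so that the evaluation is an application of a
  -- smooth family of linear maps to a smooth family of vectors.
  have h2 : ContDiffWithinAt ℝ ∞ (fun z => (ContinuousAlternatingMap.ofSubsingletonLIE (𝕜 := ℝ)
      (E := EuclideanSpace ℝ (Fin m)) (F := ℝ) (0 : Fin 1)).symm
        (η.inChart (H y) (extChartAt (𝓡 m) (H y) (H z)))
      (fderivWithin ℝ (fun z => extChartAt (𝓡 m) (H y) (H z)) S z v)) S y := by
    refine ContDiffWithinAt.clm_apply ?_ ?_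
    · exact (LinearIsometryEquiv.contDiff _).contDiffAt.comp_contDiffWithinAt y
        (ContDiffAt.comp_contDiffWithinAt (f := fun z => extChartAt (𝓡 m) (H y) (H z))
        (g := η.inChart (H y)) y (hη.contDiffAt hx) h1)
    · exact (h1.fderivWithin_right (m := ∞) hS (by simp) hy).clm_apply contDiffWithinAt_const
  refine h2.congr_of_eventuallyEq_of_mem ?_ hy
  filter_upwards [h] with z hz
  rw [hz]
  refine congrArg (η.inChart (H y) (extChartAt (𝓡 m) (H y) (H z))) ?_
  funext i
  fin_cases i
  rfl

end DForm

/-! ### Linear symplectic algebra: the top power of a nondegenerate form -/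

section LinearSymplectic

/-- The enumeration of `Fin (2 * n)` by pairs `(i, b) ↦ 2 * i + b`. -/
def pairIndex (n : ℕ) : Fin n × Fin 2 ≃ Fin (2 * n) :=
  finProdFinEquiv.trans (finCongr (mul_comm n 2))

theorem pairIndex_zero {n : ℕ} (i : Fin n) (h : 2 * (i : ℕ) < 2 * n) :
    (⟨2 * i, h⟩ : Fin (2 * n)) = pairIndex n (i, 0) := by
  ext; simp [pairIndex]

theorem pairIndex_one {n : ℕ} (i : Fin n) (h : 2 * (i : ℕ) + 1 < 2 * n) :
    (⟨2 * i + 1, h⟩ : Fin (2 * n)) = pairIndex n (i, 1) := by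
  ext; simp [pairIndex, add_comm]

variable {V : Type*} [AddCommGroup V] [Module ℝ V]

/-- Symplectic Gram–Schmidt: split off a hyperbolic plane spanned by `u, w` with `B u w = 1` and
recurse on its orthogonal, the kernel of `(B u, B w)`, of codimension 2. Only the pairing relations
are recorded; linear independence is not needed below. -/
theorem exists_symplectic_basis (n : ℕ) : ∀ {V : Type*} [AddCommGroup V] [Module ℝ V]
    [FiniteDimensional ℝ V] (B : LinearMap.BilinForm ℝ V), B.IsAlt →
    (∀ v, (∀ w, B v w = 0) → v = 0) → Module.finrank ℝ V = 2 * n →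
    ∃ e f : Fin n → V, (∀ i j, B (e i) (e j) = 0) ∧ (∀ i j, B (f i) (f j) = 0) ∧
      ∀ i j, B (e i) (f j) = if i = j then 1 else 0 := by
  induction n with
  | zero =>
    intro V _ _ _ B _ _ _
    exact ⟨Fin.elim0, Fin.elim0, fun i => i.elim0, fun i => i.elim0, fun i => i.elim0⟩
  | succ n ih =>
    intro V _ _ _ B hB hnd hV
    have : Nontrivial V := Module.nontrivial_of_finrank_pos (R := ℝ) (by omega)
    obtain ⟨u, hu⟩ := exists_ne (0 : V)
    obtain ⟨w₀, hw₀⟩ : ∃ w, B u w ≠ 0 := by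
      by_contra! h
      exact hu (hnd u h)
    obtain ⟨w, huw⟩ : ∃ w, B u w = 1 := ⟨(B u w₀)⁻¹ • w₀, by simp [hw₀]⟩
    have huu : B u u = 0 := hB u
    have hww : B w w = 0 := hB w
    have hwu : B w u = -1 := by rw [← huw, hB.neg_eq]
    let L : V →ₗ[ℝ] ℝ × ℝ := (B u).prod (B w)
    have hL : Function.Surjective L := by
      rintro ⟨a, b⟩
      refine ⟨a • w - b • u, ?_⟩
      simp [L, huu, hww, huw, hwu]
    have hker : Module.finrank ℝ (LinearMap.ker L) = 2 * n := by
      have h1 := LinearMap.finrank_range_add_finrank_ker L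
      rw [LinearMap.range_eq_top.2 hL, finrank_top, hV] at h1
      simp at h1
      omega
    have hmem : ∀ x : LinearMap.ker L, B u x = 0 ∧ B w x = 0 := fun x => by
      have := x.2
      rw [LinearMap.mem_ker] at this
      exact ⟨congrArg Prod.fst this, congrArg Prod.snd this⟩
    have hmem' : ∀ x : LinearMap.ker L, B x u = 0 ∧ B x w = 0 := fun x => by
      rw [← hB.neg_eq, ← hB.neg_eq w]
      simp [hmem]
    obtain ⟨e, f, hee, hff, hef⟩ := ih (B.restrict (LinearMap.ker L)) (fun x => hB x) (by
      intro v hv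
      have hv' : (v : V) = 0 := by
        apply hnd
        intro x
        -- This is the projection of `x` to the orthogonal of the plane. As `v` is orthogonal to `u`
        -- and `w`, pairing `v` with the projection is pairing it with `x`, so the restricted form
        -- is nondegenerate.
        have hx : x - B u x • w + B w x • u ∈ LinearMap.ker L := by
          simp [L, huu, hww, huw, hwu]
        have h1 := hv ⟨_, hx⟩
        simpa [hmem'] using h1
      exact_mod_cast hv') hker
    refine ⟨Fin.cons u (fun i => e i), Fin.cons w (fun i => f i), ?_, ?_, ?_⟩
    · intro i j
      refine Fin.cases ?_ (fun i => ?_) i <;> refine Fin.cases ?_ (fun j => ?_) j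
      · simpa using huu
      · simpa using (hmem _).1
      · simpa using (hmem' _).1
      · simpa using hee i j
    · intro i j
      refine Fin.cases ?_ (fun i => ?_) i <;> refine Fin.cases ?_ (fun j => ?_) j
      · simpa using hww
      · simpa using (hmem _).2
      · simpa using (hmem' _).2
      · simpa using hff i j
    · intro i j
      refine Fin.cases ?_ (fun i => ?_) i <;> refine Fin.cases ?_ (fun j => ?_) j
      · simpa using huw
      · simpa [(Fin.succ_ne_zero _).symm] using (hmem _).1
      · simpa using (hmem' _).2
      · simpa using hef i j

/-- The standard symplectic pairing of the basis vectors indexed by `Fin n × Fin 2`. -/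
def standardPairing {n : ℕ} (a b : Fin n × Fin 2) : ℝ :=
  if a.1 = b.1 then (b.2 : ℕ) - (a.2 : ℕ) else 0

/-- If the product is nonzero, `τ` maps each pair `{(i,0), (i,1)}` onto such a pair: it is a
permutation `ρ` of the pairs after flips `s i` inside them. The sign of `ρ` counts twice and
disappears, so both `sign τ` and the product of pairings equal `∏ sign (s i)`, and their product is
a square. -/
theorem sign_mul_prod_standardPairing_nonneg {n : ℕ} (τ : Equiv.Perm (Fin n × Fin 2)) :
    0 ≤ ((Equiv.Perm.sign τ : ℤ) : ℝ) * ∏ i, standardPairing (τ (i, 0)) (τ (i, 1)) := by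
  by_cases h0 : ∏ i, standardPairing (τ (i, 0)) (τ (i, 1)) = 0
  · simp [h0]
  rw [← ne_eq, Finset.prod_ne_zero_iff] at h0
  have h1 : ∀ i, (τ (i, 0)).1 = (τ (i, 1)).1 := by
    intro i
    by_contra h
    exact h0 i (Finset.mem_univ i) (by simp [standardPairing, h])
  have h2 : ∀ i, (τ (i, 0)).2 ≠ (τ (i, 1)).2 := by
    intro i h
    exact absurd (τ.injective (Prod.ext (h1 i) h)) (by simp)
  have hb : ∀ i b, (τ (i, b)).1 = (τ (i, 0)).1 := by
    intro i b
    fin_cases b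
    · rfl
    · exact (h1 i).symm
  have hinj : Function.Injective (fun i => (τ (i, 0)).1) := by
    intro i j hij
    simp only at hij
    -- The images of `(j,0)` and `(j,1)` exhaust their pair, so the image of `(i,0)` is one of them.
    have : (τ (i, 0)).2 = (τ (j, 0)).2 ∨ (τ (i, 0)).2 = (τ (j, 1)).2 := by
      have := h2 j
      generalize (τ (i, 0)).2 = a at *
      generalize (τ (j, 0)).2 = b at *
      generalize (τ (j, 1)).2 = c at *
      fin_cases a <;> fin_cases b <;> fin_cases c <;> simp_all
    rcases this with h | h
    · exact congrArg Prod.fst (τ.injective (Prod.ext hij h))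
    · exact congrArg Prod.fst (τ.injective (Prod.ext (hij.trans (h1 j)) h))
  let ρ : Equiv.Perm (Fin n) := Equiv.ofBijective _ (Finite.injective_iff_bijective.1 hinj)
  let s : Fin n → Equiv.Perm (Fin 2) := fun i => if (τ (i, 0)).2 = 0 then 1 else Equiv.swap 0 1
  have hs : ∀ i b, (τ (i, b)).2 = s i b := by
    intro i b
    have := h2 i
    simp only [s]
    generalize hx : (τ (i, 0)).2 = x at *
    generalize hy : (τ (i, 1)).2 = y at *
    fin_cases x <;> fin_cases y <;> fin_cases b <;> simp_all
  have hτ : τ = (Equiv.prodCongrLeft fun _ : Fin 2 => ρ) * Equiv.prodCongrRight s := by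
    ext ⟨i, b⟩ : 1
    refine Prod.ext (hb i b) (hs i b)
  have hp : ∀ i, standardPairing (τ (i, 0)) (τ (i, 1)) = ((Equiv.Perm.sign (s i) : ℤ) : ℝ) := by
    intro i
    rw [standardPairing, if_pos (h1 i), hs, hs]
    simp only [s]
    split_ifs <;> simp
  have hsign : Equiv.Perm.sign τ = ∏ i, Equiv.Perm.sign (s i) := by
    rw [hτ, map_mul, Equiv.Perm.sign_prodCongrLeft, Equiv.Perm.sign_prodCongrRight]
    simp
  simp only [hp]
  rw [hsign]
  push_cast
  exact mul_self_nonneg _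

variable [TopologicalSpace V]

/-- No term of the sum is negative, and the identity permutation contributes `1`. -/
theorem wedgePowDivFactorial_pos_of_symplectic_basis {n : ℕ} (η : V [⋀^Fin 2]→L[ℝ] ℝ)
    (v : Fin n × Fin 2 → V) (hv : ∀ a b, η ![v a, v b] = standardPairing a b) :
    0 < wedgePowDivFactorial n η (fun i => v ((pairIndex n).symm i)) := by
  unfold wedgePowDivFactorial
  refine mul_pos (by positivity) ?_
  refine Finset.sum_pos' (fun σ _ => ?_) ⟨1, Finset.mem_univ _, ?_⟩
  · have := sign_mul_prod_standardPairing_nonneg ((pairIndex n).symm.permCongr σ)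
    rw [Equiv.Perm.sign_permCongr] at this
    simpa [pairIndex_zero, pairIndex_one, hv, Equiv.permCongr_apply] using this
  · simp [pairIndex_zero, pairIndex_one, hv, standardPairing]

/-- The alternating form `ηⁿ / n!`. -/
noncomputable def wedgePowAlternating (n : ℕ) (η : V [⋀^Fin 2]→L[ℝ] ℝ) :
    V [⋀^Fin (2 * n)]→ₗ[ℝ] ℝ :=
  (((n.factorial : ℝ))⁻¹ * ((2 : ℝ) ^ n)⁻¹) • MultilinearMap.alternatization
    (((MultilinearMap.mkPiAlgebra ℝ (Fin n) ℝ).compMultilinearMap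
      (fun _ : Fin n => η.toMultilinearMap)).domDomCongr
        ((Equiv.sigmaEquivProd (Fin n) (Fin 2)).trans (pairIndex n)))

/-- The explicit sum is thereby an alternating map of top degree, which is a multiple of the
determinant in any basis. -/
theorem wedgePowAlternating_apply (n : ℕ) (η : V [⋀^Fin 2]→L[ℝ] ℝ) (v : Fin (2 * n) → V) :
    wedgePowAlternating n η v = wedgePowDivFactorial n η v := by
  unfold wedgePowAlternating wedgePowDivFactorial
  rw [AlternatingMap.smul_apply, MultilinearMap.alternatization_apply, smul_eq_mul]
  congr 1
  refine Finset.sum_congr rfl fun σ _ => ?_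
  rw [Units.smul_def, zsmul_eq_mul]
  congr 1
  simp only [MultilinearMap.domDomCongr_apply, MultilinearMap.compMultilinearMap_apply,
    MultilinearMap.mkPiAlgebra_apply]
  refine Finset.prod_congr rfl fun i _ => ?_
  refine congrArg η ?_
  funext b
  fin_cases b
  · simp [Sigma.curry, pairIndex_zero]
  · simp [Sigma.curry, pairIndex_one]

/-- A multiple of the determinant is multiplied by `det A` under pull-back by `A`. This is the
Jacobian factor in the change of variables for the Liouville measure. -/
theorem wedgePowDivFactorial_comp {m : ℕ} (η : V [⋀^Fin 2]→L[ℝ] ℝ) (A : V →L[ℝ] V)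
    (e : Module.Basis (Fin (2 * m)) ℝ V) :
    wedgePowDivFactorial m (η.compContinuousLinearMap A) e =
      A.det * wedgePowDivFactorial m η e := by
  have h1 : wedgePowDivFactorial m (η.compContinuousLinearMap A) e =
      wedgePowDivFactorial m η (A ∘ e) := by
    unfold wedgePowDivFactorial
    congr 1
    refine Finset.sum_congr rfl fun σ _ => ?_
    congr 1
    refine Finset.prod_congr rfl fun i _ => ?_
    refine congrArg η ?_
    funext b
    fin_cases b <;> rfl
  rw [h1, ← wedgePowAlternating_apply, ← wedgePowAlternating_apply,
    (wedgePowAlternating m η).eq_smul_basis_det e]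
  have := e.det_comp (A : V →ₗ[ℝ] V) e
  simp only [AlternatingMap.smul_apply, smul_eq_mul, e.det_self, mul_one] at this ⊢
  erw [this]
  exact mul_comm _ _

theorem update_vec_zero {α : Type*} (a b x : α) : Function.update ![a, b] 0 x = ![x, b] := by
  funext i
  fin_cases i <;> rfl

theorem update_vec_one {α : Type*} (a b x : α) : Function.update ![a, b] 1 x = ![a, x] := by
  funext i
  fin_cases i <;> rfl

/-- A top-degree alternating map that vanishes on one basis is zero, whereas `ηⁿ / n!` is positive
on a symplectic family. -/
theorem wedgePowDivFactorial_ne_zero {n : ℕ} (η : V [⋀^Fin 2]→L[ℝ] ℝ)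
    (hη : ∀ v, (∀ w, η ![v, w] = 0) → v = 0) (e : Module.Basis (Fin (2 * n)) ℝ V) :
    wedgePowDivFactorial n η e ≠ 0 := by
  have : FiniteDimensional ℝ V := Module.Finite.of_basis e
  let B : LinearMap.BilinForm ℝ V := LinearMap.mk₂ ℝ (fun v w => η ![v, w])
    (fun a b c => by
      have := η.map_update_add ![a, c] 0 a b
      simpa only [update_vec_zero] using this)
    (fun r a c => by
      have := η.map_update_smul ![a, c] 0 r a
      simpa only [update_vec_zero] using this)
    (fun a b c => by
      have := η.map_update_add ![a, b] 1 b c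
      simpa only [update_vec_one] using this)
    (fun r a c => by
      have := η.map_update_smul ![a, c] 1 r c
      simpa only [update_vec_one] using this)
  have hB : B.IsAlt := fun v => η.map_eq_zero_of_eq ![v, v] (i := 0) (j := 1) rfl (by simp)
  obtain ⟨a, b, haa, hbb, hab⟩ := exists_symplectic_basis n B hB hη
    (by rw [Module.finrank_eq_card_basis e, Fintype.card_fin])
  have hba : ∀ i j, B (b i) (a j) = if i = j then -1 else 0 := fun i j => by
    rw [← hB.neg_eq, hab]
    simp only [eq_comm]
    split_ifs <;> simp
  have hpos := wedgePowDivFactorial_pos_of_symplectic_basis η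
    (fun x : Fin n × Fin 2 => if x.2 = 0 then a x.1 else b x.1) (by
      rintro ⟨i, x⟩ ⟨j, y⟩
      change B _ _ = _
      fin_cases x <;> fin_cases y <;> simp [standardPairing, haa, hbb, hab, hba])
  rw [← wedgePowAlternating_apply, AlternatingMap.map_basis_ne_zero_iff]
  intro h
  rw [← wedgePowAlternating_apply, h] at hpos
  simp at hpos

end LinearSymplectic

/-! ### The Liouville measure: charts, invariance, finiteness, positivity -/

namespace SymplecticForm

variable {n : ℕ} {M : Type*} [TopologicalSpace M]
  [ChartedSpace (EuclideanSpace ℝ (Fin (2 * n))) M]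

theorem measurableSet_extChartAt_image [MeasurableSpace M] [BorelSpace M] (x₀ : M) {A : Set M}
    (hA : MeasurableSet A) :
    MeasurableSet ((extChartAt (𝓡 (2 * n)) x₀).target ∩
      (extChartAt (𝓡 (2 * n)) x₀).symm ⁻¹' A) := by
  have hT : MeasurableSet (extChartAt (𝓡 (2 * n)) x₀).target :=
    (isOpen_extChartAt_target x₀).measurableSet
  have h := (continuousOn_iff_continuous_domRestrict.1
    (continuousOn_extChartAt_symm (I := 𝓡 (2 * n)) x₀)).measurable hA
  have h2 := hT.subtype_image h
  convert h2 using 1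
  ext y
  simp [and_comm]

theorem liouvilleInChart_apply [MeasurableSpace M] [BorelSpace M] (Ω : SymplecticForm n M)
    (x₀ : M) {A : Set M} (hA : MeasurableSet A) :
    Ω.liouvilleInChart x₀ A = ∫⁻ y in (extChartAt (𝓡 (2 * n)) x₀).target ∩
      (extChartAt (𝓡 (2 * n)) x₀).symm ⁻¹' A, ENNReal.ofReal (Ω.liouvilleDensity x₀ y) := by
  have hT : MeasurableSet (extChartAt (𝓡 (2 * n)) x₀).target :=
    (isOpen_extChartAt_target x₀).measurableSet
  unfold liouvilleInChart
  rw [Measure.map_apply_of_aemeasurable _ hA]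
  · rw [← restrict_withDensity hT, Measure.restrict_apply' hT, Set.inter_comm,
      withDensity_apply _ (measurableSet_extChartAt_image x₀ hA)]
  · exact ((continuousOn_extChartAt_symm (I := 𝓡 (2 * n)) x₀).aemeasurable hT).mono_ac
      (withDensity_absolutelyContinuous _ _)

theorem liouvilleInChart_eq_inter_source [MeasurableSpace M] [BorelSpace M]
    (Ω : SymplecticForm n M) (x₀ : M) {A : Set M} (hA : MeasurableSet A) :
    Ω.liouvilleInChart x₀ A = Ω.liouvilleInChart x₀ (A ∩ (extChartAt (𝓡 (2 * n)) x₀).source) := by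
  rw [liouvilleInChart_apply Ω x₀ hA, liouvilleInChart_apply Ω x₀
    (hA.inter (isOpen_extChartAt_source x₀).measurableSet)]
  congr 2
  ext y
  constructor
  · rintro ⟨h1, h2⟩
    exact ⟨h1, h2, (extChartAt (𝓡 (2 * n)) x₀).map_target h1⟩
  · rintro ⟨h1, h2, -⟩
    exact ⟨h1, h2⟩

/-- A finite cover, enumerated with repetitions by `ℕ` so that `disjointed` applies to it. -/
theorem exists_countable_chart_cover [CompactSpace M] [Nonempty M] :
    ∃ u : ℕ → M, ⋃ k, (extChartAt (𝓡 (2 * n)) (u k)).source = Set.univ := by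
  obtain ⟨t, ht⟩ := isCompact_univ.elim_finite_subcover
    (fun x : M => (extChartAt (𝓡 (2 * n)) x).source) (fun x => isOpen_extChartAt_source x)
    (fun x _ => Set.mem_iUnion.2 ⟨x, mem_extChartAt_source x⟩)
  have hne : (t : Set M).Nonempty := by
    by_contra h
    rw [Set.not_nonempty_iff_eq_empty, Finset.coe_eq_empty] at h
    obtain ⟨x⟩ := ‹Nonempty M›
    simpa [h] using ht (Set.mem_univ x)
  obtain ⟨u, hu⟩ := (Finset.countable_toSet t).exists_eq_range hne
  refine ⟨u, Set.eq_univ_of_univ_subset fun x hx => ?_⟩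
  obtain ⟨y, hy, hxy⟩ := Set.mem_iUnion₂.1 (ht hx)
  obtain ⟨k, rfl⟩ : y ∈ Set.range u := hu ▸ hy
  exact Set.mem_iUnion.2 ⟨k, hxy⟩

theorem continuousAt_liouvilleDensity (Ω : SymplecticForm n M) (x : M) :
    ContinuousAt (Ω.liouvilleDensity x) (extChartAt (𝓡 (2 * n)) x x) := by
  have h := (Ω.smooth.contDiffAt (mem_extChartAt_source (I := 𝓡 (2 * n)) x)).continuousAt
  unfold liouvilleDensity wedgePowDivFactorial
  refine ContinuousAt.abs (continuousAt_const.mul ?_)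
  refine tendsto_finsetSum _ fun σ _ => continuousAt_const.mul ?_
  refine tendsto_finsetProd _ fun i _ => ?_
  exact (ContinuousAlternatingMap.apply ℝ (EuclideanSpace ℝ (Fin (2 * n))) ℝ
    ![EuclideanSpace.single (σ ⟨2 * i, by omega⟩) (1 : ℝ),
      EuclideanSpace.single (σ ⟨2 * i + 1, by omega⟩) (1 : ℝ)]).continuous.continuousAt.comp h

variable [IsManifold (𝓡 (2 * n)) ∞ M]

theorem contMDiffOn_extChartAt_symm_top {m : ℕ} {N : Type*} [TopologicalSpace N]
    [ChartedSpace (EuclideanSpace ℝ (Fin m)) N] [IsManifold (𝓡 m) ∞ N] (x₀ : N) :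
    ContMDiffOn 𝓘(ℝ, EuclideanSpace ℝ (Fin m)) (𝓡 m) ∞ (extChartAt (𝓡 m) x₀).symm
      (extChartAt (𝓡 m) x₀).target :=
  contMDiffOn_extChartAt_symm x₀

/-- The expressions in charts of a form which is invariant under `F` correspond to
each other under the expression of `F` in these charts. -/
theorem inChart_eq_of_pullback_eq {m k : ℕ} {N N' : Type*} [TopologicalSpace N]
    [ChartedSpace (EuclideanSpace ℝ (Fin m)) N] [IsManifold (𝓡 m) ∞ N] [TopologicalSpace N']
    [ChartedSpace (EuclideanSpace ℝ (Fin m)) N'] [IsManifold (𝓡 m) ∞ N']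
    {η : DForm m N k} {η' : DForm m N' k}
    {F : N → N'} (hF : ContMDiff (𝓡 m) (𝓡 m) ∞ F) (h : DForm.pullback F η' = η) {x₀ : N} {x₁ : N'}
    {y : EuclideanSpace ℝ (Fin m)} (hy : y ∈ (extChartAt (𝓡 m) x₀).target)
    (hy' : F ((extChartAt (𝓡 m) x₀).symm y) ∈ (extChartAt (𝓡 m) x₁).source) :
    η.inChart x₀ y = (η'.inChart x₁ (extChartAt (𝓡 m) x₁ (F ((extChartAt (𝓡 m) x₀).symm y)))
      ).compContinuousLinearMap (fderivWithin ℝ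
        (fun z => extChartAt (𝓡 m) x₁ (F ((extChartAt (𝓡 m) x₀).symm z)))
          (extChartAt (𝓡 m) x₀).target y) := by
  have hT := isOpen_extChartAt_target (I := 𝓡 m) x₀
  have hs := contMDiffOn_extChartAt_symm_top (m := m) x₀
  have hd := (hs y hy).mdifferentiableWithinAt (by simp)
  rw [← DForm.pullbackOn_eq_inChart η' (H := fun z => F ((extChartAt (𝓡 m) x₀).symm z))
    (hT.uniqueDiffWithinAt hy) (((hF.comp_contMDiffOn hs) y hy).mdifferentiableWithinAt (by simp))
    hy']
  have h1 : mfderivWithin 𝓘(ℝ, EuclideanSpace ℝ (Fin m)) (𝓡 m)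
      (fun z => F ((extChartAt (𝓡 m) x₀).symm z)) (extChartAt (𝓡 m) x₀).target y =
      (mfderiv (𝓡 m) (𝓡 m) F ((extChartAt (𝓡 m) x₀).symm y)).comp
      (mfderivWithin 𝓘(ℝ, EuclideanSpace ℝ (Fin m)) (𝓡 m) (extChartAt (𝓡 m) x₀).symm
        (extChartAt (𝓡 m) x₀).target y) :=
    mfderiv_comp_mfderivWithin y (hF.mdifferentiable (by simp) _) hd
      (hT.uniqueDiffWithinAt hy).uniqueMDiffWithinAt
  rw [mfderivWithin_of_mem_nhds (f := (extChartAt (𝓡 m) x₀).symm) (hT.mem_nhds hy)] at h1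
  unfold DForm.pullbackOn DForm.inChart
  rw [h1, ← h]
  rfl

/-- The coordinate expression of `F` pulls one expression of the form back to the other, so the top
powers differ by its Jacobian determinant. -/
theorem liouvilleDensity_eq {Ω : SymplecticForm n M}
    {F : M → M} (hF : ContMDiff (𝓡 (2 * n)) (𝓡 (2 * n)) ∞ F)
    (h : DForm.pullback F Ω.form = Ω.form) {x₀ x₁ : M}
    {y : EuclideanSpace ℝ (Fin (2 * n))} (hy : y ∈ (extChartAt (𝓡 (2 * n)) x₀).target)
    (hy' : F ((extChartAt (𝓡 (2 * n)) x₀).symm y) ∈ (extChartAt (𝓡 (2 * n)) x₁).source) :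
    Ω.liouvilleDensity x₀ y = |(fderivWithin ℝ
        (fun z => extChartAt (𝓡 (2 * n)) x₁ (F ((extChartAt (𝓡 (2 * n)) x₀).symm z)))
          (extChartAt (𝓡 (2 * n)) x₀).target y).det| *
      Ω.liouvilleDensity x₁ (extChartAt (𝓡 (2 * n)) x₁ (F ((extChartAt (𝓡 (2 * n)) x₀).symm y)))
      := by
  unfold liouvilleDensity
  rw [inChart_eq_of_pullback_eq hF h hy hy', ← abs_mul]
  congr 1
  have := wedgePowDivFactorial_comp (Ω.form.inChart x₁
    (extChartAt (𝓡 (2 * n)) x₁ (F ((extChartAt (𝓡 (2 * n)) x₀).symm y)))) (fderivWithin ℝ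
        (fun z => extChartAt (𝓡 (2 * n)) x₁ (F ((extChartAt (𝓡 (2 * n)) x₀).symm z)))
          (extChartAt (𝓡 (2 * n)) x₀).target y)
    (EuclideanSpace.basisFun (Fin (2 * n)) ℝ).toBasis
  have hb : ((EuclideanSpace.basisFun (Fin (2 * n)) ℝ).toBasis : Fin (2 * n) → _) =
      fun i => EuclideanSpace.single i (1 : ℝ) := by
    funext i
    simp
  rwa [hb] at this

theorem inChart_nondegenerate (Ω : SymplecticForm n M) (x : M)
    (v : EuclideanSpace ℝ (Fin (2 * n)))
    (hv : ∀ w, Ω.form.inChart x (extChartAt (𝓡 (2 * n)) x x) ![v, w] = 0) : v = 0 := by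
  let φ' := mfderiv (𝓡 (2 * n)) 𝓘(ℝ, EuclideanSpace ℝ (Fin (2 * n))) (extChartAt (𝓡 (2 * n)) x) x
  have hφ : Function.Bijective φ' :=
    (isInvertible_mfderiv_extChartAt (I := 𝓡 (2 * n)) (mem_extChartAt_source x)).bijective
  obtain ⟨u, hu⟩ := hφ.2 v
  have h0 : u = 0 := by
    refine Ω.nondegenerate x u fun w => ?_
    have h1 := DForm.inChart_apply_mfderiv Ω.form (mem_extChartAt_source (I := 𝓡 (2 * n)) x)
    rw [← h1, ← hv (φ' w), ← hu]
    refine congrArg (Ω.form.inChart x (extChartAt (𝓡 (2 * n)) x x)) ?_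
    funext i
    fin_cases i <;> rfl
  rw [← hu, h0, map_zero]
  rfl

theorem liouvilleDensity_pos (Ω : SymplecticForm n M) (x : M) :
    0 < Ω.liouvilleDensity x (extChartAt (𝓡 (2 * n)) x x) := by
  unfold liouvilleDensity
  rw [abs_pos]
  have := wedgePowDivFactorial_ne_zero (Ω.form.inChart x (extChartAt (𝓡 (2 * n)) x x))
    (Ω.inChart_nondegenerate x) (EuclideanSpace.basisFun (Fin (2 * n)) ℝ).toBasis
  have hb : ((EuclideanSpace.basisFun (Fin (2 * n)) ℝ).toBasis : Fin (2 * n) → _) =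
      fun i => EuclideanSpace.single i (1 : ℝ) := by
    funext i
    simp
  rwa [hb] at this

variable [MeasurableSpace M] [BorelSpace M]

/-- Symplectic maps preserve the Liouville measures of charts. -/
theorem liouvilleInChart_image_eq {Ω : SymplecticForm n M}
    {F : M → M} (hF : ContMDiff (𝓡 (2 * n)) (𝓡 (2 * n)) ∞ F)
    (h : DForm.pullback F Ω.form = Ω.form) {x₀ x₁ : M} {A : Set M} (hA : MeasurableSet A)
    (hA' : MeasurableSet (F '' A)) (hi : Set.InjOn F A)
    (hs : A ⊆ (extChartAt (𝓡 (2 * n)) x₀).source)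
    (hs' : F '' A ⊆ (extChartAt (𝓡 (2 * n)) x₁).source) :
    Ω.liouvilleInChart x₁ (F '' A) = Ω.liouvilleInChart x₀ A := by
  rw [liouvilleInChart_apply Ω x₁ hA', liouvilleInChart_apply Ω x₀ hA]
  set φ₀ := extChartAt (𝓡 (2 * n)) x₀
  set φ₁ := extChartAt (𝓡 (2 * n)) x₁
  have hT := isOpen_extChartAt_target (I := 𝓡 (2 * n)) x₀
  -- In coordinates the image of `A` under `F` is the image under the expression of `F`; the change
  -- of variables formula then applies, its Jacobian being absorbed by `liouvilleDensity_eq`.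
  have himg : φ₁.target ∩ φ₁.symm ⁻¹' (F '' A) =
      (fun z => φ₁ (F (φ₀.symm z))) '' (φ₀.target ∩ φ₀.symm ⁻¹' A) := by
    ext y
    constructor
    · rintro ⟨h1, a, ha, h2⟩
      refine ⟨φ₀ a, ⟨φ₀.map_source (hs ha), ?_⟩, ?_⟩
      · simpa [φ₀.left_inv (hs ha)] using ha
      · simp only [φ₀.left_inv (hs ha), h2, φ₁.right_inv h1]
    · rintro ⟨z, ⟨h1, h2⟩, rfl⟩
      have h3 : F (φ₀.symm z) ∈ F '' A := ⟨_, h2, rfl⟩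
      refine ⟨φ₁.map_source (hs' h3), ?_⟩
      simpa [φ₁.left_inv (hs' h3)] using h3
  rw [himg, lintegral_image_eq_lintegral_abs_det_fderiv_mul volume
    (measurableSet_extChartAt_image x₀ hA)
    (f' := fun y => fderivWithin ℝ (fun z => φ₁ (F (φ₀.symm z))) φ₀.target y)]
  · refine setLIntegral_congr_fun (measurableSet_extChartAt_image x₀ hA) ?_
    rintro y ⟨hy, hy'⟩
    simp only
    rw [liouvilleDensity_eq hF h hy (x₁ := x₁) (hs' ⟨_, hy', rfl⟩),
      ENNReal.ofReal_mul (abs_nonneg _)]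
  · rintro y ⟨hy, hy'⟩
    have h1 : F (φ₀.symm y) ∈ φ₁.source := hs' ⟨_, hy', rfl⟩
    have h2 := DForm.contDiffWithinAt_extChartAt_comp (H := fun z => F (φ₀.symm z))
      ((hF.comp_contMDiffOn (contMDiffOn_extChartAt_symm_top x₀)) y hy) h1
    exact ((h2.differentiableWithinAt (by simp)).hasFDerivWithinAt).mono Set.inter_subset_left
  · rintro y ⟨hy, hy'⟩ z ⟨hz, hz'⟩ hyz
    have h1 := φ₁.injOn (hs' ⟨_, hy', rfl⟩) (hs' ⟨_, hz', rfl⟩) hyz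
    exact φ₀.symm.injOn hy hz (hi hy' hz' h1)

/-- Compatibility of charts is the invariance under the identity map, seen in two charts. -/
theorem liouvilleInChart_eq_of_subset (Ω : SymplecticForm n M) {x₀ x₁ : M} {A : Set M}
    (hA : MeasurableSet A) (hs : A ⊆ (extChartAt (𝓡 (2 * n)) x₀).source)
    (hs' : A ⊆ (extChartAt (𝓡 (2 * n)) x₁).source) :
    Ω.liouvilleInChart x₁ A = Ω.liouvilleInChart x₀ A := by
  have := liouvilleInChart_image_eq (Ω := Ω) (F := fun x => x) contMDiff_id
    (DForm.pullback_id Ω.form) (x₀ := x₀) (x₁ := x₁) hA (by simpa using hA)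
    Function.injective_id.injOn hs (by simpa using hs')
  simpa using this

/-- The Liouville measure restricts to the Liouville measures of charts. -/
theorem liouville_apply_of_subset [CompactSpace M] (Ω : SymplecticForm n M) {x₀ : M}
    {A : Set M} (hA : MeasurableSet A) (hs : A ⊆ (extChartAt (𝓡 (2 * n)) x₀).source) :
    Ω.liouville A = Ω.liouvilleInChart x₀ A := by
  have : Nonempty M := ⟨x₀⟩
  obtain ⟨u, hu⟩ := exists_countable_chart_cover (n := n) (M := M)
  let U : ℕ → Set M := fun k => (extChartAt (𝓡 (2 * n)) (u k)).source
  have hU : ∀ k, MeasurableSet (U k) := fun k => (isOpen_extChartAt_source (u k)).measurableSet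
  have hD : ∀ k, MeasurableSet (disjointed U k) := fun k => MeasurableSet.disjointed hU k
  have hsum : ∀ (μ : Measure M) (B : Set M), MeasurableSet B →
      μ B = ∑' k, μ (B ∩ disjointed U k) := by
    intro μ B hB
    have h := Measure.restrict_iUnion (μ := μ) (disjoint_disjointed U) hD
    rw [iUnion_disjointed, show ⋃ k, U k = Set.univ from hu, Measure.restrict_univ] at h
    nth_rewrite 1 [h]
    rw [Measure.sum_apply _ hB]
    simp only [Measure.restrict_apply hB]
  have hsrc : ∀ x : M, MeasurableSet (extChartAt (𝓡 (2 * n)) x).source := fun x =>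
    (isOpen_extChartAt_source x).measurableSet
  refine le_antisymm ?_ (Measure.le_iff'.1 (le_iSup (fun x => Ω.liouvilleInChart x) x₀) A)
  -- `ν` glues the chart measures along disjoint pieces. It dominates every chart measure, hence
  -- their supremum, and it agrees with each of them inside the domain of the chart.
  let ν : Measure M := Measure.sum fun k => (Ω.liouvilleInChart (u k)).restrict (disjointed U k)
  have hν : ∀ B, MeasurableSet B → ν B = ∑' k, Ω.liouvilleInChart (u k) (B ∩ disjointed U k) := by
    intro B hB
    rw [Measure.sum_apply _ hB]
    simp only [Measure.restrict_apply hB]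
  have hle : Ω.liouville ≤ ν := by
    refine iSup_le fun x => Measure.le_iff.2 fun B hB => ?_
    rw [hsum _ B hB, hν B hB]
    refine ENNReal.tsum_le_tsum fun k => ?_
    rw [liouvilleInChart_eq_inter_source Ω x (hB.inter (hD k)),
      Ω.liouvilleInChart_eq_of_subset (x₀ := u k) ((hB.inter (hD k)).inter (hsrc x))
      (fun y hy => disjointed_subset U k hy.1.2) Set.inter_subset_right]
    exact measure_mono Set.inter_subset_left
  refine (Measure.le_iff'.1 hle A).trans (le_of_eq ?_)
  rw [hν A hA, hsum (Ω.liouvilleInChart x₀) A hA]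
  refine tsum_congr fun k => ?_
  exact Ω.liouvilleInChart_eq_of_subset (hA.inter (hD k)) (Set.inter_subset_left.trans hs)
    (fun y hy => disjointed_subset U k hy.2)

/-- The Liouville measure is preserved by symplectic diffeomorphisms. -/
theorem map_liouville [CompactSpace M] {Ω : SymplecticForm n M}
    {F G : M → M} (hF : ContMDiff (𝓡 (2 * n)) (𝓡 (2 * n)) ∞ F) (hG : Continuous G)
    (hGF : ∀ x, G (F x) = x) (hFG : ∀ x, F (G x) = x)
    (h : DForm.pullback F Ω.form = Ω.form) : Ω.liouville.map F = Ω.liouville := by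
  rcases isEmpty_or_nonempty M with hM | hM
  · exact Subsingleton.elim _ _
  obtain ⟨u, hu⟩ := exists_countable_chart_cover (n := n) (M := M)
  have hsrc : ∀ x : M, IsOpen (extChartAt (𝓡 (2 * n)) x).source := fun x =>
    isOpen_extChartAt_source x
  -- Each piece lies in one chart and has its preimage under `F` in one chart, so that
  -- `liouvilleInChart_image_eq` applies to it.
  have hcov : ⋃ k : ℕ × ℕ, (extChartAt (𝓡 (2 * n)) (u k.1)).source ∩
      G ⁻¹' (extChartAt (𝓡 (2 * n)) (u k.2)).source = Set.univ := by
    refine Set.eq_univ_of_forall fun x => ?_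
    obtain ⟨k, hk⟩ := Set.mem_iUnion.1 (hu.symm ▸ Set.mem_univ x)
    obtain ⟨l, hl⟩ := Set.mem_iUnion.1 (hu.symm ▸ Set.mem_univ (G x))
    exact Set.mem_iUnion.2 ⟨(k, l), hk, hl⟩
  refine (Measure.ext_iff_of_iUnion_eq_univ hcov).2 ?_
  rintro ⟨k, l⟩
  refine Measure.ext fun B hB => ?_
  have hC := (hsrc (u k)).inter ((hsrc (u l)).preimage hG)
  have hBC := hB.inter hC.measurableSet
  rw [Measure.restrict_apply hB, Measure.restrict_apply hB,
    Measure.map_apply hF.continuous.measurable hBC]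
  set C := B ∩ ((extChartAt (𝓡 (2 * n)) (u k)).source ∩
    G ⁻¹' (extChartAt (𝓡 (2 * n)) (u l)).source) with hCdef
  have hFC : F '' (F ⁻¹' C) = C := Set.image_preimage_eq C fun x => ⟨G x, hFG x⟩
  have hA := hF.continuous.measurable hBC
  have hs : C ⊆ (extChartAt (𝓡 (2 * n)) (u k)).source := fun x hx => hx.2.1
  have hs' : F ⁻¹' C ⊆ (extChartAt (𝓡 (2 * n)) (u l)).source := fun x hx => by
    have := hx.2.2
    simpa [hGF] using this
  rw [Ω.liouville_apply_of_subset hA hs', Ω.liouville_apply_of_subset hBC hs,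
    ← liouvilleInChart_image_eq hF h hA (hFC.symm ▸ hBC)
      (Function.LeftInverse.injective hGF).injOn hs' (hFC.symm ▸ hs), hFC]

/-- The Liouville measure is finite and positive on a small neighbourhood of each point. -/
theorem exists_nhds_liouville [CompactSpace M] (Ω : SymplecticForm n M) (x : M) :
    ∃ U : Set M, IsOpen U ∧ x ∈ U ∧ 0 < Ω.liouville U ∧ Ω.liouville U < ⊤ := by
  set φ := extChartAt (𝓡 (2 * n)) x with hφ
  have hpos := Ω.liouvilleDensity_pos x
  -- A coordinate ball on which the density stays between half its central value, which is positive,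
  -- and that value plus one.
  obtain ⟨r, hr, hball⟩ := Metric.eventually_nhds_iff_ball.1
    (((isOpen_extChartAt_target (I := 𝓡 (2 * n)) x).eventually_mem (mem_extChartAt_target x)).and
      (((Ω.continuousAt_liouvilleDensity x).eventually_lt_const (lt_add_one _)).and
        ((Ω.continuousAt_liouvilleDensity x).eventually_const_lt (half_lt_self hpos))))
  have hsub : Metric.ball (φ x) r ⊆ φ.target := fun y hy => (hball y hy).1
  have hUo : IsOpen (φ.source ∩ φ ⁻¹' Metric.ball (φ x) r) :=
    (continuousOn_extChartAt x).isOpen_inter_preimage (isOpen_extChartAt_source x)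
      Metric.isOpen_ball
  have himg : φ.target ∩ φ.symm ⁻¹' (φ.source ∩ φ ⁻¹' Metric.ball (φ x) r) =
      Metric.ball (φ x) r := by
    ext y
    constructor
    · rintro ⟨h1, -, h2⟩
      simpa [Set.mem_preimage, φ.right_inv h1] using h2
    · intro hy
      refine ⟨hsub hy, φ.map_target (hsub hy), ?_⟩
      rwa [Set.mem_preimage, φ.right_inv (hsub hy)]
  refine ⟨_, hUo, ⟨mem_extChartAt_source x, Metric.mem_ball_self hr⟩, ?_⟩
  rw [Ω.liouville_apply_of_subset hUo.measurableSet Set.inter_subset_left,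
    liouvilleInChart_apply Ω x hUo.measurableSet, himg]
  constructor
  · refine lt_of_lt_of_le ?_ (setLIntegral_mono' Metric.isOpen_ball.measurableSet fun y hy =>
      ENNReal.ofReal_le_ofReal (hball y hy).2.2.le)
    rw [setLIntegral_const]
    exact ENNReal.mul_pos (by simpa using hpos) (Metric.measure_ball_pos volume _ hr).ne'
  · refine lt_of_le_of_lt (setLIntegral_mono' Metric.isOpen_ball.measurableSet fun y hy =>
      ENNReal.ofReal_le_ofReal (hball y hy).2.1.le) ?_
    rw [setLIntegral_const]
    exact ENNReal.mul_lt_top ENNReal.ofReal_lt_top measure_ball_lt_top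

theorem liouville_univ_pos [CompactSpace M] [Nonempty M] (Ω : SymplecticForm n M) :
    0 < Ω.liouville Set.univ := by
  obtain ⟨x⟩ := ‹Nonempty M›
  obtain ⟨U, -, -, h, -⟩ := Ω.exists_nhds_liouville x
  exact h.trans_le (measure_mono (Set.subset_univ U))

theorem liouville_univ_lt_top [CompactSpace M] (Ω : SymplecticForm n M) :
    Ω.liouville Set.univ < ⊤ := by
  choose U hU hx _ hfin using Ω.exists_nhds_liouville
  obtain ⟨t, ht⟩ := isCompact_univ.elim_finite_subcover U hU
    (fun x _ => Set.mem_iUnion.2 ⟨x, hx x⟩)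
  exact (measure_mono ht).trans_lt ((measure_biUnion_finset_le t U).trans_lt
    (ENNReal.sum_lt_top.2 fun x _ => hfin x))

end SymplecticForm

/-! ### The exterior derivative on partial derivatives, and smooth families -/

namespace DForm

variable {m k : ℕ}
  {N : Type*} [TopologicalSpace N] [ChartedSpace (EuclideanSpace ℝ (Fin m)) N]
  {V : Type*} [NormedAddCommGroup V] [NormedSpace ℝ V]
  {W : Type*} [NormedAddCommGroup W] [NormedSpace ℝ W]

theorem mfderivWithin_partial_fst {H : V × W → N} {S : Set V} {T : Set W} {y : V} {z : W}
    (hS : UniqueDiffWithinAt ℝ S y) (hz : z ∈ T)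
    (hH : MDifferentiableWithinAt 𝓘(ℝ, V × W) (𝓡 m) H (S ×ˢ T) (y, z)) (v : V) :
    mfderivWithin 𝓘(ℝ, V) (𝓡 m) (fun y' => H (y', z)) S y v =
      mfderivWithin 𝓘(ℝ, V × W) (𝓡 m) H (S ×ˢ T) (y, z) ((v, 0) : V × W) := by
  have hd : HasFDerivWithinAt (fun y' : V => (y', z)) (ContinuousLinearMap.inl ℝ V W) S y :=
    (hasFDerivAt_prodMk_left y z).hasFDerivWithinAt
  have h := mfderivWithin_comp (I := 𝓘(ℝ, V)) (I' := 𝓘(ℝ, V × W)) (I'' := 𝓡 m) (g := H)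
    (f := fun y' : V => (y', z)) (s := S) (u := S ×ˢ T) y hH
    hd.differentiableWithinAt.mdifferentiableWithinAt
    (fun y' hy' => ⟨hy', hz⟩) hS.uniqueMDiffWithinAt
  rw [mfderivWithin_eq_fderivWithin, hd.fderivWithin hS] at h
  exact congrArg (fun L => L v) h

theorem mfderivWithin_partial_snd {H : V × W → N} {S : Set V} {T : Set W} {y : V} {z : W}
    (hT : UniqueDiffWithinAt ℝ T z) (hy : y ∈ S)
    (hH : MDifferentiableWithinAt 𝓘(ℝ, V × W) (𝓡 m) H (S ×ˢ T) (y, z)) (w : W) :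
    mfderivWithin 𝓘(ℝ, W) (𝓡 m) (fun z' => H (y, z')) T z w =
      mfderivWithin 𝓘(ℝ, V × W) (𝓡 m) H (S ×ˢ T) (y, z) ((0, w) : V × W) := by
  have hd : HasFDerivWithinAt (fun z' : W => (y, z')) (ContinuousLinearMap.inr ℝ V W) T z :=
    (hasFDerivAt_prodMk_right y z).hasFDerivWithinAt
  have h := mfderivWithin_comp (I := 𝓘(ℝ, W)) (I' := 𝓘(ℝ, V × W)) (I'' := 𝓡 m) (g := H)
    (f := fun z' : W => (y, z')) (s := T) (u := S ×ˢ T) z hH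
    hd.differentiableWithinAt.mdifferentiableWithinAt
    (fun z' hz' => ⟨hy, hz'⟩) hT.uniqueMDiffWithinAt
  rw [mfderivWithin_eq_fderivWithin, hd.fderivWithin hT] at h
  exact congrArg (fun L => L w) h

variable [IsManifold (𝓡 m) ∞ N]

/-- The exterior derivative of a `1`-form, evaluated on the two partial derivatives of a map
defined on a product. -/
theorem d_apply_partial {η : DForm m N 1} (hη : η.IsSmooth) {H : V × W → N}
    {S : Set V} {T : Set W} (hS : UniqueDiffOn ℝ S) (hT : UniqueDiffOn ℝ T)
    (hST : S ×ˢ T ⊆ closure (interior (S ×ˢ T)))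
    (hH : ContMDiffOn 𝓘(ℝ, V × W) (𝓡 m) ∞ H (S ×ˢ T)) {y : V} {z : W} (hy : y ∈ S) (hz : z ∈ T)
    (v : V) (w : W) :
    η.d (H (y, z)) ![mfderivWithin 𝓘(ℝ, V) (𝓡 m) (fun y' => H (y', z)) S y v,
      mfderivWithin 𝓘(ℝ, W) (𝓡 m) (fun z' => H (y, z')) T z w] =
    fderivWithin ℝ (fun y' => η (H (y', z))
      ![mfderivWithin 𝓘(ℝ, W) (𝓡 m) (fun z' => H (y', z')) T z w]) S y v -
    fderivWithin ℝ (fun z' => η (H (y, z'))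
      ![mfderivWithin 𝓘(ℝ, V) (𝓡 m) (fun y' => H (y', z')) S y v]) T z w := by
  have hU := hS.prod hT
  have hd : ∀ y ∈ S, ∀ z ∈ T, MDifferentiableWithinAt 𝓘(ℝ, V × W) (𝓡 m) H (S ×ˢ T) (y, z) :=
    fun y hy z hz => (hH (y, z) ⟨hy, hz⟩).mdifferentiableWithinAt (by simp)
  -- The vectors `(v, 0)` and `(0, w)` are constant, so `d` of the pulled-back `1`-form on them is
  -- the difference of two directional derivatives, without bracket term.
  have h := congrArg (fun L => L ![((v, 0) : V × W), (0, w)])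
    (extDerivWithin_pullbackOn hη hU hH (y := (y, z)) ⟨hy, hz⟩ (hST ⟨hy, hz⟩))
  rw [extDerivWithin_apply (differentiableWithinAt_pullbackOn (y := (y, z)) hη hU hH
    ⟨hy, hz⟩) (hU (y, z) ⟨hy, hz⟩),
    Fin.sum_univ_two] at h
  have hr0 : (Fin.removeNth 0 ![((v, 0) : V × W), (0, w)]) = ![(0, w)] := by
    funext i; fin_cases i; rfl
  have hr1 : (Fin.removeNth 1 ![((v, 0) : V × W), (0, w)]) = ![(v, 0)] := by
    funext i; fin_cases i; rfl
  rw [hr0, hr1] at h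
  have hβ : ∀ u : V × W, DifferentiableWithinAt ℝ (fun x => pullbackOn H (S ×ˢ T) η x ![u])
      (S ×ˢ T) (y, z) := fun u =>
    ((contDiffOn_pullbackOn_apply hη hU hH u) (y, z) ⟨hy, hz⟩).differentiableWithinAt (by simp)
  have h1 : fderivWithin ℝ (fun y' => η (H (y', z))
      ![mfderivWithin 𝓘(ℝ, W) (𝓡 m) (fun z' => H (y', z')) T z w]) S y v =
      fderivWithin ℝ (fun x => pullbackOn H (S ×ˢ T) η x ![(0, w)]) (S ×ˢ T) (y, z) (v, 0) := by
    have hi : HasFDerivWithinAt (fun y' : V => (y', z)) (ContinuousLinearMap.inl ℝ V W) S y :=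
      (hasFDerivAt_prodMk_left y z).hasFDerivWithinAt
    have hc := (hβ (0, w)).hasFDerivWithinAt.comp (t := S ×ˢ T) y hi (fun y' hy' => ⟨hy', hz⟩)
    have hc' := HasFDerivWithinAt.congr' hc (f₁ := fun y' => η (H (y', z))
      ![mfderivWithin 𝓘(ℝ, W) (𝓡 m) (fun z' => H (y', z')) T z w]) (fun y' hy' => by
        refine congrArg (η (H (y', z))) ?_
        funext i; fin_cases i
        exact mfderivWithin_partial_snd (hT z hz) hy' (hd y' hy' z hz) w) hy
    rw [hc'.fderivWithin (hS y hy)]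
    rfl
  have h2 : fderivWithin ℝ (fun z' => η (H (y, z'))
      ![mfderivWithin 𝓘(ℝ, V) (𝓡 m) (fun y' => H (y', z')) S y v]) T z w =
      fderivWithin ℝ (fun x => pullbackOn H (S ×ˢ T) η x ![(v, 0)]) (S ×ˢ T) (y, z) (0, w) := by
    have hi : HasFDerivWithinAt (fun z' : W => (y, z')) (ContinuousLinearMap.inr ℝ V W) T z :=
      (hasFDerivAt_prodMk_right y z).hasFDerivWithinAt
    have hc := (hβ (v, 0)).hasFDerivWithinAt.comp (t := S ×ˢ T) z hi (fun z' hz' => ⟨hy, hz'⟩)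
    have hc' := HasFDerivWithinAt.congr' hc (f₁ := fun z' => η (H (y, z'))
      ![mfderivWithin 𝓘(ℝ, V) (𝓡 m) (fun y' => H (y', z')) S y v]) (fun z' hz' => by
        refine congrArg (η (H (y, z'))) ?_
        funext i; fin_cases i
        exact mfderivWithin_partial_fst (hS y hy) hz' (hd y hy z' hz') v) hz
    rw [hc'.fderivWithin (hT z hz)]
    rfl
  rw [h1, h2, mfderivWithin_partial_fst (hS y hy) hz (hd y hy z hz),
    mfderivWithin_partial_snd (hT z hz) hy (hd y hy z hz)]
  have h3 : pullbackOn H (S ×ˢ T) η.d (y, z) ![((v, 0) : V × W), (0, w)] = η.d (H (y, z))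
      ![mfderivWithin 𝓘(ℝ, V × W) (𝓡 m) H (S ×ˢ T) (y, z) ((v, 0) : V × W),
        mfderivWithin 𝓘(ℝ, V × W) (𝓡 m) H (S ×ˢ T) (y, z) ((0, w) : V × W)] := by
    refine congrArg (η.d (H (y, z))) ?_
    funext i; fin_cases i <;> rfl
  rw [← h3, ← h]
  simp [sub_eq_add_neg]

variable {m' : ℕ} {Q : Type*} [TopologicalSpace Q] [ChartedSpace (EuclideanSpace ℝ (Fin m')) Q]

theorem contMDiffOn_of_forall_chart {G : V × Q → ℝ} {S : Set V}
    (hG : ∀ p₀ : Q, ContDiffOn ℝ ∞ (fun x : V × EuclideanSpace ℝ (Fin m') =>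
      G (x.1, (extChartAt (𝓡 m') p₀).symm x.2)) (S ×ˢ (extChartAt (𝓡 m') p₀).target)) :
    ContMDiffOn (𝓘(ℝ, V).prod (𝓡 m')) 𝓘(ℝ, ℝ) ∞ G (S ×ˢ Set.univ) := by
  rintro ⟨y, p⟩ ⟨hy, -⟩
  let φ := extChartAt (𝓡 m') p
  have h1 : ContMDiffWithinAt (𝓘(ℝ, V).prod (𝓡 m')) 𝓘(ℝ, V × EuclideanSpace ℝ (Fin m')) ∞
      (fun x : V × Q => (x.1, φ x.2)) (S ×ˢ φ.source) (y, p) :=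
    contMDiffWithinAt_fst.prodMk_space
      ((contMDiffAt_extChartAt (I := 𝓡 m') (n := ∞) (x := p)).contMDiffWithinAt.comp (y, p)
        contMDiffWithinAt_snd (Set.mapsTo_univ _ _))
  have hp : p ∈ φ.source := mem_extChartAt_source p
  have h2 : ContMDiffWithinAt (𝓘(ℝ, V).prod (𝓡 m')) 𝓘(ℝ, ℝ) ∞
      (fun x : V × Q => G (x.1, φ.symm (φ x.2))) (S ×ˢ φ.source) (y, p) :=
    ContMDiffWithinAt.comp (f := fun x : V × Q => (x.1, φ x.2))
      (g := fun x : V × EuclideanSpace ℝ (Fin m') => G (x.1, φ.symm x.2)) (t := S ×ˢ φ.target)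
      (y, p) ((hG p (y, φ p) ⟨hy, φ.map_source hp⟩).contMDiffWithinAt) h1
      (fun x hx => ⟨hx.1, φ.map_source hx.2⟩)
  have h3 : ContMDiffWithinAt (𝓘(ℝ, V).prod (𝓡 m')) 𝓘(ℝ, ℝ) ∞ G (S ×ˢ φ.source) (y, p) :=
    h2.congr_of_mem (fun x hx => by rw [φ.left_inv hx.2]) ⟨hy, hp⟩
  refine h3.mono_of_mem_nhdsWithin ?_
  have : Set.univ ×ˢ φ.source ∈ 𝓝 (y, p) :=
    prod_mem_nhds Filter.univ_mem ((isOpen_extChartAt_source p).mem_nhds hp)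
  filter_upwards [mem_nhdsWithin_of_mem_nhds this, self_mem_nhdsWithin] with x h4 h5
  exact ⟨h5.1, h4.2⟩

variable [IsManifold (𝓡 m') ∞ Q]

theorem contMDiffOn_comp_extChartAt_symm {E' H' Z : Type*} [NormedAddCommGroup E']
    [NormedSpace ℝ E'] [TopologicalSpace H'] {J : ModelWithCorners ℝ E' H'} [TopologicalSpace Z]
    [ChartedSpace H' Z] {K : V × Q → Z} {S : Set V}
    (hK : ContMDiffOn (𝓘(ℝ, V).prod (𝓡 m')) J ∞ K (S ×ˢ Set.univ)) (p₀ : Q) :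
    ContMDiffOn 𝓘(ℝ, V × EuclideanSpace ℝ (Fin m')) J ∞
      (fun x => K (x.1, (extChartAt (𝓡 m') p₀).symm x.2)) (S ×ˢ (extChartAt (𝓡 m') p₀).target) := by
  have h1 : ContMDiffOn 𝓘(ℝ, V × EuclideanSpace ℝ (Fin m')) 𝓘(ℝ, V) ∞
      (fun x : V × EuclideanSpace ℝ (Fin m') => x.1) (S ×ˢ (extChartAt (𝓡 m') p₀).target) :=
    contDiff_fst.contMDiff.contMDiffOn
  have h2 : ContMDiffOn 𝓘(ℝ, V × EuclideanSpace ℝ (Fin m')) 𝓘(ℝ, EuclideanSpace ℝ (Fin m')) ∞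
      (fun x : V × EuclideanSpace ℝ (Fin m') => x.2) (S ×ˢ (extChartAt (𝓡 m') p₀).target) :=
    contDiff_snd.contMDiff.contMDiffOn
  have h3 := (contMDiffOn_extChartAt_symm (I := 𝓡 m') (n := ∞) p₀).comp h2 (fun x hx => hx.2)
  exact hK.comp (h1.prodMk h3) (fun x hx => ⟨hx.1, Set.mem_univ _⟩)

/-- The evaluation of a `1`-form on the derivative with respect to the parameter of a family
of maps is smooth. -/
theorem contMDiffOn_apply_mfderivWithin {η : DForm m N 1} (hη : η.IsSmooth) {K : V × Q → N}
    {S : Set V} (hS : UniqueDiffOn ℝ S)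
    (hK : ContMDiffOn (𝓘(ℝ, V).prod (𝓡 m')) (𝓡 m) ∞ K (S ×ˢ Set.univ)) (v : V) :
    ContMDiffOn (𝓘(ℝ, V).prod (𝓡 m')) 𝓘(ℝ, ℝ) ∞
      (fun x : V × Q => η (K x) ![mfderivWithin 𝓘(ℝ, V) (𝓡 m) (fun y => K (y, x.2)) S x.1 v])
      (S ×ˢ Set.univ) := by
  refine contMDiffOn_of_forall_chart fun p₀ => ?_
  have hT := isOpen_extChartAt_target (I := 𝓡 m') p₀
  have hH := contMDiffOn_comp_extChartAt_symm hK p₀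
  refine (contDiffOn_pullbackOn_apply hη (hS.prod hT.uniqueDiffOn) hH (v, 0)).congr ?_
  rintro ⟨y, z⟩ ⟨hy, hz⟩
  have := mfderivWithin_partial_fst (hS y hy) hz
    ((hH (y, z) ⟨hy, hz⟩).mdifferentiableWithinAt (by simp)) v
  simp only at this ⊢
  rw [this]
  refine congrArg (η (K (y, (extChartAt (𝓡 m') p₀).symm z))) ?_
  funext i; fin_cases i; rfl

/-- The partial derivative with respect to the parameter of a smooth family of functions is
smooth. -/
theorem contMDiffOn_fderivWithin_apply {f : V × Q → ℝ} {S : Set V} (hS : UniqueDiffOn ℝ S)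
    (hf : ContMDiffOn (𝓘(ℝ, V).prod (𝓡 m')) 𝓘(ℝ, ℝ) ∞ f (S ×ˢ Set.univ)) (v : V) :
    ContMDiffOn (𝓘(ℝ, V).prod (𝓡 m')) 𝓘(ℝ, ℝ) ∞
      (fun x : V × Q => fderivWithin ℝ (fun y => f (y, x.2)) S x.1 v) (S ×ˢ Set.univ) := by
  refine contMDiffOn_of_forall_chart fun p₀ => ?_
  have hT := isOpen_extChartAt_target (I := 𝓡 m') p₀
  have hH := (contMDiffOn_comp_extChartAt_symm hf p₀).contDiffOn
  have h1 := (hH.fderivWithin (m := ∞) (hS.prod hT.uniqueDiffOn) (by simp)).clm_apply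
    (contDiffOn_const (c := ((v, 0) : V × EuclideanSpace ℝ (Fin m'))))
  refine h1.congr ?_
  rintro ⟨y, z⟩ ⟨hy, hz⟩
  have hd : HasFDerivWithinAt (fun y' : V => (y', z))
      (ContinuousLinearMap.inl ℝ V (EuclideanSpace ℝ (Fin m'))) S y :=
    (hasFDerivAt_prodMk_left y z).hasFDerivWithinAt
  have hc := ((hH (y, z) ⟨hy, hz⟩).differentiableWithinAt (by simp)).hasFDerivWithinAt.comp
      (t := S ×ˢ (extChartAt (𝓡 m') p₀).target) y hd (fun y' hy' => ⟨hy', hz⟩)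
  exact congrArg (fun L => L v) (hc.fderivWithin (hS y hy))

end DForm

/-! ### Naturality of the exterior derivative on manifolds -/

namespace DForm

variable {m m' k : ℕ}
  {N : Type*} [TopologicalSpace N] [ChartedSpace (EuclideanSpace ℝ (Fin m)) N]
  [IsManifold (𝓡 m) ∞ N]
  {N' : Type*} [TopologicalSpace N'] [ChartedSpace (EuclideanSpace ℝ (Fin m')) N']
  [IsManifold (𝓡 m') ∞ N']

/-- The exterior derivative commutes with pull-back by smooth maps of manifolds. -/
theorem d_pullback {η : DForm m' N' k} (hη : η.IsSmooth) {F : N → N'}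
    (hF : ContMDiff (𝓡 m) (𝓡 m') ∞ F) : (pullback F η).d = pullback (m := m) F η.d := by
  funext x
  let φ := extChartAt (𝓡 m) x
  have hT : IsOpen φ.target := isOpen_extChartAt_target x
  have hx : x ∈ φ.source := mem_extChartAt_source x
  have hφx : φ x ∈ φ.target := φ.map_source hx
  have hs : ContMDiffOn 𝓘(ℝ, EuclideanSpace ℝ (Fin m)) (𝓡 m) ∞ φ.symm φ.target :=
    contMDiffOn_extChartAt_symm x
  have hH : ContMDiffOn 𝓘(ℝ, EuclideanSpace ℝ (Fin m)) (𝓡 m') ∞ (fun z => F (φ.symm z)) φ.target :=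
    hF.comp_contMDiffOn hs
  have hD : ∀ y ∈ φ.target, mfderivWithin 𝓘(ℝ, EuclideanSpace ℝ (Fin m)) (𝓡 m')
      (fun z => F (φ.symm z)) φ.target y = (mfderiv (𝓡 m) (𝓡 m') F (φ.symm y)).comp
      (mfderiv 𝓘(ℝ, EuclideanSpace ℝ (Fin m)) (𝓡 m) φ.symm y) := by
    intro y hy
    rw [← mfderivWithin_of_mem_nhds (f := φ.symm) (hT.mem_nhds hy)]
    exact mfderiv_comp_mfderivWithin y (hF.mdifferentiable (by simp) _)
      ((hs y hy).mdifferentiableWithinAt (by simp)) (hT.uniqueDiffWithinAt hy).uniqueMDiffWithinAt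
  have h1 : ∀ y ∈ φ.target, (pullback F η).inChart x y =
      pullbackOn (fun z => F (φ.symm z)) φ.target η y := by
    intro y hy
    unfold pullbackOn
    rw [hD y hy]
    rfl
  have h2 : extDeriv ((pullback F η).inChart x) (φ x) =
      pullbackOn (fun z => F (φ.symm z)) φ.target η.d (φ x) := by
    rw [← extDerivWithin_pullbackOn hη hT.uniqueDiffOn hH hφx
      (by rw [hT.interior_eq]; exact subset_closure hφx)]
    have h3 : (pullback F η).inChart x =ᶠ[𝓝 (φ x)]
        pullbackOn (fun z => F (φ.symm z)) φ.target η := by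
      filter_upwards [hT.mem_nhds hφx] with y hy using h1 y hy
    rw [h3.extDeriv_eq]
    unfold extDeriv extDerivWithin
    rw [fderivWithin_of_mem_nhds (hT.mem_nhds hφx)]
  ext v
  change extDeriv ((pullback F η).inChart x) (φ x) _ = _
  rw [h2]
  refine apply_congr η.d (congrArg F (φ.left_inv hx)) _ _ ?_
  funext i
  change mfderivWithin 𝓘(ℝ, EuclideanSpace ℝ (Fin m)) (𝓡 m')
      (fun z => F (φ.symm z)) φ.target (φ x) (mfderiv (𝓡 m) 𝓘(ℝ, EuclideanSpace ℝ (Fin m)) φ x (v i))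
      = mfderiv (𝓡 m) (𝓡 m') F x (v i)
  -- Near `x` the map `F` factors as its expression in the chart after the chart, so the chart
  -- derivatives introduced by `d` and `inChart` cancel.
  have h5 : mfderiv (𝓡 m) (𝓡 m') (fun z => F (φ.symm (φ z))) x =
      (mfderivWithin 𝓘(ℝ, EuclideanSpace ℝ (Fin m)) (𝓡 m')
      (fun z => F (φ.symm z)) φ.target (φ x)).comp
      (mfderiv (𝓡 m) 𝓘(ℝ, EuclideanSpace ℝ (Fin m)) φ x) := by
    rw [mfderivWithin_of_mem_nhds (hT.mem_nhds hφx)]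
    exact mfderiv_comp (g := fun z => F (φ.symm z)) x
      ((hH _ hφx).contMDiffAt (hT.mem_nhds hφx) |>.mdifferentiableAt (by simp))
      (mdifferentiableAt_extChartAt (mem_chart_source _ x))
  have h6 : mfderiv (𝓡 m) (𝓡 m') (fun z => F (φ.symm (φ z))) x = mfderiv (𝓡 m) (𝓡 m') F x := by
    have h7 : (fun z => F (φ.symm (φ z))) =ᶠ[𝓝 x] F := by
      filter_upwards [(isOpen_extChartAt_source (I := 𝓡 m) x).mem_nhds hx] with z hz
      rw [φ.left_inv hz]
    exact h7.mfderiv_eq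
  rw [← h6, h5]
  rfl

end DForm

/-! ### Paths on the unit interval as functions on the line -/

section ProjIcc

variable {E H : Type*} [NormedAddCommGroup E] [NormedSpace ℝ E] [TopologicalSpace H]
  {J : ModelWithCorners ℝ E H} {Q : Type*} [TopologicalSpace Q] [ChartedSpace H Q]
  {E' H' : Type*} [NormedAddCommGroup E'] [NormedSpace ℝ E'] [TopologicalSpace H']
  {J' : ModelWithCorners ℝ E' H'} {Z : Type*} [TopologicalSpace Z] [ChartedSpace H' Z]

/-- The projection of `ℝ` to the unit interval. -/
noncomputable abbrev projUnit (t : ℝ) : unitInterval := Set.projIcc 0 1 zero_le_one t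

theorem contMDiffOn_projUnit : ContMDiffOn 𝓘(ℝ, ℝ) (𝓡∂ 1) ∞ projUnit (Set.Icc 0 1) :=
  contMDiffOn_projIcc

@[simp] theorem projUnit_coe (t : unitInterval) : projUnit t = t := Set.projIcc_val _ t

/-- This trades the manifold with boundary `unitInterval` for the subset `Icc 0 1` of `ℝ`, where
derivatives within a set and the formula for `d` are available. -/
theorem contMDiffOn_comp_projUnit {f : unitInterval × Q → Z}
    (hf : ContMDiff ((𝓡∂ 1).prod J) J' ∞ f) :
    ContMDiffOn (𝓘(ℝ, ℝ).prod J) J' ∞ (fun x : ℝ × Q => f (projUnit x.1, x.2))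
      (Set.Icc 0 1 ×ˢ Set.univ) :=
  hf.comp_contMDiffOn ((contMDiffOn_projUnit.comp contMDiffOn_fst fun _ hx => hx.1).prodMk
    contMDiffOn_snd)

theorem contMDiff_comp_coe_unitInterval {g : ℝ × Q → Z}
    (hg : ContMDiffOn (𝓘(ℝ, ℝ).prod J) J' ∞ g (Set.Icc 0 1 ×ˢ Set.univ)) :
    ContMDiff ((𝓡∂ 1).prod J) J' ∞ (fun x : unitInterval × Q => g (x.1, x.2)) :=
  hg.comp_contMDiff (((contMDiff_subtypeVal_Icc (x := (0 : ℝ)) (y := 1)).comp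
    contMDiff_fst).prodMk contMDiff_snd) fun x => ⟨x.1.2, Set.mem_univ _⟩

end ProjIcc

/-! ### Geometry of the bundle and the symplectic maps induced on the base -/

section Prequantum

variable {n : ℕ} {M : Type*} [TopologicalSpace M]
    [ChartedSpace (EuclideanSpace ℝ (Fin (2 * n))) M] {Ω : SymplecticForm n M}
    {P : Type*} [TopologicalSpace P] [ChartedSpace (EuclideanSpace ℝ (Fin (2 * n + 1))) P]
    [MulAction Circle P]

namespace PrequantumBundle

variable (B : PrequantumBundle Ω P)

/-- There is a smooth local section through each point. -/
theorem exists_local_section (p : P) : ∃ (U : Set M) (σ : M → P), IsOpen U ∧ B.proj p ∈ U ∧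
    ContMDiffOn (𝓡 (2 * n)) (𝓡 (2 * n + 1)) ∞ σ U ∧ σ (B.proj p) = p ∧
    ∀ x ∈ U, B.proj (σ x) = x := by
  obtain ⟨e, hx, he, hes, -⟩ := B.exists_trivialization (B.proj p)
  have hp : p ∈ e.source := e.mem_source.2 hx
  refine ⟨e.baseSet, fun x => e.toOpenPartialHomeomorph.symm (x, (e p).2), e.open_baseSet, hx, ?_,
    ?_, fun x hx => e.proj_symm_apply' hx⟩
  · refine hes.comp ((contMDiff_id.prodMk contMDiff_const).contMDiffOn) fun x hx => ?_
    exact e.mem_target.2 hx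
  · have : (B.proj p, (e p).2) = e p := Prod.ext (e.coe_fst hp).symm rfl
    simp only [this]
    exact e.toOpenPartialHomeomorph.left_inv hp

/-- In an equivariant trivialization, `z` is the quotient of the two fibre coordinates. -/
theorem exists_smul_eq {p q : P} (h : B.proj p = B.proj q) : ∃ z : Circle, z • p = q := by
  obtain ⟨e, hx, -, -, hz⟩ := B.exists_trivialization (B.proj p)
  have hp : p ∈ e.source := e.mem_source.2 hx
  have hq : q ∈ e.source := e.mem_source.2 (h ▸ hx)
  refine ⟨(e q).2 * (e p).2⁻¹, ?_⟩
  have hzp : ((e q).2 * (e p).2⁻¹) • p ∈ e.source := e.mem_source.2 (by rwa [B.proj_smul])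
  refine e.toOpenPartialHomeomorph.injOn hzp hq (Prod.ext ?_ ?_)
  · exact (e.coe_fst hzp).trans ((B.proj_smul _ _).trans (h.trans (e.coe_fst hq).symm))
  · exact (hz p hp _).trans (by simp)

/-- The derivative of a local section through `p` is a right inverse. -/
theorem mfderiv_proj_surjective (p : P) :
    Function.Surjective (mfderiv (𝓡 (2 * n + 1)) (𝓡 (2 * n)) B.proj p) := by
  obtain ⟨U, σ, hU, hp, hσ, hσp, hπ⟩ := B.exists_local_section p
  have h1 : mfderiv (𝓡 (2 * n)) (𝓡 (2 * n)) (fun x => B.proj (σ x)) (B.proj p) =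
      ContinuousLinearMap.id ℝ _ := by
    have : (fun x => B.proj (σ x)) =ᶠ[𝓝 (B.proj p)] id := by
      filter_upwards [hU.mem_nhds hp] with x hx using hπ x hx
    rw [this.mfderiv_eq, mfderiv_id]
  have h2 := mfderiv_comp (I := 𝓡 (2 * n)) (I' := 𝓡 (2 * n + 1)) (I'' := 𝓡 (2 * n))
    (g := B.proj) (f := σ) (B.proj p)
    (B.smooth_proj.mdifferentiable (by simp) _)
    (((hσ _ hp).contMDiffAt (hU.mem_nhds hp)).mdifferentiableAt (by simp))
  rw [hσp] at h2
  intro w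
  refine ⟨mfderiv (𝓡 (2 * n)) (𝓡 (2 * n + 1)) σ (B.proj p) w, ?_⟩
  have h3 := congrArg (fun L => L w) (h2.symm.trans h1)
  exact h3

/-- The projection is constant along the orbit whose velocity is `∂_θ`. -/
theorem mfderiv_proj_fundamentalVector (p : P) :
    mfderiv (𝓡 (2 * n + 1)) (𝓡 (2 * n)) B.proj p (fundamentalVector p) = 0 := by
  have hs : ContMDiff 𝓘(ℝ, ℝ) (𝓡 (2 * n + 1)) ∞ (fun s : ℝ => Circle.exp s • p) :=
    B.smooth_smul.comp (contMDiff_circleExp.prodMk contMDiff_const)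
  have h := mfderiv_comp (I := 𝓘(ℝ, ℝ)) (I' := 𝓡 (2 * n + 1)) (I'' := 𝓡 (2 * n))
    (g := B.proj) (f := fun s : ℝ => Circle.exp s • p) 0
    (B.smooth_proj.mdifferentiable (by simp) _) (hs.mdifferentiable (by simp) _)
  have h1 : B.proj ∘ (fun s : ℝ => Circle.exp s • p) = fun _ => B.proj p := by
    funext s
    exact B.proj_smul _ _
  rw [h1, mfderiv_const] at h
  have h2 := congrArg (fun L => L (1 : ℝ)) h
  have h3 : Circle.exp 0 • p = p := by simp
  unfold fundamentalVector
  rw [h3] at h2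
  exact h2.symm

theorem d_conn_apply (p : P) (u v : TangentSpace (𝓡 (2 * n + 1)) p) :
    B.conn.d p ![u, v] = -Ω.form (B.proj p) ![mfderiv (𝓡 (2 * n + 1)) (𝓡 (2 * n)) B.proj p u,
      mfderiv (𝓡 (2 * n + 1)) (𝓡 (2 * n)) B.proj p v] := by
  have h := congrArg (fun L => L ![u, v]) (B.curvature p)
  have h1 : DForm.pullback (m := 2 * n + 1) B.proj Ω.form p ![u, v] = Ω.form (B.proj p)
      ![mfderiv (𝓡 (2 * n + 1)) (𝓡 (2 * n)) B.proj p u,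
      mfderiv (𝓡 (2 * n + 1)) (𝓡 (2 * n)) B.proj p v] := by
    refine congrArg (Ω.form (B.proj p)) ?_
    funext i; fin_cases i <;> rfl
  rw [← h1]
  exact eq_neg_of_add_eq_zero_left h

/-- Functions which are constant on the fibres and smooth descend to smooth functions. -/
theorem contMDiffOn_descend {E H : Type*} [NormedAddCommGroup E] [NormedSpace ℝ E]
    [TopologicalSpace H] {J : ModelWithCorners ℝ E H} {Z : Type*} [TopologicalSpace Z]
    [ChartedSpace H Z] {E' H' : Type*} [NormedAddCommGroup E'] [NormedSpace ℝ E']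
    [TopologicalSpace H'] {J' : ModelWithCorners ℝ E' H'} {Z' : Type*} [TopologicalSpace Z']
    [ChartedSpace H' Z'] {g : Z × P → Z'} {g' : Z × M → Z'} {S : Set Z}
    (hg : ContMDiffOn (J.prod (𝓡 (2 * n + 1))) J' ∞ g (S ×ˢ Set.univ))
    (h : ∀ y ∈ S, ∀ p, g' (y, B.proj p) = g (y, p)) :
    ContMDiffOn (J.prod (𝓡 (2 * n))) J' ∞ g' (S ×ˢ Set.univ) := by
  rintro ⟨y, x⟩ ⟨hy, -⟩
  obtain ⟨p, rfl⟩ := B.proj_surjective x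
  obtain ⟨U, σ, hU, hp, hσ, hσp, hπ⟩ := B.exists_local_section p
  have h1 : ContMDiffOn (J.prod (𝓡 (2 * n))) J' ∞ (fun x : Z × M => g (x.1, σ x.2)) (S ×ˢ U) :=
    hg.comp (contMDiffOn_fst.prodMk (hσ.comp contMDiffOn_snd fun x hx => hx.2))
      fun x hx => ⟨hx.1, Set.mem_univ _⟩
  have h2 : ContMDiffOn (J.prod (𝓡 (2 * n))) J' ∞ g' (S ×ˢ U) := by
    refine h1.congr fun x hx => ?_
    rw [← h x.1 hx.1, hπ _ hx.2]
  refine (h2 (y, B.proj p) ⟨hy, hp⟩).mono_of_mem_nhdsWithin ?_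
  have : Set.univ ×ˢ U ∈ 𝓝 (y, B.proj p) := prod_mem_nhds Filter.univ_mem (hU.mem_nhds hp)
  filter_upwards [mem_nhdsWithin_of_mem_nhds this, self_mem_nhdsWithin] with x h4 h5
  exact ⟨h5.1, h4.2⟩

end PrequantumBundle

namespace Preq

variable {B : PrequantumBundle Ω P}

/-- The diffeomorphism of the base induced by a prequantum bundle automorphism. -/
noncomputable def baseMap (ψ : Preq B) (x : M) : M := B.proj (ψ (B.proj_surjective x).choose)

theorem proj_apply (ψ : Preq B) {p q : P} (h : B.proj p = B.proj q) :
    B.proj (ψ p) = B.proj (ψ q) := by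
  obtain ⟨z, rfl⟩ := B.exists_smul_eq h
  rw [ψ.map_smul, B.proj_smul]

theorem baseMap_proj (ψ : Preq B) (p : P) : ψ.baseMap (B.proj p) = B.proj (ψ p) :=
  ψ.proj_apply (B.proj_surjective (B.proj p)).choose_spec

theorem baseMap_inv_baseMap (ψ : Preq B) (x : M) : ψ⁻¹.baseMap (ψ.baseMap x) = x := by
  obtain ⟨p, rfl⟩ := B.proj_surjective x
  rw [baseMap_proj, baseMap_proj, inv_apply_self]

theorem baseMap_baseMap_inv (ψ : Preq B) (x : M) : ψ.baseMap (ψ⁻¹.baseMap x) = x := by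
  simpa using ψ⁻¹.baseMap_inv_baseMap x

theorem contMDiff_baseMap (ψ : Preq B) : ContMDiff (𝓡 (2 * n)) (𝓡 (2 * n)) ∞ ψ.baseMap := by
  intro x
  obtain ⟨p, rfl⟩ := B.proj_surjective x
  obtain ⟨U, σ, hU, hp, hσ, hσp, hπ⟩ := B.exists_local_section p
  have h1 : ContMDiffOn (𝓡 (2 * n)) (𝓡 (2 * n)) ∞ (fun x => B.proj (ψ (σ x))) U :=
    B.smooth_proj.comp_contMDiffOn (ψ.toDiffeo.contMDiff.comp_contMDiffOn hσ)
  have h2 : ContMDiffOn (𝓡 (2 * n)) (𝓡 (2 * n)) ∞ ψ.baseMap U :=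
    h1.congr fun x hx => by rw [← baseMap_proj, hπ x hx]
  exact (h2 _ hp).contMDiffAt (hU.mem_nhds hp)

theorem conn_mfderiv (ψ : Preq B) (p : P) (v : TangentSpace (𝓡 (2 * n + 1)) p) :
    B.conn (ψ p) ![mfderiv (𝓡 (2 * n + 1)) (𝓡 (2 * n + 1)) ψ p v] = B.conn p ![v] := by
  have h := congrArg (fun L : DForm (2 * n + 1) P 1 => L p ![v]) ψ.pullback_conn
  refine Eq.trans (congrArg (B.conn (ψ p)) ?_) h
  funext i; fin_cases i; rfl

/-- As `ψ` preserves `α`, it preserves `dα = -π^*ω`. Hence the form and its pull-back by the base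
map agree after pull-back by `π`, which is injective on forms because `π` is a surjective
submersion. -/
theorem pullback_form_baseMap [IsManifold (𝓡 (2 * n + 1)) ∞ P] (ψ : Preq B) :
    DForm.pullback (m := 2 * n) ψ.baseMap Ω.form = Ω.form := by
  have h1 : DForm.pullback (m := 2 * n + 1) ψ B.conn.d = B.conn.d := by
    rw [← DForm.d_pullback B.smooth_conn ψ.toDiffeo.contMDiff, ψ.pullback_conn]
  have h2 : B.conn.d = -DForm.pullback (m := 2 * n + 1) B.proj Ω.form := by
    funext p
    exact eq_neg_of_add_eq_zero_left (B.curvature p)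
  have h3 : DForm.pullback (m := 2 * n + 1) B.proj (DForm.pullback (m := 2 * n) ψ.baseMap Ω.form) =
      DForm.pullback (m := 2 * n + 1) B.proj Ω.form := by
    rw [← DForm.pullback_comp B.smooth_proj ψ.contMDiff_baseMap]
    simp only [baseMap_proj]
    rw [DForm.pullback_comp ψ.toDiffeo.contMDiff B.smooth_proj]
    rw [h2] at h1
    have h4 : DForm.pullback (m := 2 * n + 1) ψ
        (-DForm.pullback (m := 2 * n + 1) B.proj Ω.form) =
        -DForm.pullback (m := 2 * n + 1) ψ (DForm.pullback (m := 2 * n + 1) B.proj Ω.form) := rfl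
    rw [h4, neg_inj] at h1
    exact h1
  funext x
  obtain ⟨p, rfl⟩ := B.proj_surjective x
  ext v
  choose u hu using fun i => B.mfderiv_proj_surjective p (v i)
  have h5 := congrArg (fun L : DForm (2 * n + 1) P 2 => L p u) h3
  have hv : v = fun i => mfderiv (𝓡 (2 * n + 1)) (𝓡 (2 * n)) B.proj p (u i) :=
    funext fun i => (hu i).symm
  rw [hv]
  exact h5

theorem map_liouville_baseMap [IsManifold (𝓡 (2 * n)) ∞ M] [IsManifold (𝓡 (2 * n + 1)) ∞ P]
    [MeasurableSpace M] [BorelSpace M] [CompactSpace M] (ψ : Preq B) :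
    Ω.liouville.map ψ.baseMap = Ω.liouville :=
  SymplecticForm.map_liouville ψ.contMDiff_baseMap ψ⁻¹.contMDiff_baseMap.continuous
    ψ.baseMap_inv_baseMap ψ.baseMap_baseMap_inv ψ.pullback_form_baseMap

/-- The integral with respect to the Liouville measure is invariant under prequantum bundle
automorphisms. -/
theorem integral_comp_baseMap [IsManifold (𝓡 (2 * n)) ∞ M] [IsManifold (𝓡 (2 * n + 1)) ∞ P]
    [MeasurableSpace M] [BorelSpace M] [CompactSpace M] (ψ : Preq B) (f : M → ℝ) :
    ∫ x, f (ψ.baseMap x) ∂Ω.liouville = ∫ x, f x ∂Ω.liouville := by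
  let e : M ≃ₜ M :=
    { toFun := ψ.baseMap
      invFun := ψ⁻¹.baseMap
      left_inv := ψ.baseMap_inv_baseMap
      right_inv := ψ.baseMap_baseMap_inv
      continuous_toFun := ψ.contMDiff_baseMap.continuous
      continuous_invFun := ψ⁻¹.contMDiff_baseMap.continuous }
  have h := e.measurableEmbedding.integral_map (μ := Ω.liouville) f
  rw [show Ω.liouville.map e = Ω.liouville from ψ.map_liouville_baseMap] at h
  exact h.symm

end Preq

end Prequantum

/-! ### The generating Hamiltonian of a path -/

section Prequantum

variable {n : ℕ} {M : Type*} [TopologicalSpace M]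
    [ChartedSpace (EuclideanSpace ℝ (Fin (2 * n))) M] {Ω : SymplecticForm n M}
    {P : Type*} [TopologicalSpace P] [ChartedSpace (EuclideanSpace ℝ (Fin (2 * n + 1))) P]
    [MulAction Circle P]

theorem Preq.mfderiv_surjective {B : PrequantumBundle Ω P} (ψ : Preq B) (p : P) :
    Function.Surjective (mfderiv (𝓡 (2 * n + 1)) (𝓡 (2 * n + 1)) ψ p) := by
  have h := (ψ.toDiffeo.mfderivToContinuousLinearEquiv (by simp) p).surjective
  exact h

namespace PreqPath

variable {B : PrequantumBundle Ω P}

/-- The value of the connection form on the velocity of the path. -/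
noncomputable def connVelocity (γ : PreqPath B) (t : unitInterval) (p : P) : ℝ :=
  B.conn (γ t p) ![γ.velocity t p]

theorem mdifferentiable_apply (γ : PreqPath B) (p : P) :
    MDifferentiable (𝓡∂ 1) (𝓡 (2 * n + 1)) (fun s : unitInterval => γ s p) :=
  (γ.smooth.comp (contMDiff_id.prodMk contMDiff_const)).mdifferentiable (by simp)

/-- Leibniz rule: the derivative of `γ_s(c(s))` is the sum of the two partial derivatives of `(s, p)
↦ γ_s(p)`. -/
theorem mfderiv_apply_comp (γ : PreqPath B) {c : unitInterval → P} {t : unitInterval}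
    (hc : MDifferentiableAt (𝓡∂ 1) (𝓡 (2 * n + 1)) c t) :
    (mfderiv (𝓡∂ 1) (𝓡 (2 * n + 1)) (fun s : unitInterval => γ s (c s)) t (oneTangentSpaceIcc t) :
      EuclideanSpace ℝ (Fin (2 * n + 1))) = γ.velocity t (c t) +
      mfderiv (𝓡 (2 * n + 1)) (𝓡 (2 * n + 1)) (γ t) (c t)
        (mfderiv (𝓡∂ 1) (𝓡 (2 * n + 1)) c t (oneTangentSpaceIcc t)) := by
  have h1 := mfderiv_comp (I := 𝓡∂ 1) (I' := (𝓡∂ 1).prod (𝓡 (2 * n + 1))) (I'' := 𝓡 (2 * n + 1))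
    (g := fun q : unitInterval × P => γ q.1 q.2) (f := fun s => (s, c s)) t
    (γ.smooth.mdifferentiable (by simp) _) (mdifferentiableAt_id.prodMk hc)
  have h2 := mfderiv_prod_eq_add_apply (I := 𝓡∂ 1) (I' := 𝓡 (2 * n + 1)) (I'' := 𝓡 (2 * n + 1))
    (f := fun q : unitInterval × P => γ q.1 q.2) (p := (t, c t))
    (v := mfderiv (𝓡∂ 1) ((𝓡∂ 1).prod (𝓡 (2 * n + 1))) (fun s => (s, c s)) t
      (oneTangentSpaceIcc t)) (γ.smooth.mdifferentiable (by simp) _)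
  have h3 := congrArg (fun L => L (oneTangentSpaceIcc t)) h1
  refine h3.trans (h2.trans ?_)
  have h4 : mfderiv (𝓡∂ 1) ((𝓡∂ 1).prod (𝓡 (2 * n + 1))) (fun s => (s, c s)) t =
      (ContinuousLinearMap.id ℝ _).prod (mfderiv (𝓡∂ 1) (𝓡 (2 * n + 1)) c t) := by
    rw [← mfderiv_id]
    exact (mdifferentiableAt_id (I := 𝓡∂ 1) (x := t)).mfderiv_prod hc
  rw [h4]
  rfl

/-- Evaluate `α` on the Leibniz rule; in the second term `γ_t` disappears because it preserves `α`.
-/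
theorem connVelocity_mul (γ γ' : PreqPath B) (t : unitInterval) (p : P) :
    (γ * γ').connVelocity t p = γ.connVelocity t (γ' t p) + γ'.connVelocity t p := by
  have h := γ.mfderiv_apply_comp (γ'.mdifferentiable_apply p t)
  rw [connVelocity, connVelocity, connVelocity, ← (γ t).conn_mfderiv (γ' t p)]
  have h1 := (B.conn (γ t (γ' t p))).map_update_add
    ![γ.velocity t (γ' t p)] 0 (γ.velocity t (γ' t p))
    (mfderiv (𝓡 (2 * n + 1)) (𝓡 (2 * n + 1)) (γ t) (γ' t p) (γ'.velocity t p))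
  have h2 : ∀ a b : TangentSpace (𝓡 (2 * n + 1)) (γ t (γ' t p)),
      Function.update ![a] 0 b = ![b] := by
    intro a b
    funext i; fin_cases i; rfl
  rw [h2, h2, h2] at h1
  rw [← h1]
  refine congrArg (B.conn (γ t (γ' t p))) ?_
  funext i; fin_cases i
  exact h

/-- Automorphisms commute with rotations, and rotations preserve `α`. So this function is constant
on fibres, and the choice of a point made in `hamiltonian` is harmless. -/
theorem connVelocity_smul (γ : PreqPath B) (t : unitInterval) (z : Circle) (p : P) :
    γ.connVelocity t (z • p) = γ.connVelocity t p := by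
  unfold connVelocity
  have h : γ.velocity t (z • p) =
      (mfderiv (𝓡 (2 * n + 1)) (𝓡 (2 * n + 1)) (Preq.rotation B z) (γ t p) (γ.velocity t p) :
        EuclideanSpace ℝ (Fin (2 * n + 1))) := by
    have h1 := mfderiv_comp (I := 𝓡∂ 1) (I' := 𝓡 (2 * n + 1)) (I'' := 𝓡 (2 * n + 1))
      (g := Preq.rotation B z) (f := fun s : unitInterval => γ s p) t
      ((Preq.rotation B z).toDiffeo.contMDiff.mdifferentiable (by simp) _)
      (γ.mdifferentiable_apply p t)
    have h2 : (fun s : unitInterval => γ s (z • p)) =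
        Preq.rotation B z ∘ (fun s : unitInterval => γ s p) :=
      funext fun s => (γ s).map_smul z p
    unfold velocity
    rw [h2, h1]
    rfl
  rw [← (Preq.rotation B z).conn_mfderiv (γ t p)]
  refine DForm.apply_congr B.conn ((γ t).map_smul z p) _ _ ?_
  funext i; fin_cases i
  exact h

theorem connVelocity_eq_of_proj_eq (γ : PreqPath B) (t : unitInterval) {p q : P}
    (h : B.proj p = B.proj q) : γ.connVelocity t p = γ.connVelocity t q := by
  obtain ⟨z, rfl⟩ := B.exists_smul_eq h
  exact (γ.connVelocity_smul t z p).symm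

theorem hamiltonian_proj (γ : PreqPath B) (t : unitInterval) (q : P) :
    γ.hamiltonian t (B.proj q) = -γ.connVelocity t ((γ t)⁻¹ q) := by
  refine congrArg Neg.neg (γ.connVelocity_eq_of_proj_eq t ?_)
  exact (γ t)⁻¹.proj_apply (B.proj_surjective (B.proj q)).choose_spec

theorem hamiltonian_proj_apply (γ : PreqPath B) (t : unitInterval) (p : P) :
    γ.hamiltonian t (B.proj (γ t p)) = -γ.connVelocity t p := by
  rw [hamiltonian_proj, Preq.inv_apply_self]

theorem hamiltonian_mul (γ γ' : PreqPath B) (t : unitInterval) (x : M) :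
    (γ * γ').hamiltonian t x = γ.hamiltonian t x + γ'.hamiltonian t ((γ t)⁻¹.baseMap x) := by
  obtain ⟨q, rfl⟩ := B.proj_surjective x
  rw [Preq.baseMap_proj, hamiltonian_proj, hamiltonian_proj, hamiltonian_proj, connVelocity_mul]
  simp only [mul_apply, mul_inv_rev, Preq.mul_apply]
  have h : γ' t ((γ' t)⁻¹ ((γ t)⁻¹ q)) = (γ t)⁻¹ q := by
    rw [← Preq.mul_apply, mul_inv_cancel, Preq.one_apply]
  rw [h]
  ring

theorem velocity_eq (γ : PreqPath B) (t : unitInterval) (p : P) :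
    (γ.velocity t p : EuclideanSpace ℝ (Fin (2 * n + 1))) =
      mfderivWithin 𝓘(ℝ, ℝ) (𝓡 (2 * n + 1)) (fun s : ℝ => γ (projUnit s) p) (Set.Icc 0 1) t
        (1 : ℝ) :=
  (mfderivWithin_comp_projIcc_one (I := 𝓡 (2 * n + 1)) (f := fun s : unitInterval => γ s p)
    (w := t)).symm

theorem connVelocity_projUnit (γ : PreqPath B) {t : ℝ} (ht : t ∈ Set.Icc (0 : ℝ) 1) (p : P) :
    γ.connVelocity (projUnit t) p = B.conn (γ (projUnit t) p)
      ![mfderivWithin 𝓘(ℝ, ℝ) (𝓡 (2 * n + 1)) (fun s : ℝ => γ (projUnit s) p) (Set.Icc 0 1) t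
        (1 : ℝ)] := by
  refine congrArg (B.conn (γ (projUnit t) p)) ?_
  funext i; fin_cases i
  have h := γ.velocity_eq (projUnit t) p
  rw [show ((projUnit t : unitInterval) : ℝ) = t by simp [projUnit, Set.projIcc_of_mem _ ht]] at h
  exact h

theorem contMDiffOn_projUnit (γ : PreqPath B) :
    ContMDiffOn (𝓘(ℝ, ℝ).prod (𝓡 (2 * n + 1))) (𝓡 (2 * n + 1)) ∞
      (fun x : ℝ × P => γ (projUnit x.1) x.2) (Set.Icc 0 1 ×ˢ Set.univ) :=
  contMDiffOn_comp_projUnit γ.smooth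

variable [IsManifold (𝓡 (2 * n + 1)) ∞ P]

theorem contMDiffOn_connVelocity (γ : PreqPath B) :
    ContMDiffOn (𝓘(ℝ, ℝ).prod (𝓡 (2 * n + 1))) 𝓘(ℝ, ℝ) ∞
      (fun x : ℝ × P => γ.connVelocity (projUnit x.1) x.2) (Set.Icc 0 1 ×ˢ Set.univ) :=
  (DForm.contMDiffOn_apply_mfderivWithin B.smooth_conn (uniqueDiffOn_Icc zero_lt_one)
    γ.contMDiffOn_projUnit 1).congr fun x hx => γ.connVelocity_projUnit hx.1 x.2

/-- The choice of a point in the fibre is not smooth; smoothness is proved for the pull-back to `P`,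
then descends along local sections. -/
theorem contMDiffOn_hamiltonian (γ : PreqPath B) :
    ContMDiffOn (𝓘(ℝ, ℝ).prod (𝓡 (2 * n))) 𝓘(ℝ, ℝ) ∞
      (fun x : ℝ × M => γ.hamiltonian (projUnit x.1) x.2) (Set.Icc 0 1 ×ˢ Set.univ) := by
  have h1 : ContMDiffOn (𝓘(ℝ, ℝ).prod (𝓡 (2 * n + 1))) 𝓘(ℝ, ℝ) ∞
      (fun x : ℝ × P => -γ.connVelocity (projUnit x.1) ((γ (projUnit x.1))⁻¹ x.2))
      (Set.Icc 0 1 ×ˢ Set.univ) := by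
    have := γ.contMDiffOn_connVelocity.comp
      (contMDiffOn_fst.prodMk (contMDiffOn_comp_projUnit γ.smooth_inv))
      (fun x hx => ⟨hx.1, Set.mem_univ _⟩)
    exact contDiff_neg.contMDiff.comp_contMDiffOn this
  exact B.contMDiffOn_descend h1 fun t _ p => γ.hamiltonian_proj _ p

theorem contMDiff_hamiltonian (γ : PreqPath B) :
    ContMDiff ((𝓡∂ 1).prod (𝓡 (2 * n))) 𝓘(ℝ, ℝ) ∞
      (fun q : unitInterval × M => γ.hamiltonian q.1 q.2) := by
  simpa using contMDiff_comp_coe_unitInterval γ.contMDiffOn_hamiltonian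

theorem contMDiff_hamiltonian_apply (γ : PreqPath B) (t : unitInterval) :
    ContMDiff (𝓡 (2 * n)) 𝓘(ℝ, ℝ) ∞ (γ.hamiltonian t) :=
  γ.contMDiff_hamiltonian.comp (contMDiff_const.prodMk contMDiff_id)

/-- The projection of the velocity of the path is the Hamiltonian vector field. -/
theorem form_velocity_add_mfderiv (γ : PreqPath B) (t : unitInterval) (p : P)
    (w : TangentSpace (𝓡 (2 * n)) (B.proj (γ t p))) :
    Ω.form (B.proj (γ t p))
      ![mfderiv (𝓡 (2 * n + 1)) (𝓡 (2 * n)) B.proj (γ t p) (γ.velocity t p), w] +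
      NormedSpace.fromTangentSpace _
        (mfderiv (𝓡 (2 * n)) 𝓘(ℝ, ℝ) (γ.hamiltonian t) (B.proj (γ t p)) w) = 0 := by
  revert w
  let φ := extChartAt (𝓡 (2 * n + 1)) p
  -- The space variable is moved to a chart, so that `(s, z) ↦ γ_s(φ.symm z)` is defined on a
  -- product of subsets of vector spaces.
  suffices h : ∀ z ∈ φ.target, ∀ w : TangentSpace (𝓡 (2 * n)) (B.proj (γ t (φ.symm z))),
      Ω.form (B.proj (γ t (φ.symm z)))
      ![mfderiv (𝓡 (2 * n + 1)) (𝓡 (2 * n)) B.proj (γ t (φ.symm z)) (γ.velocity t (φ.symm z)), w] +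
      NormedSpace.fromTangentSpace _
        (mfderiv (𝓡 (2 * n)) 𝓘(ℝ, ℝ) (γ.hamiltonian t) (B.proj (γ t (φ.symm z))) w) = 0 by
    have hp := mem_extChartAt_source (I := 𝓡 (2 * n + 1)) p
    have h1 := h (φ p) (φ.map_source hp)
    rw [φ.left_inv hp] at h1
    exact h1
  intro z hz w
  have hT : IsOpen φ.target := isOpen_extChartAt_target p
  have hS := uniqueDiffOn_Icc (zero_lt_one' ℝ)
  have hU := hT.uniqueDiffWithinAt (𝕜 := ℝ) hz
  have hs : ContMDiffOn 𝓘(ℝ, EuclideanSpace ℝ (Fin (2 * n + 1))) (𝓡 (2 * n + 1)) ∞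
    φ.symm φ.target := contMDiffOn_extChartAt_symm p
  have hsd := (hs z hz).mdifferentiableWithinAt (by simp)
  have hψ : ∀ ψ : Preq B, mfderivWithin 𝓘(ℝ, EuclideanSpace ℝ (Fin (2 * n + 1))) (𝓡 (2 * n + 1))
      (fun z => ψ (φ.symm z)) φ.target z =
      (mfderiv (𝓡 (2 * n + 1)) (𝓡 (2 * n + 1)) ψ (φ.symm z)).comp
      (mfderivWithin 𝓘(ℝ, EuclideanSpace ℝ (Fin (2 * n + 1))) (𝓡 (2 * n + 1))
        φ.symm φ.target z) := fun ψ =>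
    mfderiv_comp_mfderivWithin z (ψ.toDiffeo.contMDiff.mdifferentiable (by simp) _) hsd
      hU.uniqueMDiffWithinAt
  have hψd : MDifferentiableWithinAt 𝓘(ℝ, EuclideanSpace ℝ (Fin (2 * n + 1))) (𝓡 (2 * n + 1))
      (fun z => γ t (φ.symm z)) φ.target z :=
    ((γ t).toDiffeo.contMDiff.mdifferentiable (by simp) _).comp_mdifferentiableWithinAt z hsd
  -- Every `w` comes from a constant vector `u` in the chart, since the derivatives of `π`, of `γ_t`
  -- and of the inverse chart are surjective.
  obtain ⟨u', rfl⟩ := B.mfderiv_proj_surjective _ w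
  obtain ⟨u'', rfl⟩ := (γ t).mfderiv_surjective _ u'
  obtain ⟨u, rfl⟩ : ∃ u : EuclideanSpace ℝ (Fin (2 * n + 1)),
      mfderivWithin 𝓘(ℝ, EuclideanSpace ℝ (Fin (2 * n + 1))) (𝓡 (2 * n + 1))
        φ.symm φ.target z u = u'' := by
    have h1 := (isInvertible_mfderivWithin_extChartAt_symm (I := 𝓡 (2 * n + 1)) hz).bijective.2 u''
    rw [modelWithCornersSelf_coe, Set.range_id, mfderivWithin_univ] at h1
    rw [mfderivWithin_of_mem_nhds (hT.mem_nhds hz)]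
    exact h1
  have hH := DForm.contMDiffOn_comp_extChartAt_symm γ.contMDiffOn_projUnit p
  have hST : Set.Icc (0 : ℝ) 1 ×ˢ φ.target ⊆
      closure (interior (Set.Icc (0 : ℝ) 1 ×ˢ φ.target)) := by
    rw [interior_prod_eq, closure_prod_eq, interior_Icc, closure_Ioo zero_ne_one, hT.interior_eq]
    exact Set.prod_mono subset_rfl subset_closure
  have key : B.conn.d (γ (projUnit t) (φ.symm z)) ![mfderivWithin 𝓘(ℝ, ℝ) (𝓡 (2 * n + 1))
        (fun s : ℝ => γ (projUnit s) (φ.symm z)) (Set.Icc 0 1) t (1 : ℝ),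
      mfderivWithin 𝓘(ℝ, EuclideanSpace ℝ (Fin (2 * n + 1))) (𝓡 (2 * n + 1))
        (fun z' => γ (projUnit t) (φ.symm z')) φ.target z u] =
      fderivWithin ℝ (fun s : ℝ => B.conn (γ (projUnit s) (φ.symm z))
      ![mfderivWithin 𝓘(ℝ, EuclideanSpace ℝ (Fin (2 * n + 1))) (𝓡 (2 * n + 1))
        (fun z => γ (projUnit s) (φ.symm z)) φ.target z u]) (Set.Icc 0 1) t (1 : ℝ) -
      fderivWithin ℝ (fun z' => B.conn (γ (projUnit t) (φ.symm z'))
      ![mfderivWithin 𝓘(ℝ, ℝ) (𝓡 (2 * n + 1)) (fun s : ℝ => γ (projUnit s) (φ.symm z'))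
        (Set.Icc 0 1) t (1 : ℝ)]) φ.target z u :=
    DForm.d_apply_partial B.smooth_conn hS hT.uniqueDiffOn hST hH t.2 hz (1 : ℝ) u
  -- Every `γ_s` preserves `α`, so the value of `α` on the space derivative does not depend on `s`.
  have h1 : fderivWithin ℝ (fun s : ℝ => B.conn (γ (projUnit s) (φ.symm z))
      ![mfderivWithin 𝓘(ℝ, EuclideanSpace ℝ (Fin (2 * n + 1))) (𝓡 (2 * n + 1))
        (fun z => γ (projUnit s) (φ.symm z)) φ.target z u]) (Set.Icc 0 1) t (1 : ℝ) = 0 := by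
    have h2 : (fun s : ℝ => B.conn (γ (projUnit s) (φ.symm z))
      ![mfderivWithin 𝓘(ℝ, EuclideanSpace ℝ (Fin (2 * n + 1))) (𝓡 (2 * n + 1))
        (fun z => γ (projUnit s) (φ.symm z)) φ.target z u]) = fun _ => B.conn (φ.symm z)
      ![mfderivWithin 𝓘(ℝ, EuclideanSpace ℝ (Fin (2 * n + 1))) (𝓡 (2 * n + 1))
        φ.symm φ.target z u] := by
      funext s
      rw [hψ]
      exact (γ (projUnit s)).conn_mfderiv _ _
    rw [h2, fderivWithin_fun_const]
    rfl
  have h3 : (fun z' => B.conn (γ (projUnit t) (φ.symm z'))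
      ![mfderivWithin 𝓘(ℝ, ℝ) (𝓡 (2 * n + 1)) (fun s : ℝ => γ (projUnit s) (φ.symm z'))
        (Set.Icc 0 1) t (1 : ℝ)]) =
      fun z' => -γ.hamiltonian t (B.proj (γ t (φ.symm z'))) := by
    funext z'
    rw [← γ.connVelocity_projUnit t.2, projUnit_coe, hamiltonian_proj_apply, neg_neg]
  have h4 : mfderivWithin 𝓘(ℝ, EuclideanSpace ℝ (Fin (2 * n + 1))) 𝓘(ℝ, ℝ)
      (fun z' => γ.hamiltonian t (B.proj (γ t (φ.symm z')))) φ.target z =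
      (mfderiv (𝓡 (2 * n)) 𝓘(ℝ, ℝ) (γ.hamiltonian t) (B.proj (γ t (φ.symm z)))).comp
      ((mfderiv (𝓡 (2 * n + 1)) (𝓡 (2 * n)) B.proj (γ t (φ.symm z))).comp
      (mfderivWithin 𝓘(ℝ, EuclideanSpace ℝ (Fin (2 * n + 1))) (𝓡 (2 * n + 1))
        (fun z' => γ t (φ.symm z')) φ.target z)) := by
    have h5 := mfderiv_comp_mfderivWithin (I := 𝓘(ℝ, EuclideanSpace ℝ (Fin (2 * n + 1))))
      (I' := 𝓡 (2 * n + 1)) (I'' := 𝓡 (2 * n)) (g := B.proj) (f := fun z' => γ t (φ.symm z')) z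
      (B.smooth_proj.mdifferentiable (by simp) _) hψd hU.uniqueMDiffWithinAt
    rw [← h5]
    exact mfderiv_comp_mfderivWithin (I := 𝓘(ℝ, EuclideanSpace ℝ (Fin (2 * n + 1))))
      (I' := 𝓡 (2 * n)) (I'' := 𝓘(ℝ, ℝ)) (g := γ.hamiltonian t)
      (f := fun z' => B.proj (γ t (φ.symm z'))) z
      ((γ.contMDiff_hamiltonian_apply t).mdifferentiable (by simp) _)
      ((B.smooth_proj.mdifferentiable (by simp) _).comp_mdifferentiableWithinAt z hψd)
      hU.uniqueMDiffWithinAt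
  rw [h1, h3, fderivWithin_fun_neg hU] at key
  have key' : B.conn.d (γ t (φ.symm z)) ![γ.velocity t (φ.symm z),
      mfderivWithin 𝓘(ℝ, EuclideanSpace ℝ (Fin (2 * n + 1))) (𝓡 (2 * n + 1))
        (fun z' => γ t (φ.symm z')) φ.target z u] =
      0 - (-fderivWithin ℝ (fun z' => γ.hamiltonian t (B.proj (γ t (φ.symm z')))) φ.target z) u := by
    refine Eq.trans ?_ key
    refine DForm.apply_congr B.conn.d (by rw [projUnit_coe]) _ _ ?_
    funext i; fin_cases i
    · exact γ.velocity_eq t (φ.symm z)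
    · exact congrArg (fun s : unitInterval => (show EuclideanSpace ℝ (Fin (2 * n + 1)) from
        mfderivWithin 𝓘(ℝ, EuclideanSpace ℝ (Fin (2 * n + 1))) (𝓡 (2 * n + 1))
        (fun z' => γ s (φ.symm z')) φ.target z u)) (projUnit_coe t).symm
  rw [B.d_conn_apply, ← mfderivWithin_eq_fderivWithin, h4, hψ] at key'
  have key'' : ∀ a b : ℝ, -a = 0 - -b → a + b = 0 := fun a b h => by linarith
  exact key'' _ _ key'

end PreqPath

end Prequantum

theorem projUnit_zero : projUnit 0 = 0 := Set.projIcc_left _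

theorem projUnit_one : projUnit 1 = 1 := Set.projIcc_right _

/-! ### Differentiation of integrals depending on a parameter -/

section ParametricIntegral

variable {X : Type*} [TopologicalSpace X] [CompactSpace X]
  [MeasurableSpace X] [BorelSpace X] {μ : Measure X} [IsFiniteMeasure μ]

theorem coe_projUnit {t : ℝ} (ht : t ∈ Set.Icc (0 : ℝ) 1) : ((projUnit t : unitInterval) : ℝ) = t := by
  simp [projUnit, Set.projIcc_of_mem _ ht]

theorem continuous_projUnit : Continuous projUnit := continuous_projIcc

theorem continuous_comp_projUnit {Y Z : Type*} [TopologicalSpace Y] [TopologicalSpace Z]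
    {f : ℝ → Y → Z} (hf : ContinuousOn (Function.uncurry f) (Set.Icc 0 1 ×ˢ Set.univ)) :
    Continuous (fun x : ℝ × Y => f (projUnit x.1) x.2) :=
  hf.comp_continuous (f := fun x : ℝ × Y => (((projUnit x.1 : unitInterval) : ℝ), x.2))
    ((continuous_subtype_val.comp (continuous_projUnit.comp continuous_fst)).prodMk
    continuous_snd) fun x => ⟨(projUnit x.1).2, Set.mem_univ _⟩

theorem Continuous.integrable_of_compactSpace {f : X → ℝ} (hf : Continuous f) : Integrable f μ := by
  simpa using hf.continuousOn.integrableOn_compact' isCompact_univ MeasurableSet.univ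

variable [SecondCountableTopology X]

/-- Differentiation under the integral sign on a segment, over a compact space. -/
theorem hasDerivWithinAt_integral_of_continuousOn {f f' : ℝ → X → ℝ}
    (hf : ContinuousOn (Function.uncurry f) (Set.Icc 0 1 ×ˢ Set.univ))
    (hf' : ContinuousOn (Function.uncurry f') (Set.Icc 0 1 ×ˢ Set.univ))
    (h : ∀ t ∈ Set.Icc (0 : ℝ) 1, ∀ x, HasDerivWithinAt (fun s => f s x) (f' t x) (Set.Icc 0 1) t)
    {t : ℝ} (ht : t ∈ Set.Icc (0 : ℝ) 1) :
    HasDerivWithinAt (fun s => ∫ x, f s x ∂μ) (∫ x, f' t x ∂μ) (Set.Icc 0 1) t := by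
  have c' := continuous_comp_projUnit hf'
  have hg : Continuous (fun s : ℝ => ∫ x, f' (projUnit s) x ∂μ) := by
    have := continuous_parametric_integral_of_continuous (μ := μ)
      (f := fun s x => f' (projUnit s) x) c' isCompact_univ
    simpa using this
  have hslice : ∀ s ∈ Set.Icc (0 : ℝ) 1, Continuous (f s) := fun s hs =>
    hf.comp_continuous (f := fun x => (s, x)) (by fun_prop) fun x => ⟨hs, Set.mem_univ _⟩
  -- Each slice is the primitive of its derivative. After exchanging integrals, the integral over
  -- `X` is itself the primitive of a continuous function; clamping by `projUnit` makes the
  -- integrand continuous on all of `ℝ`.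
  have hFTC : ∀ s ∈ Set.Icc (0 : ℝ) 1, ∀ x, f s x = f 0 x + ∫ r in (0 : ℝ)..s, f' (projUnit r) x := by
    intro s hs x
    have hcont : ContinuousOn (fun r => f r x) (Set.Icc 0 s) := fun r hr =>
      ((h r ⟨hr.1, hr.2.trans hs.2⟩ x).continuousWithinAt).mono (Set.Icc_subset_Icc_right hs.2)
    have := intervalIntegral.integral_eq_sub_of_hasDerivAt_of_le hs.1 hcont
      (f' := fun r => f' (projUnit r) x) (fun r hr => by
        have hr' : r ∈ Set.Icc (0 : ℝ) 1 := ⟨hr.1.le, hr.2.le.trans hs.2⟩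
        simp only [coe_projUnit hr']
        exact (h r hr' x).hasDerivAt (Icc_mem_nhds hr.1 (hr.2.trans_le hs.2)))
      (by
        have : Continuous (fun r : ℝ => f' (projUnit r) x) := 
          c'.comp (f := fun r : ℝ => (r, x)) (by fun_prop)
        exact this.intervalIntegrable _ _)
    rw [this]
    ring
  have hint : ∀ s ∈ Set.Icc (0 : ℝ) 1, ∫ x, f s x ∂μ =
      ∫ x, f 0 x ∂μ + ∫ r in (0 : ℝ)..s, ∫ x, f' (projUnit r) x ∂μ := by
    intro s hs
    have hI : Integrable (Function.uncurry fun (r : ℝ) x => f' (projUnit r) x)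
        ((volume.restrict (Set.uIoc 0 s)).prod μ) := by
      have h1 : IntegrableOn (fun x : ℝ × X => f' (projUnit x.1) x.2)
          (Set.uIcc 0 s ×ˢ (Set.univ : Set X)) (volume.prod μ) :=
        c'.continuousOn.integrableOn_compact' (isCompact_uIcc.prod isCompact_univ)
          (measurableSet_uIcc.prod MeasurableSet.univ)
      have h2 : (volume.restrict (Set.uIoc 0 s)).prod μ =
          (volume.prod μ).restrict (Set.uIoc 0 s ×ˢ Set.univ) := by
        rw [← Measure.prod_restrict, Measure.restrict_univ]
      rw [h2]
      exact h1.mono_set (Set.prod_mono Set.uIoc_subset_uIcc subset_rfl)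
    rw [intervalIntegral_integral_swap hI, ← integral_add]
    · exact integral_congr_ae (Filter.Eventually.of_forall fun x => hFTC s hs x)
    · exact (hslice 0 ⟨le_rfl, zero_le_one⟩).integrable_of_compactSpace
    · have : (fun x => ∫ r in (0 : ℝ)..s, f' (projUnit r) x) = fun x => f s x - f 0 x := by
        funext x
        rw [hFTC s hs x]
        ring
      rw [this]
      exact ((hslice s hs).sub (hslice 0 ⟨le_rfl, zero_le_one⟩)).integrable_of_compactSpace
  have hd : HasDerivAt (fun s => ∫ x, f 0 x ∂μ + ∫ r in (0 : ℝ)..s, ∫ x, f' (projUnit r) x ∂μ)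
      (∫ x, f' (projUnit t) x ∂μ) t :=
    ((hg.integral_hasStrictDerivAt 0 t).hasDerivAt).const_add _
  rw [coe_projUnit ht] at hd
  exact hd.hasDerivWithinAt.congr (fun s hs => hint s hs) (hint t ht)

end ParametricIntegral

section ParametricIntegralManifold

variable {m : ℕ} {Q : Type*} [TopologicalSpace Q] [ChartedSpace (EuclideanSpace ℝ (Fin m)) Q]

theorem hasDerivWithinAt_slice {V : Type*} [NormedAddCommGroup V] [NormedSpace ℝ V]
    {f : V × Q → ℝ} {S : Set V}
    (hf : ContMDiffOn (𝓘(ℝ, V).prod (𝓡 m)) 𝓘(ℝ, ℝ) ∞ f (S ×ˢ Set.univ))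
    {c : ℝ → V} {v : V} {t : ℝ} (hc : HasDerivWithinAt c v (Set.Icc 0 1) t)
    (hcS : Set.MapsTo c (Set.Icc 0 1) S) (ht : t ∈ Set.Icc (0 : ℝ) 1) (x : Q) :
    HasDerivWithinAt (fun s => f (c s, x)) (fderivWithin ℝ (fun y => f (y, x)) S (c t) v)
      (Set.Icc 0 1) t := by
  have h1 : ContMDiffOn 𝓘(ℝ, V) 𝓘(ℝ, ℝ) ∞ (fun y => f (y, x)) S :=
    hf.comp ((contMDiff_id.prodMk contMDiff_const).contMDiffOn) fun y hy => ⟨hy, Set.mem_univ _⟩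
  have h2 := ((h1.contDiffOn (c t) (hcS ht)).differentiableWithinAt (by simp)).hasFDerivWithinAt
  exact h2.comp_hasDerivWithinAt t hc hcS

variable [IsManifold (𝓡 m) ∞ Q] [CompactSpace Q] [SecondCountableTopology Q] [MeasurableSpace Q] [BorelSpace Q]
  {μ : Measure Q} [IsFiniteMeasure μ]

theorem hasDerivWithinAt_integral_of_contMDiffOn {f : ℝ × Q → ℝ}
    (hf : ContMDiffOn (𝓘(ℝ, ℝ).prod (𝓡 m)) 𝓘(ℝ, ℝ) ∞ f (Set.Icc 0 1 ×ˢ Set.univ))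
    {t : ℝ} (ht : t ∈ Set.Icc (0 : ℝ) 1) :
    HasDerivWithinAt (fun s => ∫ x, f (s, x) ∂μ)
      (∫ x, fderivWithin ℝ (fun s => f (s, x)) (Set.Icc 0 1) t 1 ∂μ) (Set.Icc 0 1) t :=
  hasDerivWithinAt_integral_of_continuousOn (f := fun s x => f (s, x))
    (f' := fun s x => fderivWithin ℝ (fun s => f (s, x)) (Set.Icc 0 1) s 1) hf.continuousOn
    (DForm.contMDiffOn_fderivWithin_apply (uniqueDiffOn_Icc zero_lt_one) hf 1).continuousOn
    (fun _ ht x => hasDerivWithinAt_slice hf (hasDerivWithinAt_id _ _) (Set.mapsTo_id _) ht x) ht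

/-- The integrals of a smooth family of functions on a compact manifold depend smoothly on
the parameter. -/
theorem contDiffOn_integral {f : ℝ × Q → ℝ}
    (hf : ContMDiffOn (𝓘(ℝ, ℝ).prod (𝓡 m)) 𝓘(ℝ, ℝ) ∞ f (Set.Icc 0 1 ×ˢ Set.univ)) :
    ContDiffOn ℝ ∞ (fun s => ∫ x, f (s, x) ∂μ) (Set.Icc 0 1) := by
  have hU := uniqueDiffOn_Icc (zero_lt_one' ℝ)
  rw [contDiffOn_infty]
  intro k
  induction k generalizing f with
  | zero =>
    rw [Nat.cast_zero, contDiffOn_zero]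
    exact fun t ht => (hasDerivWithinAt_integral_of_contMDiffOn hf ht).continuousWithinAt
  | succ k ih =>
    rw [Nat.cast_add, Nat.cast_one, contDiffOn_succ_iff_derivWithin hU]
    refine ⟨fun t ht => (hasDerivWithinAt_integral_of_contMDiffOn hf ht).differentiableWithinAt,
      by simp, ?_⟩
    exact (ih (DForm.contMDiffOn_fderivWithin_apply hU hf 1)).congr fun t ht =>
      (hasDerivWithinAt_integral_of_contMDiffOn hf ht).derivWithin (hU t ht)

end ParametricIntegralManifold

/-! ### Existence and uniqueness of the generating Hamiltonian -/

section Prequantum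

variable {n : ℕ} {M : Type*} [TopologicalSpace M]
    [ChartedSpace (EuclideanSpace ℝ (Fin (2 * n))) M] {Ω : SymplecticForm n M}
    {P : Type*} [TopologicalSpace P] [ChartedSpace (EuclideanSpace ℝ (Fin (2 * n + 1))) P]
    [MulAction Circle P]

namespace PrequantumBundle

variable (B : PrequantumBundle Ω P)

/-- The connection form as a linear form. -/
noncomputable def connLinear (p : P) : TangentSpace (𝓡 (2 * n + 1)) p →ₗ[ℝ] ℝ where
  toFun v := B.conn p ![v]
  map_add' v w := by
    have h := (B.conn p).map_update_add ![v] 0 v w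
    have hu : ∀ a b : TangentSpace (𝓡 (2 * n + 1)) p, Function.update ![a] 0 b = ![b] := by
      intro a b
      funext i; fin_cases i; rfl
    rwa [hu, hu, hu] at h
  map_smul' c v := by
    have h := (B.conn p).map_update_smul ![v] 0 c v
    have hu : ∀ a b : TangentSpace (𝓡 (2 * n + 1)) p, Function.update ![a] 0 b = ![b] := by
      intro a b
      funext i; fin_cases i; rfl
    rwa [hu, hu] at h

theorem conn_add_smul_fundamentalVector {p : P} (v : TangentSpace (𝓡 (2 * n + 1)) p) (c : ℝ) :
    B.conn p ![v + c • fundamentalVector p] = B.conn p ![v] + c := by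
  have h := (B.connLinear p).map_add v (c • fundamentalVector p)
  rw [map_smul] at h
  refine h.trans ?_
  have h1 : B.connLinear p (fundamentalVector p) = 1 := B.conn_fundamentalVector p
  rw [h1, smul_eq_mul, mul_one]
  rfl

end PrequantumBundle

namespace PreqPath

variable {B : PrequantumBundle Ω P} [IsManifold (𝓡 (2 * n + 1)) ∞ P]

/-- Every path has exactly one generating Hamiltonian. -/
theorem isGeneratingHamiltonian_iff (γ : PreqPath B) (f : unitInterval → M → ℝ) :
    γ.IsGeneratingHamiltonian f ↔ f = γ.hamiltonian := by
  constructor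
  · rintro ⟨-, h⟩
    funext t x
    obtain ⟨q, rfl⟩ := B.proj_surjective x
    obtain ⟨p, rfl⟩ : ∃ p, γ t p = q := ⟨(γ t)⁻¹ q, by
      rw [← Preq.mul_apply, mul_inv_cancel, Preq.one_apply]⟩
    -- Horizontality alone determines `f`, because `α(∂_θ) = 1`.
    have h1 := (h t p).1
    rw [B.conn_add_smul_fundamentalVector] at h1
    rw [hamiltonian_proj_apply, connVelocity]
    linarith
  · rintro rfl
    refine ⟨γ.contMDiff_hamiltonian, fun t p => ⟨?_, fun w => ?_⟩⟩
    · rw [B.conn_add_smul_fundamentalVector, hamiltonian_proj_apply, connVelocity]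
      ring
    · rw [← γ.form_velocity_add_mfderiv t p w, map_add, map_smul, B.mfderiv_proj_fundamentalVector,
        smul_zero, add_zero]

end PreqPath

end Prequantum

theorem integral_unitInterval_eq (f : unitInterval → ℝ) :
    ∫ t, f t = ∫ t in (0 : ℝ)..1, f (projUnit t) := by
  rw [intervalIntegral.integral_of_le zero_le_one, ← integral_Icc_eq_integral_Ioc,
    ← integral_subtype_comap measurableSet_Icc (fun t => f (projUnit t))]
  simp only [projUnit_coe]
  rfl

/-! ### The Calabi morphism on paths -/

section Prequantum

variable {n : ℕ} {M : Type*} [TopologicalSpace M]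
    [ChartedSpace (EuclideanSpace ℝ (Fin (2 * n))) M] [MeasurableSpace M]
    {Ω : SymplecticForm n M}
    {P : Type*} [TopologicalSpace P] [ChartedSpace (EuclideanSpace ℝ (Fin (2 * n + 1))) P]
    [MulAction Circle P] {B : PrequantumBundle Ω P}

/-- The integral over `M` of the generating Hamiltonian at time `t`. -/
noncomputable def PreqPath.totalHamiltonian (γ : PreqPath B) (t : unitInterval) : ℝ :=
  ∫ x, γ.hamiltonian t x ∂Ω.liouville

theorem PreqPath.cal_eq_intervalIntegral (γ : PreqPath B) :
    γ.cal = ∫ t in (0 : ℝ)..1, γ.totalHamiltonian (projUnit t) :=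
  integral_unitInterval_eq γ.totalHamiltonian

variable [CompactSpace M] [IsManifold (𝓡 (2 * n)) ∞ M] [BorelSpace M]

theorem SymplecticForm.isFiniteMeasure_liouville (Ω : SymplecticForm n M) :
    IsFiniteMeasure Ω.liouville := ⟨Ω.liouville_univ_lt_top⟩

variable [IsManifold (𝓡 (2 * n + 1)) ∞ P]

namespace PreqPath

theorem integrable_hamiltonian (γ : PreqPath B) (t : unitInterval) :
    Integrable (γ.hamiltonian t) Ω.liouville :=
  have := Ω.isFiniteMeasure_liouville
  (γ.contMDiff_hamiltonian_apply t).continuous.integrable_of_compactSpace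

/-- In `hamiltonian_mul` the second summand is composed with a map preserving `μ`. Additivity thus
holds at each time, which is what the normalisation of a path uses. -/
theorem totalHamiltonian_mul (γ γ' : PreqPath B) (t : unitInterval) :
    (γ * γ').totalHamiltonian t = γ.totalHamiltonian t + γ'.totalHamiltonian t := by
  have := Ω.isFiniteMeasure_liouville
  unfold totalHamiltonian
  simp only [hamiltonian_mul]
  rw [integral_add (γ.integrable_hamiltonian t), Preq.integral_comp_baseMap]
  exact Continuous.integrable_of_compactSpace <|
    (γ'.contMDiff_hamiltonian_apply t).continuous.comp ((γ t)⁻¹.contMDiff_baseMap).continuous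

theorem contDiffOn_totalHamiltonian (γ : PreqPath B) :
    ContDiffOn ℝ ∞ (fun t => γ.totalHamiltonian (projUnit t)) (Set.Icc 0 1) := by
  have := Ω.isFiniteMeasure_liouville
  have := ChartedSpace.secondCountable_of_sigmaCompact (EuclideanSpace ℝ (Fin (2 * n))) M
  exact contDiffOn_integral γ.contMDiffOn_hamiltonian

theorem intervalIntegrable_totalHamiltonian (γ : PreqPath B) :
    IntervalIntegrable (fun t => γ.totalHamiltonian (projUnit t)) volume 0 1 :=
  γ.contDiffOn_totalHamiltonian.continuousOn.intervalIntegrable_of_Icc zero_le_one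

theorem cal_mul (γ γ' : PreqPath B) : (γ * γ').cal = γ.cal + γ'.cal := by
  simp only [cal_eq_intervalIntegral, totalHamiltonian_mul]
  exact intervalIntegral.integral_add γ.intervalIntegrable_totalHamiltonian
    γ'.intervalIntegrable_totalHamiltonian

end PreqPath

end Prequantum

/-! ### Homotopy invariance of the Calabi morphism -/

section Prequantum

variable {n : ℕ} {M : Type*} [TopologicalSpace M]
    [ChartedSpace (EuclideanSpace ℝ (Fin (2 * n))) M] {Ω : SymplecticForm n M}
    {P : Type*} [TopologicalSpace P] [ChartedSpace (EuclideanSpace ℝ (Fin (2 * n + 1))) P]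
    [MulAction Circle P] {B : PrequantumBundle Ω P}

namespace PreqPath

/-- The value of the connection form on the velocity of the path, as a function on the base. -/
noncomputable def connVelocityBase (γ : PreqPath B) (t : unitInterval) (x : M) : ℝ :=
  γ.connVelocity t (B.proj_surjective x).choose

theorem connVelocityBase_proj (γ : PreqPath B) (t : unitInterval) (p : P) :
    γ.connVelocityBase t (B.proj p) = γ.connVelocity t p :=
  γ.connVelocity_eq_of_proj_eq t (B.proj_surjective (B.proj p)).choose_spec

/-- Viewed from the starting point of the trajectory, the Hamiltonian involves no inverse of `γ_t`.
By invariance of `μ`, the integral over `M` may be computed in this form. -/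
theorem hamiltonian_baseMap (γ : PreqPath B) (t : unitInterval) (x : M) :
    γ.hamiltonian t ((γ t).baseMap x) = -γ.connVelocityBase t x := by
  obtain ⟨p, rfl⟩ := B.proj_surjective x
  rw [Preq.baseMap_proj, hamiltonian_proj_apply, connVelocityBase_proj]

/-- Smooth families of paths. -/
def IsSmoothFamily (h : unitInterval → PreqPath B) : Prop :=
  ContMDiff ((𝓡∂ 1).prod ((𝓡∂ 1).prod (𝓡 (2 * n + 1)))) (𝓡 (2 * n + 1)) ∞
    (fun q : unitInterval × unitInterval × P => h q.1 q.2.1 q.2.2)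

/-- The unit square. -/
abbrev unitSquare : Set (ℝ × ℝ) := Set.Icc 0 1 ×ˢ Set.Icc 0 1

theorem uniqueDiffOn_unitSquare : UniqueDiffOn ℝ unitSquare :=
  (uniqueDiffOn_Icc zero_lt_one).prod (uniqueDiffOn_Icc zero_lt_one)

theorem unitSquare_subset_closure_interior : unitSquare ⊆ closure (interior unitSquare) := by
  rw [interior_prod_eq, closure_prod_eq, interior_Icc, closure_Ioo zero_ne_one]

variable {h : unitInterval → PreqPath B}

theorem IsSmoothFamily.contMDiffOn (hh : IsSmoothFamily h) :
    ContMDiffOn (𝓘(ℝ, ℝ × ℝ).prod (𝓡 (2 * n + 1))) (𝓡 (2 * n + 1)) ∞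
      (fun x : (ℝ × ℝ) × P => h (projUnit x.1.1) (projUnit x.1.2) x.2)
      (unitSquare ×ˢ Set.univ) := by
  have h1 : ContMDiffOn (𝓘(ℝ, ℝ × ℝ).prod (𝓡 (2 * n + 1))) 𝓘(ℝ, ℝ × ℝ) ∞
      (fun x : (ℝ × ℝ) × P => x.1) (unitSquare ×ˢ Set.univ) := contMDiffOn_fst
  have h2 : ContMDiffOn (𝓘(ℝ, ℝ × ℝ).prod (𝓡 (2 * n + 1))) (𝓡∂ 1) ∞
      (fun x : (ℝ × ℝ) × P => projUnit x.1.1) (unitSquare ×ˢ Set.univ) :=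
    _root_.contMDiffOn_projUnit.comp (contDiff_fst.contMDiff.comp_contMDiffOn h1) fun x hx => hx.1.1
  have h3 : ContMDiffOn (𝓘(ℝ, ℝ × ℝ).prod (𝓡 (2 * n + 1))) (𝓡∂ 1) ∞
      (fun x : (ℝ × ℝ) × P => projUnit x.1.2) (unitSquare ×ˢ Set.univ) :=
    _root_.contMDiffOn_projUnit.comp (contDiff_snd.contMDiff.comp_contMDiffOn h1) fun x hx => hx.1.2
  exact hh.comp_contMDiffOn (h2.prodMk (h3.prodMk contMDiffOn_snd))

theorem IsSmoothFamily.mdifferentiableWithinAt (hh : IsSmoothFamily h) {y : ℝ × ℝ}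
    (hy : y ∈ unitSquare) (p : P) :
    MDifferentiableWithinAt 𝓘(ℝ, ℝ × ℝ) (𝓡 (2 * n + 1))
      (fun y : ℝ × ℝ => h (projUnit y.1) (projUnit y.2) p) unitSquare y :=
  ((hh.contMDiffOn.comp ((contMDiff_id.prodMk contMDiff_const).contMDiffOn)
    fun y hy => ⟨hy, Set.mem_univ _⟩) y hy).mdifferentiableWithinAt (by simp)

theorem IsSmoothFamily.inv_mul (hh : IsSmoothFamily h) (γ : PreqPath B) :
    IsSmoothFamily (fun s => γ⁻¹ * h s) :=
  γ.smooth_inv.comp ((contMDiff_fst.comp contMDiff_snd).prodMk hh)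

/-- The value of the connection form on the derivative along the family. -/
noncomputable def connVariation (h : unitInterval → PreqPath B) (p : P) (s t : ℝ) : ℝ :=
  B.conn (h (projUnit s) (projUnit t) p) ![mfderivWithin 𝓘(ℝ, ℝ) (𝓡 (2 * n + 1))
    (fun s : ℝ => h (projUnit s) (projUnit t) p) (Set.Icc 0 1) s (1 : ℝ)]

/-- For a family of loops this provides the vanishing boundary terms at `t = 0` and `t = 1`. -/
theorem connVariation_eq_zero {p : P} {s t : ℝ} (hc : ∀ s, h s (projUnit t) p = p) :
    connVariation h p s t = 0 := by
  unfold connVariation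
  have h1 : (fun s : ℝ => h (projUnit s) (projUnit t) p) = fun _ => p := funext fun s => hc _
  rw [h1, mfderivWithin_const]
  exact (B.connLinear _).map_zero

variable [IsManifold (𝓡 (2 * n + 1)) ∞ P]

theorem IsSmoothFamily.contMDiffOn_connVelocity (hh : IsSmoothFamily h) :
    ContMDiffOn (𝓘(ℝ, ℝ × ℝ).prod (𝓡 (2 * n + 1))) 𝓘(ℝ, ℝ) ∞
      (fun x : (ℝ × ℝ) × P => (h (projUnit x.1.1)).connVelocity (projUnit x.1.2) x.2)
      (unitSquare ×ˢ Set.univ) := by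
  refine (DForm.contMDiffOn_apply_mfderivWithin B.smooth_conn uniqueDiffOn_unitSquare
    hh.contMDiffOn (0, 1)).congr fun x hx => ?_
  rw [connVelocity_projUnit _ hx.1.2]
  refine congrArg (B.conn _) ?_
  funext i; fin_cases i
  exact DForm.mfderivWithin_partial_snd (H := fun y : ℝ × ℝ => h (projUnit y.1) (projUnit y.2) x.2)
    (uniqueDiffOn_Icc zero_lt_one _ hx.1.2) hx.1.1 (hh.mdifferentiableWithinAt hx.1 x.2) 1

theorem IsSmoothFamily.contMDiffOn_connVelocityBase (hh : IsSmoothFamily h) :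
    ContMDiffOn (𝓘(ℝ, ℝ × ℝ).prod (𝓡 (2 * n))) 𝓘(ℝ, ℝ) ∞
      (fun x : (ℝ × ℝ) × M => (h (projUnit x.1.1)).connVelocityBase (projUnit x.1.2) x.2)
      (unitSquare ×ˢ Set.univ) :=
  B.contMDiffOn_descend hh.contMDiffOn_connVelocity fun _ _ p => connVelocityBase_proj _ _ p

theorem IsSmoothFamily.continuous_connVelocityBase (hh : IsSmoothFamily h) (s : unitInterval) :
    Continuous (fun q : unitInterval × M => (h s).connVelocityBase q.1 q.2) := by
  have h1 := hh.contMDiffOn_connVelocityBase.continuousOn.comp_continuous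
    (f := fun q : unitInterval × M => ((((s : ℝ), (q.1 : ℝ)) : ℝ × ℝ), q.2))
    (by fun_prop) fun q => ⟨⟨s.2, q.1.2⟩, Set.mem_univ _⟩
  simpa [Function.comp_def] using h1

theorem IsSmoothFamily.contDiffOn_connVariation (hh : IsSmoothFamily h) (p : P) {s : ℝ}
    (hs : s ∈ Set.Icc (0 : ℝ) 1) : ContDiffOn ℝ ∞ (connVariation h p s) (Set.Icc 0 1) := by
  have h1 := DForm.contMDiffOn_apply_mfderivWithin B.smooth_conn uniqueDiffOn_unitSquare
    hh.contMDiffOn (1, 0)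
  have h2 : ContMDiff 𝓘(ℝ, ℝ) (𝓘(ℝ, ℝ × ℝ).prod (𝓡 (2 * n + 1))) ∞
      (fun t : ℝ => (((s, t), p) : (ℝ × ℝ) × P)) :=
    (contDiff_const.prodMk contDiff_id).contMDiff.prodMk contMDiff_const
  have h3 := h1.comp (h2.contMDiffOn (s := Set.Icc 0 1)) fun t ht => ⟨⟨hs, ht⟩, Set.mem_univ _⟩
  refine h3.contDiffOn.congr fun t ht => ?_
  refine congrArg (B.conn _) ?_
  funext i; fin_cases i
  exact DForm.mfderivWithin_partial_fst (H := fun y : ℝ × ℝ => h (projUnit y.1) (projUnit y.2) p)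
    (uniqueDiffOn_Icc zero_lt_one _ hs) ht (hh.mdifferentiableWithinAt ⟨hs, ht⟩ p) 1

/-- The difference of the two sides is `dα(∂_s h, ∂_t h)`, and `∂_t h` vanishes at the parameter `s`
where the path is constant. -/
theorem IsSmoothFamily.fderivWithin_connVelocity (hh : IsSmoothFamily h) {s : ℝ}
    (hs : s ∈ Set.Icc (0 : ℝ) 1) (h1 : h (projUnit s) = 1) {t : ℝ} (ht : t ∈ Set.Icc (0 : ℝ) 1)
    (p : P) :
    fderivWithin ℝ (fun s => (h (projUnit s)).connVelocity (projUnit t) p) (Set.Icc 0 1) s 1 =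
      fderivWithin ℝ (connVariation h p s) (Set.Icc 0 1) t 1 := by
  have hU := uniqueDiffOn_Icc (zero_lt_one' ℝ)
  have hH : ContMDiffOn 𝓘(ℝ, ℝ × ℝ) (𝓡 (2 * n + 1)) ∞
      (fun y : ℝ × ℝ => h (projUnit y.1) (projUnit y.2) p) unitSquare :=
    hh.contMDiffOn.comp ((contMDiff_id.prodMk contMDiff_const).contMDiffOn)
      fun y hy => ⟨hy, Set.mem_univ _⟩
  have key := DForm.d_apply_partial B.smooth_conn hU hU unitSquare_subset_closure_interior
    hH hs ht (1 : ℝ) (1 : ℝ)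
  have h2 : (fun t : ℝ => h (projUnit s) (projUnit t) p) = fun _ => p := by
    rw [h1]; rfl
  have h3 : (fun s : ℝ => B.conn (h (projUnit s) (projUnit t) p) ![mfderivWithin 𝓘(ℝ, ℝ)
      (𝓡 (2 * n + 1)) (fun t : ℝ => h (projUnit s) (projUnit t) p) (Set.Icc 0 1) t (1 : ℝ)]) =
      fun s => (h (projUnit s)).connVelocity (projUnit t) p :=
    funext fun s => ((h (projUnit s)).connVelocity_projUnit ht p).symm
  have h4 : (mfderivWithin 𝓘(ℝ, ℝ) (𝓡 (2 * n + 1)) (fun t : ℝ => h (projUnit s) (projUnit t) p)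
      (Set.Icc 0 1) t (1 : ℝ) : EuclideanSpace ℝ (Fin (2 * n + 1))) = 0 := by
    rw [h2, mfderivWithin_const]
    rfl
  have h5 := (B.conn.d (h (projUnit s) (projUnit t) p)).map_coord_zero (m := ![mfderivWithin 𝓘(ℝ, ℝ)
      (𝓡 (2 * n + 1)) (fun s : ℝ => h (projUnit s) (projUnit t) p) (Set.Icc 0 1) s (1 : ℝ),
      mfderivWithin 𝓘(ℝ, ℝ) (𝓡 (2 * n + 1)) (fun t : ℝ => h (projUnit s) (projUnit t) p)
      (Set.Icc 0 1) t (1 : ℝ)]) 1 h4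
  have key2 := h5.symm.trans key
  rw [h3] at key2
  exact sub_eq_zero.1 key2.symm

end PreqPath

end Prequantum

section Prequantum

variable {n : ℕ} {M : Type*} [TopologicalSpace M] [CompactSpace M]
    [ChartedSpace (EuclideanSpace ℝ (Fin (2 * n))) M] [IsManifold (𝓡 (2 * n)) ∞ M]
    [MeasurableSpace M] [BorelSpace M] {Ω : SymplecticForm n M}
    {P : Type*} [TopologicalSpace P] [ChartedSpace (EuclideanSpace ℝ (Fin (2 * n + 1))) P]
    [IsManifold (𝓡 (2 * n + 1)) ∞ P] [MulAction Circle P] {B : PrequantumBundle Ω P}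

namespace PreqPath

theorem totalHamiltonian_eq_neg_integral (γ : PreqPath B) (t : unitInterval) :
    γ.totalHamiltonian t = -∫ x, γ.connVelocityBase t x ∂Ω.liouville := by
  rw [totalHamiltonian, ← (γ t).integral_comp_baseMap, ← integral_neg]
  simp only [hamiltonian_baseMap]

variable {h : unitInterval → PreqPath B}

theorem IsSmoothFamily.cal_eq_neg_integral_prod (hh : IsSmoothFamily h) (s : unitInterval) :
    (h s).cal = -∫ q : unitInterval × M, (h s).connVelocityBase q.1 q.2
      ∂(volume.prod Ω.liouville) := by
  have := Ω.isFiniteMeasure_liouville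
  have := ChartedSpace.secondCountable_of_sigmaCompact (EuclideanSpace ℝ (Fin (2 * n))) M
  rw [integral_prod _ (hh.continuous_connVelocityBase s).integrable_of_compactSpace, ← integral_neg]
  exact integral_congr_ae (Filter.Eventually.of_forall fun t =>
    (h s).totalHamiltonian_eq_neg_integral t)

/-- The derivative of `Cal` along a family of loops vanishes at the constant loop. -/
theorem IsSmoothFamily.hasDerivWithinAt_cal_of_eq_one (hh : IsSmoothFamily h) {s₀ : ℝ}
    (hs₀ : s₀ ∈ Set.Icc (0 : ℝ) 1) (h1 : h (projUnit s₀) = 1) (he : ∀ s, h s 1 = 1) :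
    HasDerivWithinAt (fun s : ℝ => (h (projUnit s)).cal) 0 (Set.Icc 0 1) s₀ := by
  have := Ω.isFiniteMeasure_liouville
  have := ChartedSpace.secondCountable_of_sigmaCompact (EuclideanSpace ℝ (Fin (2 * n))) M
  have hU := uniqueDiffOn_Icc (zero_lt_one' ℝ)
  have hF := hh.contMDiffOn_connVelocityBase
  set F : (ℝ × ℝ) × M → ℝ :=
    fun x => (h (projUnit x.1.1)).connVelocityBase (projUnit x.1.2) x.2 with hFdef
  have hF' := DForm.contMDiffOn_fderivWithin_apply uniqueDiffOn_unitSquare hF (1, 0)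
  set F' : (ℝ × ℝ) × M → ℝ :=
    fun x => fderivWithin ℝ (fun y => F (y, x.2)) unitSquare x.1 (1, 0) with hFdef'
  have hcont : ∀ G : (ℝ × ℝ) × M → ℝ, ContinuousOn G (unitSquare ×ˢ Set.univ) →
      ContinuousOn (Function.uncurry fun (s : ℝ) (q : unitInterval × M) => G ((s, q.1), q.2))
        (Set.Icc 0 1 ×ˢ Set.univ) := fun G hG =>
    hG.comp (f := fun q : ℝ × unitInterval × M => (((q.1, (q.2.1 : ℝ)) : ℝ × ℝ), q.2.2))
      (by fun_prop) fun q hq => ⟨⟨hq.1, q.2.1.2⟩, Set.mem_univ _⟩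
  have hslice : ∀ s ∈ Set.Icc (0 : ℝ) 1, ∀ t ∈ Set.Icc (0 : ℝ) 1, ∀ x : M,
      HasDerivWithinAt (fun s => F ((s, t), x)) (F' ((s, t), x)) (Set.Icc 0 1) s :=
    fun s hs t ht x => hasDerivWithinAt_slice hF (c := fun s : ℝ => (s, t))
      ((hasDerivWithinAt_id s _).prodMk (hasDerivWithinAt_const s _ t))
      (fun s hs => ⟨hs, ht⟩) hs x
  have hD := hasDerivWithinAt_integral_of_continuousOn (μ := volume.prod Ω.liouville)
    (hcont F hF.continuousOn) (hcont F' hF'.continuousOn)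
    (fun s hs q => hslice s hs q.1 q.1.2 q.2) hs₀
  -- Integrating over `t` first, for fixed `x`, the integrand is the `t`-derivative of
  -- `connVariation`, so only its values at the endpoints remain, and both are zero.
  have hzero : ∫ q : unitInterval × M, F' ((s₀, q.1), q.2) ∂(volume.prod Ω.liouville) = 0 := by
    have hI : Continuous (fun q : unitInterval × M => F' ((s₀, q.1), q.2)) :=
      (hcont F' hF'.continuousOn).comp_continuous (f := fun q => (s₀, q)) (by fun_prop)
        fun q => ⟨hs₀, Set.mem_univ _⟩
    rw [integral_prod_symm _ hI.integrable_of_compactSpace]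
    refine integral_eq_zero_of_ae (Filter.Eventually.of_forall fun x => ?_)
    obtain ⟨p, rfl⟩ := B.proj_surjective x
    have hG := hh.contDiffOn_connVariation p hs₀
    have hval : ∀ t ∈ Set.Icc (0 : ℝ) 1, HasDerivWithinAt (connVariation h p s₀)
        (F' ((s₀, t), B.proj p)) (Set.Icc 0 1) t := by
      intro t ht
      have h2 := hh.fderivWithin_connVelocity hs₀ h1 ht p
      have h3 : (fun s => (h (projUnit s)).connVelocity (projUnit t) p) =
          fun s => F ((s, t), B.proj p) := funext fun s => (connVelocityBase_proj _ _ p).symm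
      have h4 := (hslice s₀ hs₀ t ht (B.proj p)).derivWithin (hU s₀ hs₀)
      rw [h3] at h2
      rw [← h4]
      refine ((hG t ht).differentiableWithinAt (by simp)).hasDerivWithinAt.congr_deriv ?_
      exact h2.symm
    have hc : Continuous (fun t : ℝ => F' ((s₀, (projUnit t : ℝ)), B.proj p)) :=
      hI.comp (f := fun t => (projUnit t, B.proj p)) (continuous_projUnit.prodMk continuous_const)
    have hFTC := intervalIntegral.integral_eq_sub_of_hasDerivAt_of_le zero_le_one
      hG.continuousOn (f' := fun t => F' ((s₀, (projUnit t : ℝ)), B.proj p))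
      (fun t ht => by
        have ht' := Set.Ioo_subset_Icc_self ht
        simp only [coe_projUnit ht']
        exact (hval t ht').hasDerivAt (Icc_mem_nhds ht.1 ht.2)) (hc.intervalIntegrable _ _)
    have h5 : connVariation h p s₀ 1 = 0 := connVariation_eq_zero fun s => by
      rw [projUnit_one, he, Preq.one_apply]
    have h6 : connVariation h p s₀ 0 = 0 := connVariation_eq_zero fun s => by
      rw [projUnit_zero, (h s).map_zero, Preq.one_apply]
    refine (integral_unitInterval_eq fun t => F' ((s₀, (t : ℝ)), B.proj p)).trans (hFTC.trans ?_)
    rw [h5, h6, sub_zero]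
    rfl
  rw [hzero] at hD
  have hcal : ∀ s ∈ Set.Icc (0 : ℝ) 1, (h (projUnit s)).cal =
      -∫ q : unitInterval × M, F ((s, q.1), q.2) ∂(volume.prod Ω.liouville) := by
    intro s hs
    rw [hh.cal_eq_neg_integral_prod]
    simp only [hFdef, projUnit_coe]
  have := hD.neg
  rw [neg_zero] at this
  exact this.congr hcal (hcal s₀ hs₀)

/-- For fixed `s`, `Cal(h(s')) = Cal(h(s)) + Cal(h(s)⁻¹ h(s'))`, and `s' ↦ h(s)⁻¹ h(s')` is a family
of loops that is trivial at `s' = s`. So the derivative vanishes everywhere. -/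
theorem IsSmoothFamily.cal_eq (hh : IsSmoothFamily h) (he : ∀ s, h s 1 = h 0 1)
    (s : unitInterval) : (h s).cal = (h 0).cal := by
  have hd : ∀ s ∈ Set.Icc (0 : ℝ) 1,
      HasDerivWithinAt (fun s : ℝ => (h (projUnit s)).cal) 0 (Set.Icc 0 1) s := by
    intro s hs
    have h1 := (hh.inv_mul (h (projUnit s))).hasDerivWithinAt_cal_of_eq_one hs
      (inv_mul_cancel _) fun s' => by rw [mul_apply, inv_apply, he, he s', inv_mul_cancel]
    have h2 := h1.const_add (h (projUnit s)).cal
    refine h2.congr_of_mem (fun s' _ => ?_) hs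
    rw [← cal_mul, mul_inv_cancel_left]
  have hdiff : DifferentiableOn ℝ (fun s : ℝ => (h (projUnit s)).cal) (Set.Icc 0 1) :=
    fun s hs => (hd s hs).differentiableWithinAt
  have hc := constant_of_derivWithin_zero hdiff
    (fun s hs => (hd s (Set.Ico_subset_Icc_self hs)).derivWithin
      (uniqueDiffOn_Icc zero_lt_one s (Set.Ico_subset_Icc_self hs))) s s.2
  rw [projUnit_coe, projUnit_zero] at hc
  exact hc

theorem Homotopic.cal_eq {γ γ' : PreqPath B} : Homotopic γ γ' → γ.cal = γ'.cal := by
  rintro ⟨h, hh, rfl, rfl, he⟩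
  exact (IsSmoothFamily.cal_eq hh he 1).symm

end PreqPath

end Prequantum

/-! ### Paths of rotations and normalisation -/

section Prequantum

variable {n : ℕ} {M : Type*} [TopologicalSpace M]
    [ChartedSpace (EuclideanSpace ℝ (Fin (2 * n))) M] {Ω : SymplecticForm n M}
    {P : Type*} [TopologicalSpace P] [ChartedSpace (EuclideanSpace ℝ (Fin (2 * n + 1))) P]
    [MulAction Circle P]

theorem PrequantumBundle.contMDiff_exp_smul (B : PrequantumBundle Ω P) :
    ContMDiff (𝓘(ℝ, ℝ).prod (𝓡 (2 * n + 1))) (𝓡 (2 * n + 1)) ∞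
      (fun q : ℝ × P => Circle.exp q.1 • q.2) :=
  B.smooth_smul.comp ((contMDiff_circleExp.comp contMDiff_fst).prodMk contMDiff_snd)

/-- One-parameter group property: the orbit of `p` near time `c` is the orbit of `e^{ic} p` near
time `0`. -/
theorem PrequantumBundle.mfderiv_exp_smul (B : PrequantumBundle Ω P) (c : ℝ) (p : P) (r : ℝ) :
    (mfderiv 𝓘(ℝ, ℝ) (𝓡 (2 * n + 1)) (fun s : ℝ => Circle.exp s • p) c r :
      EuclideanSpace ℝ (Fin (2 * n + 1))) = r • fundamentalVector (Circle.exp c • p) := by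
  have h1 : (fun s : ℝ => Circle.exp s • p) =
      (fun s : ℝ => Circle.exp s • Circle.exp c • p) ∘ fun s => s - c := by
    funext s
    simp only [Function.comp_apply]
    rw [← mul_smul, ← Circle.exp_add, sub_add_cancel]
  have h2 : HasMFDerivAt 𝓘(ℝ, ℝ) 𝓘(ℝ, ℝ) (fun s : ℝ => s - c) c (ContinuousLinearMap.id ℝ ℝ) :=
    ((hasFDerivAt_id c).sub_const c).hasMFDerivAt
  have h3 : MDifferentiableAt 𝓘(ℝ, ℝ) (𝓡 (2 * n + 1))
      (fun s : ℝ => Circle.exp s • Circle.exp c • p) (c - c) :=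
    (B.contMDiff_exp_smul.comp (contMDiff_id.prodMk contMDiff_const)).mdifferentiable (by simp) _
  have h4 := (HasMFDerivAt.comp (f := fun s : ℝ => s - c) c h3.hasMFDerivAt h2).mfderiv
  rw [← h1] at h4
  rw [h4]
  -- The base time `c - c` also occurs in the type of the derivative, so it is replaced by `0`
  -- through a variable.
  have h5 : ∀ d : ℝ, d = 0 → (mfderiv 𝓘(ℝ, ℝ) (𝓡 (2 * n + 1))
      (fun s : ℝ => Circle.exp s • Circle.exp c • p) d r : EuclideanSpace ℝ (Fin (2 * n + 1))) =
      r • fundamentalVector (Circle.exp c • p) := by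
    rintro _ rfl
    have h6 := (mfderiv 𝓘(ℝ, ℝ) (𝓡 (2 * n + 1))
      (fun s : ℝ => Circle.exp s • Circle.exp c • p) 0).map_smul r (1 : ℝ)
    exact (congrArg (mfderiv 𝓘(ℝ, ℝ) (𝓡 (2 * n + 1))
      (fun s : ℝ => Circle.exp s • Circle.exp c • p) 0) (mul_one r).symm).trans h6
  exact h5 _ (sub_self c)

namespace PreqPath

variable {B : PrequantumBundle Ω P} {C : ℝ → ℝ}

theorem contMDiff_comp_coe_of_contDiffOn (hC : ContDiffOn ℝ ∞ C (Set.Icc 0 1)) :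
    ContMDiff (𝓡∂ 1) 𝓘(ℝ, ℝ) ∞ (fun t : unitInterval => C t) :=
  hC.contMDiffOn.comp_contMDiff (contMDiff_subtypeVal_Icc (x := (0 : ℝ)) (y := 1)) fun t => t.2

/-- The path of rotations `t ↦ e^{i C(t)}`. -/
noncomputable def rotationAlong (B : PrequantumBundle Ω P)
    (hC : ContDiffOn ℝ ∞ C (Set.Icc 0 1)) (h0 : C 0 = 0) : PreqPath B where
  toFun t := Preq.rotation B (Circle.exp (C t))
  smooth := B.contMDiff_exp_smul.comp
    (((contMDiff_comp_coe_of_contDiffOn hC).comp contMDiff_fst).prodMk contMDiff_snd)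
  smooth_inv := by
    have h := B.contMDiff_exp_smul.comp
      (((contMDiff_comp_coe_of_contDiffOn hC.neg).comp (contMDiff_fst (I := 𝓡∂ 1)
        (J := 𝓡 (2 * n + 1)) (M := unitInterval) (N := P))).prodMk contMDiff_snd)
    simpa only [Function.comp_def, Circle.exp_neg, Preq.rotation_inv_apply] using h
  map_zero := Preq.ext_apply fun p => by simp [h0]

theorem rotationPath_eq_rotationAlong (τ : ℝ) : rotationPath B τ =
    rotationAlong B (C := fun t => t * τ) (contDiff_id.mul contDiff_const).contDiffOn
      (zero_mul τ) := rfl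

theorem connVelocity_rotationAlong (hC : ContDiffOn ℝ ∞ C (Set.Icc 0 1)) (h0 : C 0 = 0)
    (t : unitInterval) (p : P) :
    (rotationAlong B hC h0).connVelocity t p = derivWithin C (Set.Icc 0 1) t := by
  have hU := uniqueDiffOn_Icc (zero_lt_one' ℝ) t t.2
  have h1 : (fun s : ℝ => rotationAlong B hC h0 (projUnit s) p) =
      fun s : ℝ => Circle.exp (C (projUnit s)) • p := rfl
  have h2 : mfderivWithin 𝓘(ℝ, ℝ) (𝓡 (2 * n + 1))
      (fun s : ℝ => Circle.exp (C (projUnit s)) • p) (Set.Icc 0 1) t =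
      mfderivWithin 𝓘(ℝ, ℝ) (𝓡 (2 * n + 1))
        ((fun s : ℝ => Circle.exp s • p) ∘ C) (Set.Icc 0 1) t :=
    mfderivWithin_congr (fun s hs => by rw [coe_projUnit hs]; rfl)
      (by rw [coe_projUnit t.2]; rfl)
  have h3 := mfderiv_comp_mfderivWithin (I := 𝓘(ℝ, ℝ)) (I' := 𝓘(ℝ, ℝ)) (I'' := 𝓡 (2 * n + 1))
    (g := fun s : ℝ => Circle.exp s • p) (f := C) (s := Set.Icc 0 1) (t : ℝ)
    ((B.contMDiff_exp_smul.comp (contMDiff_id.prodMk contMDiff_const)).mdifferentiable (by simp) _)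
    ((hC t t.2).differentiableWithinAt (by simp)).mdifferentiableWithinAt hU.uniqueMDiffWithinAt
  have h4 : ((rotationAlong B hC h0).velocity t p : EuclideanSpace ℝ (Fin (2 * n + 1))) =
      derivWithin C (Set.Icc 0 1) t • fundamentalVector (Circle.exp (C t) • p) := by
    rw [velocity_eq, h1, h2, h3, ← B.mfderiv_exp_smul, mfderivWithin_eq_fderivWithin,
      ← fderivWithin_derivWithin]
    rfl
  have h5 := (B.connLinear (Circle.exp (C t) • p)).map_smul (derivWithin C (Set.Icc 0 1) t)
    (fundamentalVector (Circle.exp (C t) • p))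
  have h6 : B.connLinear (Circle.exp (C t) • p) (fundamentalVector (Circle.exp (C t) • p)) = 1 :=
    B.conn_fundamentalVector _
  rw [h6, smul_eq_mul, mul_one] at h5
  refine Eq.trans (congrArg (B.conn _) ?_) h5
  funext i; fin_cases i
  exact h4

theorem hamiltonian_rotationAlong (hC : ContDiffOn ℝ ∞ C (Set.Icc 0 1)) (h0 : C 0 = 0)
    (t : unitInterval) (x : M) :
    (rotationAlong B hC h0).hamiltonian t x = -derivWithin C (Set.Icc 0 1) t := by
  obtain ⟨p, rfl⟩ := B.proj_surjective x
  rw [hamiltonian_proj, connVelocity_rotationAlong]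

theorem totalHamiltonian_rotationAlong [MeasurableSpace M] (hC : ContDiffOn ℝ ∞ C (Set.Icc 0 1))
    (h0 : C 0 = 0) (t : unitInterval) : (rotationAlong B hC h0).totalHamiltonian t =
      -derivWithin C (Set.Icc 0 1) t * Ω.liouville.real Set.univ := by
  simp only [totalHamiltonian, hamiltonian_rotationAlong, integral_const, smul_eq_mul]
  ring

theorem cal_rotationPath [MeasurableSpace M] (τ : ℝ) :
    (rotationPath B τ).cal = -τ * Ω.liouville.real Set.univ := by
  have h1 : ∀ t : unitInterval, (rotationPath B τ).totalHamiltonian t =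
      -τ * Ω.liouville.real Set.univ := by
    intro t
    rw [rotationPath_eq_rotationAlong, totalHamiltonian_rotationAlong]
    have h2 : HasDerivWithinAt (fun t : ℝ => t * τ) τ (Set.Icc 0 1) t := by
      simpa using (hasDerivWithinAt_id (t : ℝ) (Set.Icc 0 1)).mul_const τ
    rw [h2.derivWithin (uniqueDiffOn_Icc zero_lt_one t t.2)]
  rw [cal_eq_intervalIntegral]
  simp [h1]

theorem IsNormalised.cal_eq_zero [MeasurableSpace M] {γ : PreqPath B} (h : γ.IsNormalised) : γ.cal = 0 := by
  rw [cal, integral_congr_ae (Filter.Eventually.of_forall h)]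
  exact integral_zero _ _

/-- Multiplying by a loop of rotations of degree zero does not change the homotopy class. -/
theorem homotopic_rotationAlong_mul (hC : ContDiffOn ℝ ∞ C (Set.Icc 0 1)) (h0 : C 0 = 0)
    (h1 : C 1 = 0) (γ : PreqPath B) : Homotopic (rotationAlong B hC h0 * γ) γ := by
  -- The angle function is contracted linearly to zero; its values at `t = 0` and `t = 1` remain
  -- zero, so the endpoints stay fixed.
  have hC' : ∀ s : unitInterval, ContDiffOn ℝ ∞ (fun t => (1 - (s : ℝ)) * C t) (Set.Icc 0 1) :=
    fun s => contDiffOn_const.mul hC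
  refine ⟨fun s => rotationAlong B (hC' s) (by simp [h0]) * γ, ?_, ?_, ?_, fun s => ?_⟩
  · have hs : ContMDiff ((𝓡∂ 1).prod ((𝓡∂ 1).prod (𝓡 (2 * n + 1)))) 𝓘(ℝ, ℝ) ∞
        (fun q : unitInterval × unitInterval × P => 1 - (q.1 : ℝ)) :=
      ((contMDiff_comp_coe_of_contDiffOn (C := fun t => 1 - t)
        (contDiff_const.sub contDiff_id).contDiffOn).comp contMDiff_fst)
    have ht : ContMDiff ((𝓡∂ 1).prod ((𝓡∂ 1).prod (𝓡 (2 * n + 1)))) 𝓘(ℝ, ℝ) ∞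
        (fun q : unitInterval × unitInterval × P => C (q.2.1 : ℝ)) :=
      (contMDiff_comp_coe_of_contDiffOn hC).comp (contMDiff_fst.comp contMDiff_snd)
    exact B.contMDiff_exp_smul.comp ((hs.mul ht).prodMk (γ.smooth.comp contMDiff_snd))
  · refine PreqPath.ext (funext fun t => Preq.ext_apply fun p => ?_)
    simp [rotationAlong]
  · refine PreqPath.ext (funext fun t => Preq.ext_apply fun p => ?_)
    simp [rotationAlong]
  · refine Preq.ext_apply fun p => ?_
    simp [rotationAlong, h1]

end PreqPath

variable [CompactSpace M] [IsManifold (𝓡 (2 * n)) ∞ M] [MeasurableSpace M] [BorelSpace M]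
  [IsManifold (𝓡 (2 * n + 1)) ∞ P] {B : PrequantumBundle Ω P}

namespace PreqPath

theorem continuous_totalHamiltonian_projUnit (γ : PreqPath B) :
    Continuous (fun t => γ.totalHamiltonian (projUnit t)) := by
  have h := γ.contDiffOn_totalHamiltonian.continuousOn.comp_continuous
    (f := fun t => ((projUnit t : unitInterval) : ℝ))
    (continuous_subtype_val.comp continuous_projUnit) fun t => (projUnit t).2
  simpa [Function.comp_def] using h

/-- Left multiplication by the rotations `e^{iC(t)}` subtracts `C'(t) μ(M)` from the total
Hamiltonian, so `C` is forced; the hypothesis `Cal(γ) = 0` is what closes the rotation path with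
`C(1) = 0`. -/
theorem exists_homotopic_isNormalised [Nonempty M] {γ : PreqPath B} (h : γ.cal = 0) :
    ∃ γ' : PreqPath B, Homotopic γ' γ ∧ γ'.IsNormalised := by
  set V := Ω.liouville.real Set.univ with hV
  have hVpos : 0 < V := ENNReal.toReal_pos Ω.liouville_univ_pos.ne' Ω.liouville_univ_lt_top.ne
  let C : ℝ → ℝ := fun t => (∫ s in (0 : ℝ)..t, γ.totalHamiltonian (projUnit s)) / V
  have hd : ∀ t, HasDerivAt C (γ.totalHamiltonian (projUnit t) / V) t := fun t =>
    (γ.continuous_totalHamiltonian_projUnit.integral_hasStrictDerivAt 0 t).hasDerivAt.div_const V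
  have hU := uniqueDiffOn_Icc (zero_lt_one' ℝ)
  have hC : ContDiffOn ℝ ∞ C (Set.Icc 0 1) := by
    rw [contDiffOn_infty_iff_derivWithin hU]
    refine ⟨fun t _ => (hd t).differentiableAt.differentiableWithinAt, ?_⟩
    -- Smoothness of `C` is that of its derivative, the total Hamiltonian divided by `μ(M)`.
    exact (γ.contDiffOn_totalHamiltonian.div_const V).congr fun t ht =>
      (hd t).hasDerivWithinAt.derivWithin (hU t ht)
  have h0 : C 0 = 0 := by simp [C]
  have h1 : C 1 = 0 := by
    simp only [C]
    rw [← cal_eq_intervalIntegral, h, zero_div]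
  refine ⟨_, homotopic_rotationAlong_mul hC h0 h1 γ, fun t => ?_⟩
  refine (totalHamiltonian_mul _ _ t).trans ?_
  rw [totalHamiltonian_rotationAlong, (hd t).hasDerivWithinAt.derivWithin (hU t t.2), projUnit_coe,
    ← hV, neg_mul, div_mul_cancel₀ _ hVpos.ne', neg_add_cancel]

/-- The Calabi morphism on the group of paths. -/
noncomputable def calHom (B : PrequantumBundle Ω P) : PreqPath B →* Multiplicative ℝ :=
  MonoidHom.mk' (fun γ => Multiplicative.ofAdd γ.cal) fun γ γ' => by rw [cal_mul, ofAdd_add]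

end PreqPath

/-- The Calabi morphism on the universal cover. -/
noncomputable def PreqCover.calHom (B : PrequantumBundle Ω P) :
    PreqCover B →* Multiplicative ℝ :=
  (PreqPath.homotopyCon B).lift (PreqPath.calHom B) fun _ _ h =>
    congrArg Multiplicative.ofAdd (PreqPath.Homotopic.cal_eq h)

end Prequantum

theorem mainTheorem8 {n : ℕ} {M : Type*} [TopologicalSpace M] [T2Space M] [CompactSpace M]
    [ConnectedSpace M] [ChartedSpace (EuclideanSpace ℝ (Fin (2 * n))) M]
    [IsManifold (𝓡 (2 * n)) ∞ M] [MeasurableSpace M] [BorelSpace M]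
    (Ω : SymplecticForm n M)
    {P : Type*} [TopologicalSpace P] [T2Space P]
    [ChartedSpace (EuclideanSpace ℝ (Fin (2 * n + 1))) P]
    [IsManifold (𝓡 (2 * n + 1)) ∞ P] [MulAction Circle P] (B : PrequantumBundle Ω P) :
    -- the Liouville measure is finite and nonzero, and every path has exactly one generating
    -- Hamiltonian
    (0 < Ω.liouville Set.univ ∧ Ω.liouville Set.univ < ⊤) ∧
    (∀ (γ : PreqPath B) (f : unitInterval → M → ℝ),
      γ.IsGeneratingHamiltonian f ↔ f = γ.hamiltonian) ∧
    -- `Cal` is a group morphism on paths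
    (∀ γ γ' : PreqPath B, (γ * γ').cal = γ.cal + γ'.cal) ∧
    -- it descends to a group morphism on the universal cover, with the following properties
    ∃ Cal : PreqCover B →* Multiplicative ℝ,
      (∀ γ : PreqPath B, (Cal (PreqCover.mk B γ)).toAdd = γ.cal) ∧
      (∀ τ : ℝ, (Cal (PreqCover.R B (Multiplicative.ofAdd τ))).toAdd =
        -τ * Ω.liouville.real Set.univ) ∧
      (∀ g : PreqCover B, (Cal g).toAdd = 0 ↔
        ∃ γ : PreqPath B, PreqCover.mk B γ = g ∧ γ.IsNormalised) := by
  refine ⟨⟨Ω.liouville_univ_pos, Ω.liouville_univ_lt_top⟩,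
    PreqPath.isGeneratingHamiltonian_iff, PreqPath.cal_mul, PreqCover.calHom B, fun _ => rfl,
    PreqPath.cal_rotationPath, fun g => ⟨fun h => ?_, ?_⟩⟩
  · obtain ⟨γ, rfl⟩ := (PreqPath.homotopyCon B).mk'_surjective g
    obtain ⟨γ', hγ', hn⟩ := PreqPath.exists_homotopic_isNormalised (γ := γ) h
    exact ⟨γ', (PreqPath.homotopyCon B).eq.2 hγ', hn⟩
  · rintro ⟨γ, rfl, hn⟩
    exact hn.cal_eq_zero
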